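/- Let $X$ be a connected non-compact Riemann surface with a complete conformal metric $g_X$ of curvature $-1$; locally $g_X=g_X(z)|dz|^2$, $\omega_X=\frac{\sqrt{-1}}{2}g_X(z)\,dz\wedge d\bar z$, $\Delta_{g_X}=\frac{4}{g_X(z)}\partial_z\partial_{\bar z}$, and $\Lambda_{\omega_X}$ is the contraction with $\omega_X$. Let $(E,\theta)$ be a Higgs bundle of rank $n$ over $X$ which is generically regular nilpotent, i.e. $\theta^n=0$ and $\theta^{n-1}\neq 0$. For $0\le k\le n$ let $G_k\subset E$ be the holomorphic subbundle generated by the subsheaf $\ker\theta^{n-k}$, so that $E=G_0\supset G_1\supset\dots\supset G_n=0$; in particular $E/G_k$ is a holomorphic vector bundle of rank $k$. Put $L_i=G_{i-1}/G_i$ for $1\le i\le n$, and let $\gamma_i:L_i\to L_{i+1}\otimes K_X$ be induced by $\theta$ for $1\le i\le n-1$. A smooth Hermitian metric $h$ on $E$ induces metrics on $E/G_k\cong G_k^{\perp}$, hence on $\det(E/G_k)$, and metrics $h_i$ on $L_i\cong G_{i-1}\cap G_i^\perp$. Let $F_{\det(E/G_k)}$ be the Chern curvature of $\det(E/G_k)$.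 In local holomorphic frames $s_i$ of $L_i$ write $h_i(z)=h_i(s_i,s_i)$ and $\gamma_i(s_i)=\gamma_i(z)\,s_{i+1}\otimes dz$, and set $$\|\gamma_i\|^2_{h,g_X}=\frac{2|\gamma_i(z)|^2h_i(z)^{-1}h_{i+1}(z)}{g_X(z)}.$$ The metric $h$ is called harmonic if $F(\nabla_h)+[\theta,\theta^{*_h}]=0$, where $\nabla_h$ is the Chern connection of $h$. Let $\tilde h=(\tilde h_1,\dots,\tilde h_n)$ be any smooth Hermitian metrics on $L_1,\dots,L_n$ with $\sqrt{-1}F(\nabla_{\tilde h_i})=\frac{n+1-2i}{2}\omega_X$ and $\det\tilde h=\det h$ (under $L_1\otimes\cdots\otimes L_n\cong\det E$). Define $\|\gamma_i\|^2_{\tilde h,g_X}$ in the same way, with $\tilde h$ in place of $h$. Write $h_i=e^{w_i}\tilde h_i$ and $u_i=-\sum_{k=1}^i w_k$ for $0\le i\le n$. 1. If $h$ is harmonic, then $$-\sqrt{-1}\Lambda_{\omega_X}F_{\det(E/G_k)}+\|\gamma_k\|^2_{h,g_X}\le 0,\qquad k=1,\dots,n-1,$$ and, for every such $\tilde h$,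 the $u_i$ are smooth, $u_0=u_n=0$, and they form a subsolution of the Toda-type system: $$\Delta_{g_X}u_i+i(n-i)-2\|\gamma_i\|^2_{\tilde h,g_X}\,e^{2u_i-u_{i-1}-u_{i+1}}\ge 0,\qquad i=1,\dots,n-1.$$ 2. Suppose that $(E,\theta)$ is a complex variation of Hodge structure (CVHS) of type $(1,\dots,1)$: $E=L'_1\oplus\dots\oplus L'_n$ with holomorphic line subbundles $L'_i$, where $\theta$ maps $L'_i$ to $L'_{i+1}\otimes K_X$ and is not identically zero on $L'_i$ for $i<n$, and $\theta|_{L'_n}=0$. (Here generic regular nilpotency need not be assumed separately.) If $h$ is harmonic and diagonal, i.e. the $L'_i$ are mutually $h$-orthogonal, then all the inequalities in part 1 are equalities. 3. For a generically regular nilpotent $(E,\theta)$, every smooth Hermitian metric $h$ on $E$ (harmonic or not), every $\tilde h$ as above and every $k=1,\dots,n-1$, the two inequalities of part 1 with index $k$ are equivalent to each other at each point of $X$, and so are the corresponding equalities. -/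

import Mathlib

open Bundle Set Filter Manifold
open scoped Manifold ContDiff Topology ENNReal Bundle

noncomputable section

namespace HiggsBundle

/-! ### Wirtinger derivatives -/

/-- `∂f/∂z = (∂f/∂x - i ∂f/∂y) / 2`. -/
def wirtinger (f : ℂ → ℂ) (z : ℂ) : ℂ :=
  (fderiv ℝ f z 1 - Complex.I * fderiv ℝ f z Complex.I) / 2

/-- `∂f/∂z̄ = (∂f/∂x + i ∂f/∂y) / 2`. -/
def wirtingerBar (f : ℂ → ℂ) (z : ℂ) : ℂ :=
  (fderiv ℝ f z 1 + Complex.I * fderiv ℝ f z Complex.I) / 2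

/-- Entrywise `∂/∂z` of a matrix-valued function. -/
def matrixWirtinger {n : ℕ} (M : ℂ → Matrix (Fin n) (Fin n) ℂ) (z : ℂ) :
    Matrix (Fin n) (Fin n) ℂ :=
  Matrix.of fun i j => wirtinger (fun ζ => M ζ i j) z

/-- Entrywise `∂/∂z̄` of a matrix-valued function. -/
def matrixWirtingerBar {n : ℕ} (M : ℂ → Matrix (Fin n) (Fin n) ℂ) (z : ℂ) :
    Matrix (Fin n) (Fin n) ℂ :=
  Matrix.of fun i j => wirtingerBar (fun ζ => M ζ i j) z

/-! ### Orthogonal projections -/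

section Projection

variable {V : Type*} [AddCommGroup V] [Module ℂ V] [FiniteDimensional ℂ V]

/-- The orthogonal projection onto the orthogonal complement of `W`, for an inner product `c`. -/
def orthProj (c : InnerProductSpace.Core ℂ V) (W : Submodule ℂ V) : V →ₗ[ℂ] V :=
  letI := c.toNormedAddCommGroup
  letI : InnerProductSpace ℂ V := InnerProductSpace.ofCore c.toCore
  Wᗮ.starProjection.toLinearMap

theorem sub_orthProj_mem (c : InnerProductSpace.Core ℂ V) (W : Submodule ℂ V) (v : V) :
    v - orthProj c W v ∈ W := by
  let _ := c.toNormedAddCommGroup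
  let _ : InnerProductSpace ℂ V := InnerProductSpace.ofCore c.toCore
  have key : v - Wᗮ.starProjection v ∈ Wᗮᗮ := Submodule.sub_starProjection_mem_orthogonal v
  rw [Submodule.orthogonal_orthogonal] at key
  exact key

theorem inner_orthProj (c : InnerProductSpace.Core ℂ V) (W : Submodule ℂ V) (v : V) {w : V}
    (hw : w ∈ W) : c.inner w (orthProj c W v) = 0 := by
  let _ := c.toNormedAddCommGroup
  let _ : InnerProductSpace ℂ V := InnerProductSpace.ofCore c.toCore
  have key : Wᗮ.starProjection v ∈ Wᗮ := Submodule.starProjection_apply_mem _ v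
  exact (Submodule.mem_orthogonal W _).1 key w hw

end Projection

/-! ### Riemann surfaces and conformal metrics -/

section Surface

variable {X : Type*} [TopologicalSpace X] [ChartedSpace ℂ X]

/-- The coordinate vector `∂/∂z ∈ T_x X` of a coordinate `z = e`: the tangent vector that
the differential of `e` at `x` sends to `1`. -/
def coordVec (e : OpenPartialHomeomorph X ℂ) (x : X) : TangentSpace 𝓘(ℂ, ℂ) x :=
  (mfderiv 𝓘(ℂ, ℂ) 𝓘(ℂ, ℂ) e x).inverse (1 : ℂ)

/-- `∂_z ∂_{z̄} f` at `x`, in the coordinate `z = e`, for a real-valued function `f`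
(real for twice continuously differentiable `f`). -/
def ddbar (e : OpenPartialHomeomorph X ℂ) (f : X → ℝ) (x : X) : ℝ :=
  (wirtinger (wirtingerBar fun z => ((f (e.symm z) : ℝ) : ℂ)) (e x)).re

variable (X) in
/-- A smooth conformal (equivalently, Kähler) metric on a Riemann surface, `sq x v` being the
square of the length of the tangent vector `v`. In a coordinate `z = x + i y` it is
`g(z) |dz|²` with `g(z) = sq (∂/∂z)`, the complex tangent vector `∂/∂z` standing for the real
one `∂/∂x`. -/
structure ConformalMetric [IsManifold 𝓘(ℂ, ℂ) ω X] where
  sq : ∀ x : X, TangentSpace 𝓘(ℂ, ℂ) x → ℝ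
  sq_smul : ∀ (x : X) (c : ℂ) (v : TangentSpace 𝓘(ℂ, ℂ) x), sq x (c • v) = ‖c‖ ^ 2 * sq x v
  sq_pos : ∀ (x : X) (v : TangentSpace 𝓘(ℂ, ℂ) x), v ≠ 0 → 0 < sq x v
  smooth : ∀ e ∈ IsManifold.maximalAtlas 𝓘(ℂ, ℂ) ω X,
    ContMDiffOn 𝓘(ℝ, ℂ) 𝓘(ℝ, ℝ) ∞ (fun x => sq x (coordVec e x)) e.source

namespace ConformalMetric

variable [IsManifold 𝓘(ℂ, ℂ) ω X] (g : ConformalMetric X)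

/-- The coefficient `g(z)` of `g = g(z) |dz|²` in the coordinate `z = e`. -/
def density (e : OpenPartialHomeomorph X ℂ) (x : X) : ℝ := g.sq x (coordVec e x)

/-- The Laplacian `(4 / g(z)) ∂_z ∂_{z̄} f`; it does not depend on the coordinate `z`, and the
preferred one at `x` is used. -/
def laplacian (f : X → ℝ) (x : X) : ℝ :=
  4 / g.density (chartAt ℂ x) x * ddbar (chartAt ℂ x) f x

/-- The contracted curvature `√-1 Λ_ω F` at `x` of a Hermitian holomorphic line bundle that has
a holomorphic frame `σ` near `x` with `|σ|² = N`. Here `F = ∂̄∂ log N = -∂_z∂_{z̄} log N dz ∧ dz̄`,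
`ω = (√-1/2) g(z) dz ∧ dz̄` and `Λ_ω ω = 1`, so that `√-1 Λ_ω F = -(2 / g(z)) ∂_z∂_{z̄} log N`. -/
def contractedCurvature (N : X → ℝ) (x : X) : ℝ :=
  -(2 / g.density (chartAt ℂ x) x * ddbar (chartAt ℂ x) (fun y => Real.log (N y)) x)

/-- The Gauss curvature `-(2 / g(z)) ∂_z∂_{z̄} log g(z)`. -/
def gaussCurvature (x : X) : ℝ :=
  -(2 / g.density (chartAt ℂ x) x *
    ddbar (chartAt ℂ x) (fun y => Real.log (g.density (chartAt ℂ x) y)) x)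

/-- The length of the restriction to `[0, 1]` of a path. -/
def length (γ : ℝ → X) : ℝ≥0∞ :=
  ∫⁻ t in Icc (0 : ℝ) 1,
    ENNReal.ofReal (Real.sqrt (g.sq (γ t) (mfderiv 𝓘(ℝ, ℝ) 𝓘(ℝ, ℂ) γ t (1 : ℝ))))

/-- The distance of `g`: the infimum of the lengths of `C¹` paths. -/
def dist (x y : X) : ℝ≥0∞ :=
  ⨅ (γ : ℝ → X) (_ : ContMDiff 𝓘(ℝ, ℝ) 𝓘(ℝ, ℂ) 1 γ) (_ : γ 0 = x) (_ : γ 1 = y), g.length γ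

/-- Every Cauchy sequence for the distance of `g` converges. -/
def IsComplete : Prop :=
  ∀ u : ℕ → X, (∀ ε : ℝ≥0∞, 0 < ε → ∃ N, ∀ p ≥ N, ∀ q ≥ N, g.dist (u p) (u q) < ε) →
    ∃ x, Tendsto u atTop (𝓝 x)

/-- `g` is a complete hyperbolic metric: complete of constant curvature `-1`. -/
def IsCompleteHyperbolic : Prop :=
  g.IsComplete ∧ ∀ x, g.gaussCurvature x = -1

end ConformalMetric

end Surface

/-! ### Holomorphic vector bundles

A holomorphic vector bundle of rank `n` over the Riemann surface `X` is a Mathlib vector bundle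
`E` with model fibre `ℂⁿ` whose coordinate changes are complex analytic. -/

variable {X : Type*} [TopologicalSpace X] [ChartedSpace ℂ X]
  {n : ℕ} {E : X → Type*}
  [TopologicalSpace (TotalSpace (Fin n → ℂ) E)]
  [∀ x, TopologicalSpace (E x)] [∀ x, AddCommGroup (E x)] [∀ x, Module ℂ (E x)]
  [FiberBundle (Fin n → ℂ) E]

variable (n) in
/-- `s` restricts to a holomorphic section of `E` on `U`. -/
def IsHolomorphicOn (s : ∀ x, E x) (U : Set X) : Prop :=
  ContMDiffOn 𝓘(ℂ, ℂ) (𝓘(ℂ, ℂ).prod 𝓘(ℂ, Fin n → ℂ)) ω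
    (fun x => TotalSpace.mk' (Fin n → ℂ) x (s x)) U

variable (n) in
/-- For families of subspaces `B x ≤ A x` of the fibres of `E` (holomorphic subbundles in all
uses): the sections `s 0, …, s (r - 1)` of `A` are holomorphic on the open set `U`, and their
classes are a frame of the quotient bundle `A / B` over `U`. For `A = ⊤`, `B = ⊥` this is a
holomorphic frame of `E`. -/
structure IsHolomorphicFrame (A B : ∀ x, Submodule ℂ (E x)) {r : ℕ} (U : Set X)
    (s : Fin r → ∀ x, E x) : Prop where
  isOpen : IsOpen U
  holomorphic : ∀ i, IsHolomorphicOn n (s i) U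
  mem : ∀ i, ∀ x ∈ U, s i x ∈ A x
  linearIndependent : ∀ x ∈ U, LinearIndependent ℂ fun i => (B x).mkQ (s i x)
  span : ∀ x ∈ U, A x ≤ Submodule.span ℂ (range fun i => s i x) ⊔ B x

/-! ### Higgs fields -/

variable (n E) in
/-- A Higgs field on `E`: a holomorphic one-form with values in `End E`, i.e. for every tangent
vector `v` at `x` an endomorphism `field x v` of `E x`, linear in `v`, such that
`θ(∂/∂z) s` is holomorphic for every local coordinate `z` and local holomorphic section `s`. -/
structure HiggsField [IsManifold 𝓘(ℂ, ℂ) ω X] where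
  field : ∀ x : X, TangentSpace 𝓘(ℂ, ℂ) x →ₗ[ℂ] Module.End ℂ (E x)
  holomorphic : ∀ e ∈ IsManifold.maximalAtlas 𝓘(ℂ, ℂ) ω X, ∀ U : Set X, IsOpen U → U ⊆ e.source →
    ∀ s : ∀ x, E x, IsHolomorphicOn n s U →
      IsHolomorphicOn n (fun x => field x (coordVec e x) (s x)) U

namespace HiggsField

variable [IsManifold 𝓘(ℂ, ℂ) ω X] (θ : HiggsField n E)

/-- `θⁿ = 0` and `θⁿ⁻¹ ≠ 0`, with `n` the rank of `E`. -/
def IsGenericallyRegularNilpotent : Prop :=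
  (∀ x v, θ.field x v ^ n = 0) ∧ ∃ x v, θ.field x v ^ (n - 1) ≠ 0

variable [VectorBundle ℂ (Fin n → ℂ) E] [ContMDiffVectorBundle ω (Fin n → ℂ) E 𝓘(ℂ, ℂ)]

/-- The fibre at `x` of the subbundle `G_k` generated by the subsheaf `ker θⁿ⁻ᵏ` of `E`:
the values at `x` of the sections of that sheaf near `x`. -/
def filtration (k : ℕ) (x : X) : Submodule ℂ (E x) where
  carrier := {v | ∃ (U : Set X) (s : ∀ y, E y), IsOpen U ∧ x ∈ U ∧ IsHolomorphicOn n s U ∧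
    (∀ y ∈ U, ∀ t, (θ.field y t ^ (n - k)) (s y) = 0) ∧ s x = v}
  zero_mem' := ⟨univ, fun _ => 0, isOpen_univ, mem_univ x,
    (Bundle.contMDiff_zeroSection ℂ E).contMDiffOn, fun _ _ _ => map_zero _, rfl⟩
  add_mem' := by
    rintro _ _ ⟨U, s, hU, hxU, hs, hs', rfl⟩ ⟨V, t, hV, hxV, ht, ht', rfl⟩
    refine ⟨U ∩ V, fun y => s y + t y, hU.inter hV, ⟨hxU, hxV⟩, ?_, ?_, rfl⟩
    · exact (hs.mono inter_subset_left).add_section (ht.mono inter_subset_right)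
    · intro y hy τ
      rw [map_add, hs' y hy.1, ht' y hy.2, add_zero]
  smul_mem' := by
    rintro c _ ⟨U, s, hU, hxU, hs, hs', rfl⟩
    refine ⟨U, fun y => c • s y, hU, hxU, ?_, ?_, rfl⟩
    · exact hs.const_smul_section
    · intro y hy τ
      rw [map_smul, hs' y hy, smul_zero]

/-- `(E, θ)` is a complex variation of Hodge structure of type `(1, …, 1)` through the
decomposition `E = L 0 ⊕ … ⊕ L (n - 1)`: the `L i` are holomorphic line subbundles, `θ` maps
`L i` to `L (i + 1) ⊗ K_X` by a map that is not identically zero, and kills `L (n - 1)`. -/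
structure IsCVHS (L : Fin n → ∀ x, Submodule ℂ (E x)) : Prop where
  internal : ∀ x, DirectSum.IsInternal fun i => L i x
  line : ∀ i x, ∃ (U : Set X) (s : Fin 1 → ∀ y, E y), x ∈ U ∧
    IsHolomorphicFrame n (L i) (fun _ => ⊥) U s
  map : ∀ i j : Fin n, (j : ℕ) = i + 1 → ∀ x t, ∀ v ∈ L i x, θ.field x t v ∈ L j x
  map_last : ∀ i : Fin n, (i : ℕ) + 1 = n → ∀ x t, ∀ v ∈ L i x, θ.field x t v = 0
  ne_zero : ∀ i : Fin n, (i : ℕ) + 1 < n → ∃ x t, ∃ v ∈ L i x, θ.field x t v ≠ 0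

/-- The squared norm `‖γ_k‖²` at `x` of `γ_k = Gr_k θ : G_{k-1}/G_k → (G_k/G_{k+1}) ⊗ K_X`,
with respect to the metric `g` on `X` and metrics on the line bundles `L_i = G_{i-1}/G_i`, for
which `N i x s` is the squared norm of the class of `s ∈ G_{i-1}`. It is the squared operator
norm, where `|∂/∂z|² = g(z) / 2`; as `L_k` and `T_x X` are lines, all the quotients
below are equal to `2 |γ_k(z)|² N_k⁻¹ N_{k+1} / g(z)`. -/
def gammaNormSq (g : ConformalMetric X) (N : ℕ → ∀ x, E x → ℝ) (k : ℕ) (x : X) : ℝ :=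
  sSup {c | ∃ s ∈ θ.filtration (k - 1) x, s ∉ θ.filtration k x ∧
    ∃ t : TangentSpace 𝓘(ℂ, ℂ) x, t ≠ 0 ∧
      c = 2 * N (k + 1) x (θ.field x t s) / (g.sq x t * N k x s)}

end HiggsField

/-! ### Hermitian metrics -/

variable (n E) in
/-- A smooth Hermitian metric on `E`, conjugate linear in the first variable. -/
structure HermitianMetric where
  form : ∀ x, E x →ₗ⋆[ℂ] E x →ₗ[ℂ] ℂ
  conj_symm : ∀ x (v w : E x), (starRingEnd ℂ) (form x w v) = form x v w
  pos : ∀ x (v : E x), v ≠ 0 → 0 < (form x v v).re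
  smooth : ∀ U : Set X, IsOpen U → ∀ s t : ∀ x, E x,
    IsHolomorphicOn n s U → IsHolomorphicOn n t U →
      ContMDiffOn 𝓘(ℝ, ℂ) 𝓘(ℝ, ℂ) ∞ (fun x => form x (s x) (t x)) U

variable (n E) in
theorem finiteDimensional_fiber [VectorBundle ℂ (Fin n → ℂ) E] (x : X) :
    FiniteDimensional ℂ (E x) :=
  ((trivializationAt (Fin n → ℂ) E x).continuousLinearEquivAt ℂ x
    (FiberBundle.mem_baseSet_trivializationAt' x)).symm.toLinearEquiv.finiteDimensional

namespace HermitianMetric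

variable (h : HermitianMetric n E)

/-- `h` as an inner product on the fibre `E x`. -/
abbrev core (x : X) : InnerProductSpace.Core ℂ (E x) where
  inner v w := h.form x v w
  conj_inner_symm v w := h.conj_symm x v w
  re_inner_nonneg v := by
    by_cases hv : v = 0
    · simp [hv]
    · exact (h.pos x v hv).le
  add_left u v w := by simp
  smul_left v w c := by simp
  definite v hv := by
    by_contra hne
    have := h.pos x v hne
    rw [show h.form x v v = 0 from hv] at this
    simp at this

section

variable [VectorBundle ℂ (Fin n → ℂ) E]

/-- The orthogonal projection of `E x` onto the `h`-orthogonal complement of `W`. -/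
def perp {x : X} (W : Submodule ℂ (E x)) : E x →ₗ[ℂ] E x :=
  haveI := finiteDimensional_fiber n E x
  orthProj (h.core x) W

theorem sub_perp_mem {x : X} (W : Submodule ℂ (E x)) (v : E x) : v - h.perp W v ∈ W :=
  haveI := finiteDimensional_fiber n E x
  sub_orthProj_mem (h.core x) W v

theorem form_perp {x : X} (W : Submodule ℂ (E x)) (v : E x) {w : E x} (hw : w ∈ W) :
    h.form x w (h.perp W v) = 0 :=
  haveI := finiteDimensional_fiber n E x
  inner_orthProj (h.core x) W v hw

/-- The metric on `E x / W` induced by `h` (through `E x / W ≅ W^⊥`), on the classes of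
two vectors. -/
def quotForm {x : X} (W : Submodule ℂ (E x)) (v w : E x) : ℂ :=
  h.form x (h.perp W v) (h.perp W w)

/-- The squared norm of `[v 0] ∧ … ∧ [v (k - 1)]` in the metric on `det (E x / W)` induced by `h`,
for `E x / W` of dimension `k`. -/
def detQuotSq {x : X} (W : Submodule ℂ (E x)) {k : ℕ} (v : Fin k → E x) : ℝ :=
  (Matrix.of fun i j => h.quotForm W (v i) (v j)).det.re

end

variable [IsManifold 𝓘(ℂ, ℂ) ω X]

/-- The matrix `(h(s_i, s_j))` as a function of the coordinate `z = e`. -/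
def gram (e : OpenPartialHomeomorph X ℂ) (s : Fin n → ∀ x, E x) (z : ℂ) :
    Matrix (Fin n) (Fin n) ℂ :=
  Matrix.of fun i j => h.form (e.symm z) (s i (e.symm z)) (s j (e.symm z))

/-- The Chern connection of `h` in a holomorphic frame `s` is `d + H⁻¹ ∂H` with `H = h.gram e s`,
and its curvature is `∂̄(H⁻¹ ∂H) = -∂_{z̄}(H⁻¹ ∂_z H) dz ∧ dz̄`: this is the coefficient of
`dz ∧ dz̄`. -/
def chernCurvature (e : OpenPartialHomeomorph X ℂ) (s : Fin n → ∀ x, E x) (z : ℂ) :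
    Matrix (Fin n) (Fin n) ℂ :=
  -matrixWirtingerBar (fun ζ => (h.gram e s ζ)⁻¹ * matrixWirtinger (h.gram e s) ζ) z

/-- The matrix `H⁻¹ Θᴴ H` of the `h`-adjoint of the endomorphism with matrix `Θ`. -/
def adjointMatrix (e : OpenPartialHomeomorph X ℂ) (s : Fin n → ∀ x, E x) (z : ℂ)
    (Θ : Matrix (Fin n) (Fin n) ℂ) : Matrix (Fin n) (Fin n) ℂ :=
  (h.gram e s z)⁻¹ * Θ.conjTranspose * h.gram e s z

/-- `h` is harmonic for `θ`: it solves the Hitchin equation `F(∇_h) + [θ, θ^{*_h}] = 0`. In every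
local coordinate `z = e` and local holomorphic frame `s`, if `θ = Θ dz`, then
`θ^{*_h} = H⁻¹ Θᴴ H dz̄`, and the equation is that of the coefficients of `dz ∧ dz̄`. -/
def IsHarmonic (θ : HiggsField n E) : Prop :=
  ∀ e ∈ IsManifold.maximalAtlas 𝓘(ℂ, ℂ) ω X, ∀ (U : Set X) (s : Fin n → ∀ x, E x),
    IsHolomorphicFrame n (fun _ => ⊤) (fun _ => ⊥) U s → ∀ x ∈ U ∩ e.source,
      ∀ Θ : Matrix (Fin n) (Fin n) ℂ,
        (∀ j, θ.field x (coordVec e x) (s j x) = ∑ i, Θ i j • s i x) →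
        h.chernCurvature e s (e x) +
          (Θ * h.adjointMatrix e s (e x) Θ - h.adjointMatrix e s (e x) Θ * Θ) = 0

variable [VectorBundle ℂ (Fin n → ℂ) E] [ContMDiffVectorBundle ω (Fin n → ℂ) E 𝓘(ℂ, ℂ)]

/-- The metric induced by `h` on the line bundle `L_i = G_{i-1}/G_i` (which is `h`-isometric to
the orthogonal complement of `G_i` in `G_{i-1}`): the squared norm of the class of a vector. -/
def gradedSq (θ : HiggsField n E) (i : ℕ) (x : X) (v : E x) : ℝ :=
  (h.quotForm (θ.filtration i x) v v).re

/-- `√-1 Λ_ω F_{det(E/G_k)}` at `x`, computed in a holomorphic frame `s` of `E/G_k` near `x`,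
that is in the frame `[s 0] ∧ … ∧ [s (k - 1)]` of `det(E/G_k)`. -/
def detQuotCurvature (θ : HiggsField n E) (g : ConformalMetric X) {k : ℕ}
    (s : Fin k → ∀ x, E x) (x : X) : ℝ :=
  g.contractedCurvature (fun y => h.detQuotSq (θ.filtration k y) fun i => s i y) x

/-- The `L i` are mutually `h`-orthogonal, i.e. `h = ⊕ h|_{L i}`. -/
def IsDiagonal (L : Fin n → ∀ x, Submodule ℂ (E x)) : Prop :=
  ∀ i j, i ≠ j → ∀ x, ∀ v ∈ L i x, ∀ w ∈ L j x, h.form x v w = 0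

end HermitianMetric

/-! ### Background metrics and the Toda-type system -/

variable [IsManifold 𝓘(ℂ, ℂ) ω X]
  [VectorBundle ℂ (Fin n → ℂ) E] [ContMDiffVectorBundle ω (Fin n → ℂ) E 𝓘(ℂ, ℂ)]

/-- A background metric `h̃ = (h̃_1, …, h̃_n)`: smooth Hermitian metrics on the holomorphic line
bundles `L_i = G_{i-1}/G_i`, with `√-1 F(∇_{h̃_i}) = ((n + 1 - 2 i) / 2) ω`. The number `sq i x v`
is the squared norm of the class of `v ∈ G_{i-1}`. -/
structure BackgroundMetric (θ : HiggsField n E) (g : ConformalMetric X) where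
  sq : ℕ → ∀ x, E x → ℝ
  sq_smul_add : ∀ i ∈ Finset.Icc 1 n, ∀ x, ∀ v ∈ θ.filtration (i - 1) x,
    ∀ w ∈ θ.filtration i x, ∀ c : ℂ, sq i x (c • v + w) = ‖c‖ ^ 2 * sq i x v
  sq_pos : ∀ i ∈ Finset.Icc 1 n, ∀ x, ∀ v ∈ θ.filtration (i - 1) x,
    v ∉ θ.filtration i x → 0 < sq i x v
  smooth : ∀ i ∈ Finset.Icc 1 n, ∀ (U : Set X) (s : Fin 1 → ∀ x, E x),
    IsHolomorphicFrame n (θ.filtration (i - 1)) (θ.filtration i) U s →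
      ContMDiffOn 𝓘(ℝ, ℂ) 𝓘(ℝ, ℝ) ∞ (fun x => sq i x (s 0 x)) U
  curvature : ∀ i ∈ Finset.Icc 1 n, ∀ (U : Set X) (s : Fin 1 → ∀ x, E x),
    IsHolomorphicFrame n (θ.filtration (i - 1)) (θ.filtration i) U s → ∀ x ∈ U,
      g.contractedCurvature (fun y => sq i y (s 0 y)) x = ((n : ℝ) + 1 - 2 * i) / 2

/-- `det h̃ = det h` under `L_1 ⊗ … ⊗ L_n = det E`: for `v i ∈ G_i` (`i = 0, …, n - 1`) the
element `[v 0] ⊗ … ⊗ [v (n - 1)]` has the same norm as `v 0 ∧ … ∧ v (n - 1)`. -/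
def BackgroundMetric.DetEq {θ : HiggsField n E} {g : ConformalMetric X}
    (ht : BackgroundMetric θ g) (h : HermitianMetric n E) : Prop :=
  ∀ x, ∀ v : Fin n → E x, (∀ i : Fin n, v i ∈ θ.filtration i x) →
    ∏ i : Fin n, ht.sq (i + 1) x (v i) =
      (Matrix.of fun i j => h.form x (v i) (v j)).det.re

/-- `h_i = e^{w_i} h̃_i` on `L_i = G_{i-1}/G_i` for `i = 1, …, n`. -/
def BackgroundMetric.IsConformalFactor {θ : HiggsField n E} {g : ConformalMetric X}
    (ht : BackgroundMetric θ g) (h : HermitianMetric n E) (w : ℕ → X → ℝ) : Prop :=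
  ∀ i ∈ Finset.Icc 1 n, ∀ x, ∀ v ∈ θ.filtration (i - 1) x,
    h.gradedSq θ i x v = Real.exp (w i x) * ht.sq i x v

/-- `u_i = -(w_1 + … + w_i)`. -/
def potential {X : Type*} (w : ℕ → X → ℝ) (i : ℕ) (x : X) : ℝ :=
  -∑ k ∈ Finset.Icc 1 i, w k x

/-- The left-hand side
`Δ_g u_i + i (n - i) - 2 ‖γ_i‖²_{h̃, g} e^{2 u_i - u_{i-1} - u_{i+1}}` of the Toda-type system. -/
def todaOperator {θ : HiggsField n E} {g : ConformalMetric X}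
    (ht : BackgroundMetric θ g) (u : ℕ → X → ℝ) (i : ℕ) (x : X) : ℝ :=
  g.laplacian (u i) x + (i : ℝ) * ((n : ℝ) - i) -
    2 * θ.gammaNormSq g ht.sq i x * Real.exp (2 * u i x - u (i - 1) x - u (i + 1) x)

end HiggsBundle

end

/-! Fix x₀. Near x₀ there is a holomorphic frame s₀, …, s_{n-1} of E whose members from the k-th on
span G_k, for all k at once; a constant triangular change makes it orthonormal at x₀. Let H be its
Gram matrix and D_k the Gram determinant of s_k, …, s_{n-1}, i.e. the squared norm of a frame of det
G_k. Orthogonal projection gives |[s₀] ∧ … ∧ [s_{k-1}]|² = D_0 / D_k and |[s_k]|² = D_k / D_{k+1} in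
L_{k+1}, so all curvatures come from ∂∂̄ log D_k at x₀.

Where H = 1, ∂∂̄ log D_k is the trace of ∂∂̄H − ∂H ∂̄H over the block of indices ≥ k. The Hitchin
equation expresses the diagonal of ∂∂̄H through ∂H and the matrix Θ of θ
(`re_wirtinger_wirtingerBar_log_det_of_hitchin`). Since G_k is θ-invariant, what survives is √-1 Λ
F_{det(E/G_k)} = (2/g) Σ_{i ≥ k > j} (|∂H_{ji}|² + |Θ_{ij}|²) (`detQuotCurvature_eq_of_isHarmonic`):
the second fundamental form of G_k plus the part of θ from the complement of G_k into G_k. For k = 0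
the sum is empty, so det E is flat. The single term |Θ_{k,k-1}|² is ‖γ_k‖², and the others are
nonnegative: this is the inequality. For a diagonal metric on a CVHS the frame can be taken in the
lines L'_i; then H is diagonal near x₀ and Θ has only subdiagonal entries, so no other term
survives.

For the Toda form, take logarithms in h_i = e^{w_i} h̃_i and sum over i ≤ k. The background
curvatures add up to k(n - k)/2, and the Toda expression equals -2 (-√-1 Λ F + ‖γ_k‖²) for any
Hermitian metric (`todaOperator_eq`). This proves the equivalence and transfers the inequality and
the equality.

The remaining work is the adapted frame. Connectedness and isolated zeros spread θ^{n-1} ≠ 0 to a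
punctured neighbourhood of every point. There ker θ^{n-k} has dimension n - k, and v, θv, …,
θ^{n-1}v is adapted for a suitable constant v. Its determinant may vanish at x₀; dividing suitable
combinations by z - z₀ lowers the order of vanishing to zero while staying in the kernels
(`exists_independent_of_generically_independent`). The identity theorem then identifies the spans
with the saturated G_k, at x₀ as well (`exists_isAdaptedFrame_of_ker`). -/

noncomputable section

set_option linter.unusedSectionVars false

namespace HiggsBundle

/-! ### Calculus of Wirtinger derivatives -/

/-- `(∂f/∂x + c ∂f/∂y) / 2`: the common form of the two Wirtinger derivatives. -/
def complexDirDeriv (c : ℂ) (f : ℂ → ℂ) (z : ℂ) : ℂ :=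
  (fderiv ℝ f z 1 + c * fderiv ℝ f z Complex.I) / 2

theorem wirtinger_eq (f : ℂ → ℂ) (z : ℂ) : wirtinger f z = complexDirDeriv (-Complex.I) f z := by
  simp [wirtinger, complexDirDeriv, sub_eq_add_neg]

theorem wirtingerBar_eq (f : ℂ → ℂ) (z : ℂ) :
    wirtingerBar f z = complexDirDeriv Complex.I f z := rfl

namespace complexDirDeriv

variable {c : ℂ} {f g : ℂ → ℂ} {z : ℂ}

theorem congr (h : f =ᶠ[𝓝 z] g) : complexDirDeriv c f z = complexDirDeriv c g z := by
  simp [complexDirDeriv, h.fderiv_eq]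

theorem const (a : ℂ) : complexDirDeriv c (fun _ => a) z = 0 := by
  simp [complexDirDeriv]

theorem sub (hf : DifferentiableAt ℝ f z) (hg : DifferentiableAt ℝ g z) :
    complexDirDeriv c (fun ζ => f ζ - g ζ) z = complexDirDeriv c f z - complexDirDeriv c g z := by
  simp only [complexDirDeriv, fderiv_fun_sub hf hg, sub_apply]
  ring

theorem mul (hf : DifferentiableAt ℝ f z) (hg : DifferentiableAt ℝ g z) :
    complexDirDeriv c (fun ζ => f ζ * g ζ) z =
      complexDirDeriv c f z * g z + f z * complexDirDeriv c g z := by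
  simp only [complexDirDeriv, fderiv_fun_mul hf hg, add_apply,
    smul_apply, smul_eq_mul]
  ring

theorem sum {ι : Type*} {s : Finset ι} {F : ι → ℂ → ℂ}
    (hF : ∀ i ∈ s, DifferentiableAt ℝ (F i) z) :
    complexDirDeriv c (fun ζ => ∑ i ∈ s, F i ζ) z = ∑ i ∈ s, complexDirDeriv c (F i) z := by
  simp only [complexDirDeriv, fderiv_fun_sum hF, sum_apply, Finset.mul_sum,
    ← Finset.sum_add_distrib, Finset.sum_div]

theorem prod {ι : Type*} [DecidableEq ι] {s : Finset ι} {F : ι → ℂ → ℂ}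
    (hF : ∀ i ∈ s, DifferentiableAt ℝ (F i) z) :
    complexDirDeriv c (fun ζ => ∏ i ∈ s, F i ζ) z =
      ∑ i ∈ s, (∏ j ∈ s.erase i, F j z) * complexDirDeriv c (F i) z := by
  have h := (HasFDerivAt.finsetProd (u := s) fun i hi => (hF i hi).hasFDerivAt).fderiv
  simp only [complexDirDeriv, h, sum_apply, smul_apply,
    smul_eq_mul, Finset.mul_sum, ← Finset.sum_add_distrib, Finset.sum_div]
  exact Finset.sum_congr rfl fun i _ => by ring

theorem conj (hf : DifferentiableAt ℝ f z) :
    complexDirDeriv c (fun ζ => (starRingEnd ℂ) (f ζ)) z =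
      (starRingEnd ℂ) (complexDirDeriv ((starRingEnd ℂ) c) f z) := by
  have h : HasFDerivAt (fun ζ => (starRingEnd ℂ) (f ζ))
      ((Complex.conjCLE : ℂ →L[ℝ] ℂ).comp (fderiv ℝ f z)) z :=
    (Complex.conjCLE : ℂ →L[ℝ] ℂ).hasFDerivAt.comp z hf.hasFDerivAt
  simp [complexDirDeriv, h.fderiv, Complex.conj_ofNat]

theorem log {d : ℂ → ℝ} (hd : DifferentiableAt ℝ d z) (h0 : d z ≠ 0) :
    complexDirDeriv c (fun ζ => ((Real.log (d ζ) : ℝ) : ℂ)) z =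
      (d z : ℂ)⁻¹ * complexDirDeriv c (fun ζ => ((d ζ : ℝ) : ℂ)) z := by
  have h1 : HasFDerivAt (fun ζ => ((d ζ : ℝ) : ℂ)) (Complex.ofRealCLM.comp (fderiv ℝ d z)) z :=
    Complex.ofRealCLM.hasFDerivAt.comp z hd.hasFDerivAt
  have h2 : HasFDerivAt (fun ζ => ((Real.log (d ζ) : ℝ) : ℂ))
      (Complex.ofRealCLM.comp ((d z)⁻¹ • fderiv ℝ d z)) z :=
    Complex.ofRealCLM.hasFDerivAt.comp z (hd.hasFDerivAt.log h0)
  simp only [complexDirDeriv, h1.fderiv, h2.fderiv]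
  simp
  ring

theorem differentiableAt (hf : ContDiffAt ℝ 2 f z) :
    DifferentiableAt ℝ (complexDirDeriv c f) z := by
  have h : DifferentiableAt ℝ (fderiv ℝ f) z :=
    (hf.fderiv_right (m := 1) (by norm_num)).differentiableAt (by norm_num)
  unfold complexDirDeriv
  fun_prop

/-- Cauchy–Riemann: the real differential is ℂ-linear, so its value at i is i times its value at 1
and the two halves cancel. -/
theorem bar_of_differentiableAt (hf : DifferentiableAt ℂ f z) :
    complexDirDeriv Complex.I f z = 0 := by
  have h : fderiv ℝ f z = (fderiv ℂ f z).restrictScalars ℝ :=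
    hf.fderiv_restrictScalars ℝ
  have h2 : fderiv ℂ f z Complex.I = Complex.I * fderiv ℂ f z 1 := by
    simp [mul_comm]
  simp only [complexDirDeriv, h, ContinuousLinearMap.coe_restrictScalars', h2, ← mul_assoc,
    Complex.I_mul_I]
  ring

end complexDirDeriv

/-! ### Determinants of matrix-valued functions -/

section Det

variable {ι : Type*} [Fintype ι] [DecidableEq ι] {M : ℂ → Matrix ι ι ℂ} {z : ℂ}

theorem contDiffAt_det {m : WithTop ℕ∞} (hM : ∀ i j, ContDiffAt ℝ m (fun ζ => M ζ i j) z) :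
    ContDiffAt ℝ m (fun ζ => (M ζ).det) z := by
  simp only [Matrix.det_apply']
  exact ContDiffAt.sum fun σ _ => contDiffAt_const.mul (contDiffAt_prod fun i _ => hM _ _)

theorem contDiffAt_adjugate {m : WithTop ℕ∞} (hM : ∀ i j, ContDiffAt ℝ m (fun ζ => M ζ i j) z)
    (i j : ι) : ContDiffAt ℝ m (fun ζ => (M ζ).adjugate i j) z := by
  simp only [Matrix.adjugate_apply]
  refine contDiffAt_det fun k l => ?_
  by_cases hk : k = j
  · subst hk
    simpa using contDiffAt_const
  · simpa [Matrix.updateRow_ne hk] using hM k l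

theorem contDiffAt_inv {m : WithTop ℕ∞} (hM : ∀ i j, ContDiffAt ℝ m (fun ζ => M ζ i j) z)
    (h0 : (M z).det ≠ 0) (i j : ι) : ContDiffAt ℝ m (fun ζ => (M ζ)⁻¹ i j) z := by
  simp only [Matrix.inv_def, Ring.inverse_eq_inv', Matrix.smul_apply, smul_eq_mul]
  exact ((contDiffAt_det hM).inv h0).mul (contDiffAt_adjugate hM i j)

/-- Jacobi's formula. -/
theorem complexDirDeriv_det {c : ℂ} (hM : ∀ i j, DifferentiableAt ℝ (fun ζ => M ζ i j) z) :
    complexDirDeriv c (fun ζ => (M ζ).det) z =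
      ∑ i, ∑ j, (M z).adjugate i j * complexDirDeriv c (fun ζ => M ζ j i) z := by
  have hp : ∀ σ : Equiv.Perm ι, DifferentiableAt ℝ (fun ζ => ∏ i, M ζ (σ i) i) z :=
    fun σ => (HasFDerivAt.finsetProd (u := Finset.univ) fun i _ =>
      (hM (σ i) i).hasFDerivAt).differentiableAt
  have h1 : complexDirDeriv c (fun ζ => (M ζ).det) z =
      ∑ σ : Equiv.Perm ι, ((Equiv.Perm.sign σ : ℤ) : ℂ) *
        ∑ i, (∏ j ∈ Finset.univ.erase i, M z (σ j) j) *
          complexDirDeriv c (fun ζ => M ζ (σ i) i) z := by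
    simp only [Matrix.det_apply']
    rw [complexDirDeriv.sum fun σ _ => (differentiableAt_const _).fun_mul (hp σ)]
    refine Finset.sum_congr rfl fun σ _ => ?_
    rw [complexDirDeriv.mul (differentiableAt_const _) (hp σ), complexDirDeriv.const,
      complexDirDeriv.prod fun i _ => hM _ _]
    ring
  -- Cramer: row i of the adjugate paired with v is det M with column i replaced by v. Expanded over
  -- permutations, this is the term of the product rule in which the factor of column i is
  -- differentiated.
  have h2 : ∀ (i : ι) (v : ι → ℂ), ∑ j, (M z).adjugate i j * v j =
      ∑ σ : Equiv.Perm ι, ((Equiv.Perm.sign σ : ℤ) : ℂ) *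
        ((∏ j ∈ Finset.univ.erase i, M z (σ j) j) * v (σ i)) := by
    intro i v
    have : ∑ j, (M z).adjugate i j * v j = ((M z).updateCol i v).det := by
      rw [← Matrix.cramer_apply, Matrix.cramer_eq_adjugate_mulVec]
      rfl
    rw [this, Matrix.det_apply']
    refine Finset.sum_congr rfl fun σ _ => ?_
    rw [← Finset.mul_prod_erase Finset.univ _ (Finset.mem_univ i)]
    have : ∏ x ∈ Finset.univ.erase i, (M z).updateCol i v (σ x) x =
        ∏ j ∈ Finset.univ.erase i, M z (σ j) j :=
      Finset.prod_congr rfl fun j hj => by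
        rw [Matrix.updateCol_ne (Finset.ne_of_mem_erase hj)]
    rw [this, Matrix.updateCol_self]
    ring
  rw [h1]
  simp only [h2, Finset.mul_sum]
  exact Finset.sum_comm

theorem eventually_det_ne_zero (hM : ∀ i j, ContDiffAt ℝ 2 (fun ζ => M ζ i j) z)
    (h0 : (M z).det ≠ 0) : ∀ᶠ ζ in 𝓝 z, (M ζ).det ≠ 0 :=
  (contDiffAt_det hM).continuousAt.eventually_ne h0

/-- Differentiate M⁻¹ M = 1, which holds near z because det M stays non-zero there; at z both
factors are 1. -/
theorem complexDirDeriv_inv {c : ℂ} (hM : ∀ i j, ContDiffAt ℝ 2 (fun ζ => M ζ i j) z)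
    (h1 : M z = 1) (i j : ι) :
    complexDirDeriv c (fun ζ => (M ζ)⁻¹ i j) z = -complexDirDeriv c (fun ζ => M ζ i j) z := by
  have h0 : (M z).det ≠ 0 := by simp [h1]
  have hd : ∀ i j, DifferentiableAt ℝ (fun ζ => M ζ i j) z := fun i j =>
    (hM i j).differentiableAt (by norm_num)
  have hdi : ∀ i j, DifferentiableAt ℝ (fun ζ => (M ζ)⁻¹ i j) z := fun i j =>
    (contDiffAt_inv hM h0 i j).differentiableAt (by norm_num)
  have key : complexDirDeriv c (fun ζ => ∑ k, (M ζ)⁻¹ i k * M ζ k j) z = 0 := by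
    rw [complexDirDeriv.congr (g := fun _ => (1 : Matrix ι ι ℂ) i j), complexDirDeriv.const]
    filter_upwards [eventually_det_ne_zero hM h0] with ζ hζ
    rw [← Matrix.nonsing_inv_mul (M ζ) (Ne.isUnit hζ), Matrix.mul_apply]
  rw [complexDirDeriv.sum fun k _ => (hdi i k).fun_mul (hd k j)] at key
  simp only [complexDirDeriv.mul (hdi i _) (hd _ j), h1, inv_one, Matrix.one_apply, mul_ite,
    mul_one, mul_zero, ite_mul, one_mul, zero_mul, Finset.sum_add_distrib, Finset.sum_ite_eq,
    Finset.sum_ite_eq', Finset.mem_univ, if_true] at key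
  exact eq_neg_of_add_eq_zero_left key

/-- The first derivative of `log det M`. -/
theorem complexDirDeriv_log_det {c : ℂ} (hM : ∀ i j, DifferentiableAt ℝ (fun ζ => M ζ i j) z)
    {d : ℂ → ℝ} (hd : ∀ᶠ ζ in 𝓝 z, (M ζ).det = d ζ) (hz : d z ≠ 0)
    (hdd : DifferentiableAt ℝ d z) :
    complexDirDeriv c (fun ζ => ((Real.log (d ζ) : ℝ) : ℂ)) z =
      ∑ i, ∑ j, (M z)⁻¹ i j * complexDirDeriv c (fun ζ => M ζ j i) z := by
  rw [complexDirDeriv.log hdd hz, ← complexDirDeriv.congr hd, complexDirDeriv_det hM,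
    Finset.mul_sum]
  refine Finset.sum_congr rfl fun i _ => ?_
  rw [Finset.mul_sum]
  refine Finset.sum_congr rfl fun j _ => ?_
  rw [Matrix.inv_def, hd.self_of_nhds]
  simp [mul_assoc]

/-- `∂∂̄ log det M = tr ∂∂̄M - tr (∂M ∂̄M)` at a point where `M = 1`. -/
theorem wirtinger_wirtingerBar_log_det (hM : ∀ i j, ContDiffAt ℝ 2 (fun ζ => M ζ i j) z)
    (h1 : M z = 1) {d : ℂ → ℝ} (hd : ∀ᶠ ζ in 𝓝 z, (M ζ).det = d ζ) :
    wirtinger (wirtingerBar fun ζ => ((Real.log (d ζ) : ℝ) : ℂ)) z =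
      ∑ i, wirtinger (wirtingerBar fun ζ => M ζ i i) z -
        ∑ i, ∑ j, wirtinger (fun ζ => M ζ i j) z * wirtingerBar (fun ζ => M ζ j i) z := by
  have h0 : (M z).det ≠ 0 := by simp [h1]
  have hdz : d z = 1 := by
    have := hd.self_of_nhds
    rw [h1, Matrix.det_one] at this
    exact_mod_cast this.symm
  have hcd : ContDiffAt ℝ 2 d z := by
    have : ContDiffAt ℝ 2 (fun ζ => ((M ζ).det).re) z :=
      Complex.reCLM.contDiff.contDiffAt.comp z (contDiffAt_det hM)
    exact this.congr_of_eventuallyEq (hd.mono fun ζ hζ => by simp [hζ])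
  -- The inner derivative is needed on a neighbourhood, where M need not be 1, so Jacobi's formula
  -- is used there in full; M z = 1 enters only after the outer derivative.
  have hev : ∀ᶠ ζ in 𝓝 z, wirtingerBar (fun ζ => ((Real.log (d ζ) : ℝ) : ℂ)) ζ =
      ∑ i, ∑ j, (M ζ)⁻¹ i j * wirtingerBar (fun ζ => M ζ j i) ζ := by
    have e1 : ∀ᶠ ζ in 𝓝 z, ∀ i j, ContDiffAt ℝ 2 (fun ζ => M ζ i j) ζ :=
      eventually_all.2 fun i => eventually_all.2 fun j => (hM i j).eventually (by simp)
    filter_upwards [e1, hcd.eventually (by simp), hd.eventually_nhds,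
      hcd.continuousAt.eventually_ne (hdz.trans_ne one_ne_zero)] with ζ q1 q2 q3 q4
    exact complexDirDeriv_log_det (fun i j => (q1 i j).differentiableAt (by norm_num)) q3 q4
      (q2.differentiableAt (by norm_num))
  rw [wirtinger_eq, complexDirDeriv.congr hev]
  have hdi : ∀ i j, DifferentiableAt ℝ (fun ζ => (M ζ)⁻¹ i j) z := fun i j =>
    (contDiffAt_inv hM h0 i j).differentiableAt (by norm_num)
  have hb : ∀ i j, DifferentiableAt ℝ (wirtingerBar fun ζ => M ζ j i) z := fun i j =>
    complexDirDeriv.differentiableAt (hM j i)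
  rw [complexDirDeriv.sum fun i _ => DifferentiableAt.fun_sum fun j _ => (hdi i j).fun_mul (hb i j)]
  rw [← Finset.sum_sub_distrib]
  refine Finset.sum_congr rfl fun i _ => ?_
  rw [complexDirDeriv.sum fun j _ => (hdi i j).fun_mul (hb i j)]
  simp only [complexDirDeriv.mul (hdi i _) (hb i _), complexDirDeriv_inv hM h1, h1, inv_one,
    Matrix.one_apply, ite_mul, one_mul, zero_mul, Finset.sum_add_distrib, Finset.sum_ite_eq,
    Finset.mem_univ, if_true, neg_mul, Finset.sum_neg_distrib, wirtinger_eq]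
  ring

end Det

/-- `log |f|²` is harmonic for a holomorphic function `f` without zeros. -/
theorem wirtinger_wirtingerBar_log_normSq {f : ℂ → ℂ} {z : ℂ} (hf : AnalyticAt ℂ f z)
    (h0 : f z ≠ 0) :
    wirtinger (wirtingerBar fun ζ => ((Real.log (Complex.normSq (f ζ)) : ℝ) : ℂ)) z = 0 := by
  -- ∂̄ log(f f̄) is the conjugate of f'/f, which is antiholomorphic and hence killed by ∂.
  have hev : ∀ᶠ ζ in 𝓝 z, wirtingerBar
      (fun ζ => ((Real.log (Complex.normSq (f ζ)) : ℝ) : ℂ)) ζ =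
      (starRingEnd ℂ) (deriv f ζ / f ζ) := by
    filter_upwards [hf.eventually_analyticAt, hf.continuousAt.eventually_ne h0] with ζ h1 h2
    have hdC := h1.differentiableAt
    have hd : DifferentiableAt ℝ f ζ := hdC.restrictScalars ℝ
    have hc : DifferentiableAt ℝ (fun ζ => (starRingEnd ℂ) (f ζ)) ζ :=
      (Complex.conjCLE : ℂ →L[ℝ] ℂ).differentiableAt.comp ζ hd
    have hn : DifferentiableAt ℝ (fun ζ => Complex.normSq (f ζ)) ζ := by
      have : DifferentiableAt ℝ (fun ζ => (f ζ * (starRingEnd ℂ) (f ζ)).re) ζ :=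
        Complex.reCLM.differentiableAt.comp ζ (hd.fun_mul hc)
      refine this.congr_of_eventuallyEq (Eventually.of_forall fun w => ?_)
      simp [Complex.mul_conj]
    have hw : complexDirDeriv (-Complex.I) f ζ = deriv f ζ := by
      have h : fderiv ℝ f ζ = (fderiv ℂ f ζ).restrictScalars ℝ := hdC.fderiv_restrictScalars ℝ
      simp only [complexDirDeriv, h, ContinuousLinearMap.coe_restrictScalars',
        fderiv_eq_smul_deriv, smul_eq_mul]
      linear_combination (-deriv f ζ / 2) * Complex.I_mul_I
    have h3 : (fun ζ => ((Complex.normSq (f ζ) : ℝ) : ℂ)) = fun ζ => f ζ * (starRingEnd ℂ) (f ζ) :=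
      funext fun w => (Complex.mul_conj _).symm
    rw [wirtingerBar_eq, complexDirDeriv.log hn (by simpa using h2), h3,
      complexDirDeriv.mul hd hc, complexDirDeriv.bar_of_differentiableAt hdC,
      complexDirDeriv.conj hd, Complex.conj_I, hw, ← Complex.mul_conj, map_div₀]
    have h4 : (starRingEnd ℂ) (f ζ) ≠ 0 := by simpa using h2
    field_simp
    ring
  have hG : DifferentiableAt ℂ (fun ζ => deriv f ζ / f ζ) z :=
    (hf.deriv.fun_div hf h0).differentiableAt
  rw [wirtinger_eq, complexDirDeriv.congr hev, complexDirDeriv.conj (hG.restrictScalars ℝ)]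
  simp [complexDirDeriv.bar_of_differentiableAt hG]

/-! ### Pointwise Hitchin equation and factorization of Gram determinants -/

section Hitchin

variable {ι : Type*} [Fintype ι]

theorem sum_subtype_eq_sum_ite {R : Type*} [AddCommMonoid R] (p : ι → Prop) [DecidablePred p]
    (f : ι → R) : ∑ i : {i // p i}, f i = ∑ i, if p i then f i else 0 := by
  rw [← Finset.sum_filter]
  exact (Finset.sum_subtype (Finset.univ.filter p) (by simp) f).symm

theorem sum_smul_subtype_eq_sum_dite {M : Type*} [AddCommGroup M] [Module ℂ M] (p : ι → Prop)
    [DecidablePred p] (b : {i // p i} → ℂ) (v : ι → M) :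
    ∑ i, b i • v i = ∑ i, (if h : p i then b ⟨i, h⟩ else 0) • v i := by
  have e := sum_subtype_eq_sum_ite p fun i => (if h : p i then b ⟨i, h⟩ else 0) • v i
  simp only [Subtype.prop, dite_true, Subtype.coe_eta] at e
  rw [e]
  exact Finset.sum_congr rfl fun j _ => by by_cases hj : p j <;> simp [hj]

variable [DecidableEq ι]

/-- Consequence of the Hitchin equation `F + [θ, θ*] = 0` in a holomorphic frame that is
orthonormal at the point `z` and adapted to a `θ`-invariant holomorphic subbundle, the one spanned
by the members of the frame that satisfy `p`. -/
theorem re_wirtinger_wirtingerBar_log_det_of_hitchin {n : ℕ}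
    {H : ℂ → Matrix (Fin n) (Fin n) ℂ} {z : ℂ}
    (hH : ∀ i j, ContDiffAt ℝ 2 (fun ζ => H ζ i j) z) (h1 : H z = 1)
    (hherm : ∀ i j, ∀ᶠ ζ in 𝓝 z, H ζ j i = (starRingEnd ℂ) (H ζ i j))
    {Θ : Matrix (Fin n) (Fin n) ℂ}
    (hit : -matrixWirtingerBar (fun ζ => (H ζ)⁻¹ * matrixWirtinger H ζ) z +
      (Θ * ((H z)⁻¹ * Θ.conjTranspose * H z) - ((H z)⁻¹ * Θ.conjTranspose * H z) * Θ) = 0)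
    (p : Fin n → Prop) [DecidablePred p] {d : ℂ → ℝ}
    (hd : ∀ᶠ ζ in 𝓝 z,
      (Matrix.of fun i j : {i // p i} => H ζ i j).det = d ζ) :
    (wirtinger (wirtingerBar fun ζ => ((Real.log (d ζ) : ℝ) : ℂ)) z).re =
      ∑ i, if p i then ∑ j, (Complex.normSq (wirtinger (fun ζ => H ζ j i) z) +
        Complex.normSq (Θ i j) - Complex.normSq (Θ j i) -
          if p j then Complex.normSq (wirtinger (fun ζ => H ζ j i) z) else 0) else 0 := by
  have h0 : (H z).det ≠ 0 := by simp [h1]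
  have hdi : ∀ i j, DifferentiableAt ℝ (fun ζ => H ζ i j) z := fun i j =>
    (hH i j).differentiableAt (by norm_num)
  have hbar : ∀ i j, wirtingerBar (fun ζ => H ζ i j) z =
      (starRingEnd ℂ) (wirtinger (fun ζ => H ζ j i) z) := by
    intro i j
    rw [wirtingerBar_eq, complexDirDeriv.congr (hherm j i), complexDirDeriv.conj (hdi j i),
      wirtinger_eq, Complex.conj_I]
  -- Diagonal entry (i, i) of the Hitchin equation at H = 1: the curvature contributes ∂̄∂H_ii − Σ
  -- |∂H_ji|², the commutator the differences of |Θ|².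
  have hsecond : ∀ i, (wirtinger (wirtingerBar fun ζ => H ζ i i) z).re =
      ∑ j, (Complex.normSq (wirtinger (fun ζ => H ζ j i) z) +
        Complex.normSq (Θ i j) - Complex.normSq (Θ j i)) := by
    -- The equation contains ∂̄∂H_ii while the determinant formula contains ∂∂̄H_ii. As H_ii is real
    -- the two are conjugate, so their real parts agree and no symmetry of second derivatives is
    -- required.
    intro i
    have hswap : wirtinger (wirtingerBar fun ζ => H ζ i i) z =
        (starRingEnd ℂ) (wirtingerBar (wirtinger fun ζ => H ζ i i) z) := by
      have hev : ∀ᶠ ζ in 𝓝 z, wirtingerBar (fun ζ => H ζ i i) ζ =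
          (starRingEnd ℂ) (wirtinger (fun ζ => H ζ i i) ζ) := by
        filter_upwards [(hH i i).eventually (by simp), (hherm i i).eventually_nhds] with ζ q1 q2
        rw [wirtingerBar_eq, complexDirDeriv.congr q2,
          complexDirDeriv.conj (q1.differentiableAt (by norm_num)), wirtinger_eq, Complex.conj_I]
      have hw : DifferentiableAt ℝ (wirtinger fun ζ => H ζ i i) z := by
        simp only [funext (wirtinger_eq _)]
        exact complexDirDeriv.differentiableAt (hH i i)
      rw [wirtinger_eq, complexDirDeriv.congr hev, complexDirDeriv.conj hw, map_neg,
        Complex.conj_I, neg_neg, wirtingerBar_eq]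
    have hinv : ∀ i j, DifferentiableAt ℝ (fun ζ => (H ζ)⁻¹ i j) z := fun i j =>
      (contDiffAt_inv hH h0 i j).differentiableAt (by norm_num)
    have hw : ∀ k, DifferentiableAt ℝ (fun ζ => wirtinger (fun ζ => H ζ k i) ζ) z := by
      intro k
      simp only [wirtinger_eq]
      exact complexDirDeriv.differentiableAt (hH k i)
    have hF : matrixWirtingerBar (fun ζ => (H ζ)⁻¹ * matrixWirtinger H ζ) z i i =
        -∑ k, wirtingerBar (fun ζ => H ζ i k) z * wirtinger (fun ζ => H ζ k i) z +
          wirtingerBar (wirtinger fun ζ => H ζ i i) z := by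
      simp only [matrixWirtingerBar, matrixWirtinger, Matrix.of_apply, Matrix.mul_apply,
        wirtingerBar_eq]
      rw [complexDirDeriv.sum fun k _ => (hinv i k).fun_mul (hw k)]
      simp only [complexDirDeriv.mul (hinv i _) (hw _), complexDirDeriv_inv hH h1, h1, inv_one,
        Matrix.one_apply, ite_mul, one_mul, zero_mul, Finset.sum_add_distrib, Finset.sum_ite_eq,
        Finset.mem_univ, if_true, neg_mul, Finset.sum_neg_distrib]
    have h3 := congrFun (congrFun hit i) i
    simp only [h1, inv_one, one_mul, mul_one, Matrix.add_apply, Matrix.neg_apply,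
      Matrix.sub_apply, hF, Matrix.zero_apply] at h3
    rw [hswap, Complex.conj_re]
    have h4 : wirtingerBar (wirtinger fun ζ => H ζ i i) z =
        ((∑ j, (Complex.normSq (wirtinger (fun ζ => H ζ j i) z) +
          Complex.normSq (Θ i j) - Complex.normSq (Θ j i)) : ℝ) : ℂ) := by
      simp only [Matrix.mul_apply, Matrix.conjTranspose_apply, hbar] at h3
      push_cast
      simp only [Finset.sum_sub_distrib, Finset.sum_add_distrib, Complex.normSq_eq_conj_mul_self]
      have e1 : ∑ j, Θ i j * star (Θ i j) = ∑ j, (starRingEnd ℂ) (Θ i j) * Θ i j :=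
        Finset.sum_congr rfl fun j _ => mul_comm _ _
      have e2 : ∑ j, star (Θ j i) * Θ j i = ∑ j, (starRingEnd ℂ) (Θ j i) * Θ j i := rfl
      rw [e1, e2] at h3
      linear_combination -h3
    rw [h4, Complex.ofReal_re]
  have key := wirtinger_wirtingerBar_log_det (M := fun ζ => Matrix.of fun i j : {i // p i} => H ζ i j)
    (z := z) (fun i j => hH i j) (by
      ext i j
      simp [h1, Matrix.one_apply, Subtype.ext_iff]) hd
  rw [key, Complex.sub_re, Complex.re_sum, Complex.re_sum]
  simp only [Matrix.of_apply, hsecond, Complex.re_sum]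
  rw [sum_subtype_eq_sum_ite p fun i => ∑ j, (Complex.normSq (wirtinger (fun ζ => H ζ j i) z) +
        Complex.normSq (Θ i j) - Complex.normSq (Θ j i))]
  rw [Finset.sum_comm]
  have h5 : ∀ i j, (wirtinger (fun ζ => H ζ j i) z * wirtingerBar (fun ζ => H ζ i j) z).re =
      Complex.normSq (wirtinger (fun ζ => H ζ j i) z) := by
    intro i j
    rw [hbar, Complex.mul_conj, Complex.ofReal_re]
  simp only [h5]
  rw [sum_subtype_eq_sum_ite p fun i => ∑ j : {j // p j},
    Complex.normSq (wirtinger (fun ζ => H ζ j i) z), ← Finset.sum_sub_distrib]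
  refine Finset.sum_congr rfl fun i _ => ?_
  by_cases hi : p i
  · simp only [hi, if_true]
    rw [sum_subtype_eq_sum_ite p fun j => Complex.normSq (wirtinger (fun ζ => H ζ j i) z),
      ← Finset.sum_sub_distrib]
  · simp [hi]

/-- Multiplicativity of Gram determinants along a subspace and its orthogonal projection. -/
theorem det_gram_eq_mul {V : Type*} [AddCommGroup V] [Module ℂ V] (B : V →ₗ⋆[ℂ] V →ₗ[ℂ] ℂ)
    (v : ι → V) (p : ι → Prop) [DecidablePred p]
    (P : V → V) (hP : ∀ u, u - P u ∈ Submodule.span ℂ (range fun i : {i // p i} => v i))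
    (hB0 : ∀ u, ∀ w ∈ Submodule.span ℂ (range fun i : {i // p i} => v i), B w (P u) = 0) :
    (Matrix.of fun i j => B (v i) (v j)).det =
      (Matrix.of fun i j : {i // ¬p i} => B (P (v i)) (P (v j))).det *
        (Matrix.of fun i j : {i // p i} => B (v i) (v j)).det := by
  have hex : ∀ i, ∃ a : {i // p i} → ℂ, ∑ j, a j • v j = v i - P (v i) := fun i =>
    (Submodule.mem_span_range_iff_exists_fun ℂ).1 (hP (v i))
  choose a ha using hex
  -- C replaces each v i with ¬p i by its projection and keeps the others. It is block triangular
  -- with identity diagonal blocks, so the Gram determinant is unchanged, while the new Gram matrix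
  -- is block triangular because projections are orthogonal to the span.
  set C : Matrix ι ι ℂ := Matrix.of fun i j =>
    (if i = j then 1 else 0) - if hj : p j then (if p i then 0 else a i ⟨j, hj⟩) else 0 with hC
  set v' : ι → V := fun i => if p i then v i else P (v i) with hv'
  have hCv : ∀ i, v' i = ∑ j, C i j • v j := by
    intro i
    simp only [hC, Matrix.of_apply, sub_smul, Finset.sum_sub_distrib, ite_smul, one_smul, zero_smul,
      Finset.sum_ite_eq, Finset.mem_univ, if_true]
    have : ∑ j, (if hj : p j then (if p i then 0 else a i ⟨j, hj⟩) else 0) • v j =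
        if p i then 0 else v i - P (v i) := by
      by_cases hi : p i
      · simp [hi]
      · simp only [hi, if_false, ← ha i, dite_smul, zero_smul]
        rw [sum_smul_subtype_eq_sum_dite p (a i) v]
        simp only [dite_smul, zero_smul]
    rw [this]
    by_cases hi : p i <;> simp [hv', hi]
  have hdetC : C.det = 1 := by
    rw [Matrix.twoBlockTriangular_det' C p]
    · have e1 : C.toSquareBlockProp p = 1 := by
        ext i j
        simp [hC, Matrix.toSquareBlockProp_def, Matrix.one_apply, i.2, Subtype.ext_iff]
      have e2 : (C.toSquareBlockProp fun i => ¬p i) = 1 := by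
        ext i j
        simp [hC, Matrix.toSquareBlockProp_def, Matrix.one_apply, j.2, Subtype.ext_iff]
      rw [e1, e2, Matrix.det_one, Matrix.det_one, one_mul]
    · intro i hi j hj
      have : i ≠ j := fun h => hj (h ▸ hi)
      simp [hC, this, hj]
  have hgram : (Matrix.of fun i j => B (v' i) (v' j)) =
      C.map (starRingEnd ℂ) * (Matrix.of fun i j => B (v i) (v j)) * C.transpose := by
    ext i j
    simp only [Matrix.of_apply, Matrix.mul_apply, Matrix.map_apply, Matrix.transpose_apply, hCv,
      map_sum, LinearMap.sum_apply, map_smulₛₗ, LinearMap.smul_apply, smul_eq_mul,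
      Finset.sum_mul, Finset.mul_sum, RingHom.id_apply]
    exact Finset.sum_congr rfl fun k _ => Finset.sum_congr rfl fun l _ => by ring
  have hdet : (Matrix.of fun i j => B (v' i) (v' j)).det =
      (Matrix.of fun i j => B (v i) (v j)).det := by
    have : (C.map (starRingEnd ℂ)).det = 1 := by
      have := (RingHom.map_det (starRingEnd ℂ) C).symm
      rwa [hdetC, map_one] at this
    rw [hgram, Matrix.det_mul, Matrix.det_mul, Matrix.det_transpose, hdetC, this]
    simp
  rw [← hdet, Matrix.twoBlockTriangular_det' _ p, mul_comm]
  · congr 2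
    · ext i j
      simp [Matrix.toSquareBlockProp_def, hv', i.2, j.2]
    · ext i j
      simp [Matrix.toSquareBlockProp_def, hv', i.2, j.2]
  · intro i hi j hj
    simp only [Matrix.of_apply, hv', hi, hj, if_true, if_false]
    exact hB0 _ _ (Submodule.subset_span ⟨⟨i, hi⟩, rfl⟩)

end Hitchin

/-! ### Nilpotent endomorphisms of maximal index -/

section Nilpotent

variable {V : Type*} [AddCommGroup V] [Module ℂ V] {n : ℕ} {A : Module.End ℂ V}

theorem pow_apply_eq_zero_of_le {a b : ℕ} (hab : a ≤ b) {v : V} (h : (A ^ a) v = 0) :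
    (A ^ b) v = 0 := by
  rw [← Nat.sub_add_cancel hab, pow_add, Module.End.mul_apply, h, map_zero]

/-- In a relation whose first non-zero coefficient has index i, applying A^(n-1-i) kills all later
terms and leaves a multiple of A^(n-1) v. -/
theorem linearIndependent_pow_apply (hA : A ^ n = 0) {v : V} (hv : (A ^ (n - 1)) v ≠ 0) :
    LinearIndependent ℂ fun i : Fin n => (A ^ (i : ℕ)) v := by
  rw [Fintype.linearIndependent_iff]
  intro c hc
  by_contra! hne
  obtain ⟨i, hi, hmin⟩ : ∃ i, c i ≠ 0 ∧ ∀ j < i, c j = 0 := by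
    obtain ⟨i, hi⟩ := WellFounded.has_min (wellFounded_lt (α := Fin n)) {i | c i ≠ 0} hne
    exact ⟨i, hi.1, fun j hj => by_contra fun h => hi.2 j h hj⟩
  have h := congrArg (A ^ (n - 1 - (i : ℕ))) hc
  rw [map_sum, map_zero, Finset.sum_eq_single i] at h
  · rw [map_smul, ← Module.End.mul_apply, ← pow_add, Nat.sub_add_cancel (by omega)] at h
    exact (smul_ne_zero hi hv) h
  · intro j _ hji
    rcases lt_or_gt_of_ne hji with hlt | hgt
    · simp [hmin j hlt]
    · rw [map_smul, ← Module.End.mul_apply, ← pow_add,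
        pow_apply_eq_zero_of_le (a := n) (by have := Fin.lt_def.1 hgt; omega) (by simp [hA]),
        smul_zero]
  · simp

/-- With v outside ker A^(n-1), the independent vectors A^m v, …, A^(n-1) v lie in the range of A^m;
rank–nullity does the rest. -/
theorem finrank_ker_pow_le [FiniteDimensional ℂ V] (hV : Module.finrank ℂ V = n) (hA : A ^ n = 0)
    (hA' : A ^ (n - 1) ≠ 0) {m : ℕ} (hm : m ≤ n) :
    Module.finrank ℂ (LinearMap.ker (A ^ m)) ≤ m := by
  obtain ⟨v, hv⟩ : ∃ v, (A ^ (n - 1)) v ≠ 0 := by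
    by_contra! h
    exact hA' (LinearMap.ext h)
  have hli := (linearIndependent_pow_apply hA hv).comp
    (fun i : Fin (n - m) => (⟨m + i, by omega⟩ : Fin n)) (fun a b hab => by
      have := congrArg Fin.val hab
      exact Fin.ext (by simpa using this))
  have hle : n - m ≤ Module.finrank ℂ (LinearMap.range (A ^ m)) := by
    have hli2 : LinearIndependent ℂ fun i : Fin (n - m) =>
        (⟨(A ^ (m + (i : ℕ))) v, by
          rw [pow_add, Module.End.mul_apply]; exact LinearMap.mem_range_self _ _⟩ :
          LinearMap.range (A ^ m)) :=
      LinearIndependent.of_comp (LinearMap.range (A ^ m)).subtype hli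
    simpa using hli2.fintype_card_le_finrank
  have := LinearMap.finrank_range_add_finrank_ker (A ^ m)
  omega

end Nilpotent

/-! ### Analytic families of vectors -/

section Analytic

variable {n : ℕ} {z₀ : ℂ}

theorem analyticAt_det {ι : Type*} [Fintype ι] [DecidableEq ι] {M : ℂ → Matrix ι ι ℂ}
    (hM : ∀ i j, AnalyticAt ℂ (fun z => M z i j) z₀) : AnalyticAt ℂ (fun z => (M z).det) z₀ := by
  simp only [Matrix.det_apply']
  exact Finset.analyticAt_fun_sum _ fun σ _ =>
    analyticAt_const.fun_mul (Finset.analyticAt_fun_prod _ fun i _ => hM _ _)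

theorem analyticAt_inv_apply {ι : Type*} [Fintype ι] [DecidableEq ι] {M : ℂ → Matrix ι ι ℂ}
    (hM : ∀ i j, AnalyticAt ℂ (fun z => M z i j) z₀) (h0 : (M z₀).det ≠ 0) (i j : ι) :
    AnalyticAt ℂ (fun z => (M z)⁻¹ i j) z₀ := by
  simp only [Matrix.inv_def, Ring.inverse_eq_inv', Matrix.smul_apply, smul_eq_mul,
    Matrix.adjugate_apply]
  refine ((analyticAt_det hM).fun_inv h0).fun_mul (analyticAt_det fun k l => ?_)
  by_cases hk : k = j
  · subst hk
    simpa using analyticAt_const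
  · simpa [Matrix.updateRow_ne hk] using hM k l

/-- The coefficients are obtained by multiplying with the inverse of the matrix of the f i, whose
entries are analytic by Cramer's rule. -/
theorem exists_analytic_coeff {f : Fin n → ℂ → Fin n → ℂ} (hf : ∀ i, AnalyticAt ℂ (f i) z₀)
    (h0 : (Matrix.of fun i => f i z₀).det ≠ 0) {g : ℂ → Fin n → ℂ} (hg : AnalyticAt ℂ g z₀) :
    ∃ a : Fin n → ℂ → ℂ, (∀ i, AnalyticAt ℂ (a i) z₀) ∧
      ∀ᶠ z in 𝓝 z₀, g z = ∑ i, a i z • f i z := by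
  have hM : ∀ i j, AnalyticAt ℂ (fun z => (Matrix.of fun i => f i z) i j) z₀ := fun i j =>
    analyticAt_pi_iff.1 (hf i) j
  refine ⟨fun i z => Matrix.vecMul (g z) (Matrix.of fun i => f i z)⁻¹ i, fun i => ?_, ?_⟩
  · simp only [Matrix.vecMul, dotProduct]
    exact Finset.analyticAt_fun_sum _ fun j _ =>
      (analyticAt_pi_iff.1 hg j).fun_mul (analyticAt_inv_apply hM h0 j i)
  · filter_upwards [(analyticAt_det hM).continuousAt.eventually_ne h0] with z hz
    have : Matrix.vecMul (Matrix.vecMul (g z) (Matrix.of fun i => f i z)⁻¹)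
        (Matrix.of fun i => f i z) = g z := by
      rw [Matrix.vecMul_vecMul, Matrix.nonsing_inv_mul _ (Ne.isUnit hz), Matrix.vecMul_one]
    conv_lhs => rw [← this]
    rw [Matrix.vecMul_eq_sum]
    rfl

variable {A : ℂ → Module.End ℂ (Fin n → ℂ)}

theorem analyticAt_pow_apply
    (hA : ∀ f : ℂ → Fin n → ℂ, AnalyticAt ℂ f z₀ → AnalyticAt ℂ (fun z => A z (f z)) z₀)
    {f : ℂ → Fin n → ℂ} (hf : AnalyticAt ℂ f z₀) (m : ℕ) :
    AnalyticAt ℂ (fun z => (A z ^ m) (f z)) z₀ := by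
  induction m with
  | zero => simpa using hf
  | succ m ih => simpa only [pow_succ', Module.End.mul_apply] using hA _ ih

/-- Saturation: a system of analytic vectors that is adapted to the kernels of the powers of `A` and
generically independent can be improved to one that is independent at `z₀`. -/
theorem exists_independent_of_generically_independent
    (hA : ∀ f : ℂ → Fin n → ℂ, AnalyticAt ℂ f z₀ → AnalyticAt ℂ (fun z => A z (f z)) z₀)
    (m : ℕ) (f : Fin n → ℂ → Fin n → ℂ) (hf : ∀ i, AnalyticAt ℂ (f i) z₀)
    (hker : ∀ i : Fin n, ∀ᶠ z in 𝓝 z₀, (A z ^ (n - (i : ℕ))) (f i z) = 0)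
    (hord : analyticOrderAt (fun z => (Matrix.of fun i => f i z).det) z₀ = m) :
    ∃ f : Fin n → ℂ → Fin n → ℂ, (∀ i, AnalyticAt ℂ (f i) z₀) ∧
      (∀ i : Fin n, ∀ᶠ z in 𝓝 z₀, (A z ^ (n - (i : ℕ))) (f i z) = 0) ∧
      (Matrix.of fun i => f i z₀).det ≠ 0 := by
  induction m generalizing f with
  | zero =>
    have hM : ∀ i j, AnalyticAt ℂ (fun z => (Matrix.of fun i => f i z) i j) z₀ := fun i j =>
      analyticAt_pi_iff.1 (hf i) j
    exact ⟨f, hf, hker, (analyticAt_det hM).analyticOrderAt_eq_zero.1 (by simpa using hord)⟩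
  | succ m ih =>
    have hz : (Matrix.of fun i => f i z₀).det = 0 :=
      apply_eq_zero_of_analyticOrderAt_ne_zero (f := fun z => (Matrix.of fun i => f i z).det)
        (by rw [hord]; simp)
    obtain ⟨c, hc, hcz⟩ := Matrix.exists_vecMul_eq_zero_iff.2 hz
    -- Taking i to be the first index of the relation at z₀ matters: the combination g then involves
    -- only f j with j ≥ i, so it is still killed by A^(n-i) and may replace f i.
    obtain ⟨i, hi, hmin⟩ : ∃ i, c i ≠ 0 ∧ ∀ j < i, c j = 0 := by
      obtain ⟨i, hi⟩ := WellFounded.has_min (wellFounded_lt (α := Fin n)) {i | c i ≠ 0}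
        (Function.ne_iff.1 hc)
      exact ⟨i, hi.1, fun j hj => by_contra fun h => hi.2 j h hj⟩
    set g : ℂ → Fin n → ℂ := fun z => ∑ j, c j • f j z with hg
    have hga : AnalyticAt ℂ g z₀ :=
      Finset.analyticAt_fun_sum _ fun j _ => analyticAt_const.fun_smul (hf j)
    have hg0 : g z₀ = 0 := by
      rw [Matrix.vecMul_eq_sum] at hcz
      exact hcz
    have hgq : ∀ z, g z = (z - z₀) • dslope g z₀ z := fun z => by
      rw [sub_smul_dslope, hg0, sub_zero]
    have hqa : AnalyticAt ℂ (dslope g z₀) z₀ := by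
      obtain ⟨p, hp⟩ := hga
      exact ⟨_, hp.has_fpower_series_dslope_fslope⟩
    have hgker : ∀ᶠ z in 𝓝 z₀, (A z ^ (n - (i : ℕ))) (g z) = 0 := by
      filter_upwards [eventually_all.2 hker] with z h
      simp only [hg, map_sum, map_smul]
      refine Finset.sum_eq_zero fun j _ => ?_
      rcases lt_or_ge j i with hji | hij
      · simp [hmin j hji]
      · rw [pow_apply_eq_zero_of_le (a := n - (j : ℕ)) (by have := Fin.le_def.1 hij; omega) (h j),
          smul_zero]
    -- Off z₀ the scalar z - z₀ can be cancelled; the identity theorem adds z₀ itself.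
    have hqker : ∀ᶠ z in 𝓝 z₀, (A z ^ (n - (i : ℕ))) (dslope g z₀ z) = 0 := by
      rw [← (analyticAt_pow_apply hA hqa _).frequently_zero_iff_eventually_zero]
      refine Eventually.frequently ?_
      filter_upwards [hgker.filter_mono nhdsWithin_le_nhds, self_mem_nhdsWithin] with z h1 h2
      rw [hgq, map_smul, smul_eq_zero] at h1
      exact h1.resolve_left (sub_ne_zero.2 h2)
    have hf' : ∀ j, AnalyticAt ℂ (Function.update f i (dslope g z₀) j) z₀ := by
      intro j
      by_cases hj : j = i
      · subst hj; simpa using hqa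
      · simpa [Function.update_of_ne hj] using hf j
    refine ih (Function.update f i (dslope g z₀)) hf' ?_ ?_
    · intro j
      by_cases hj : j = i
      · subst hj; simpa using hqker
      · simpa [Function.update_of_ne hj] using hker j
    -- Undoing the division turns row i into Σ c j f j, which contributes c i times the old
    -- determinant. As c i ≠ 0, the order of vanishing drops by exactly one.
    · have hdet : (fun z => (z - z₀) *
          (Matrix.of fun j => Function.update f i (dslope g z₀) j z).det) =
          fun z => c i * (Matrix.of fun j => f j z).det := by
        funext z
        have e1 : (Matrix.of fun j => Function.update f i (dslope g z₀) j z) =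
            (Matrix.of fun j => f j z).updateRow i (dslope g z₀ z) := by
          ext j k
          by_cases hj : j = i
          · subst hj; simp
          · simp [Function.update_of_ne hj, Matrix.updateRow_ne hj]
        rw [e1, ← Matrix.det_updateRow_smul, ← hgq, ← smul_eq_mul,
          ← Matrix.det_updateRow_sum]
        rfl
      have hD' : AnalyticAt ℂ (fun z =>
          (Matrix.of fun j => Function.update f i (dslope g z₀) j z).det) z₀ :=
        analyticAt_det fun j k => analyticAt_pi_iff.1 (hf' j) k
      have hD : AnalyticAt ℂ (fun z => (Matrix.of fun j => f j z).det) z₀ :=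
        analyticAt_det fun j k => analyticAt_pi_iff.1 (hf j) k
      have h1 := congrArg (fun F => analyticOrderAt F z₀) hdet
      have h2 := analyticOrderAt_mul (f := fun z => z - z₀) (z₀ := z₀) (by fun_prop) hD'
      have h3 := analyticOrderAt_mul (f := fun _ => c i) (z₀ := z₀) (by fun_prop) hD
      have h4 : analyticOrderAt (fun z => z - z₀) z₀ = 1 := by
        simp
      have h5 : analyticOrderAt (fun _ : ℂ => c i) z₀ = 0 :=
        analyticAt_const.analyticOrderAt_eq_zero.2 hi
      simp only [Pi.mul_def] at h2 h3
      simp only [h2, h3, h4, h5, hord, zero_add, Nat.cast_add, Nat.cast_one] at h1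
      rw [add_comm] at h1
      exact (ENat.add_left_injective_of_ne_top (by simp)) h1

/-- Local frames adapted to the filtration by the saturated kernels of the powers of a generically
regular nilpotent family. -/
theorem exists_analytic_adapted_frame
    (hA : ∀ f : ℂ → Fin n → ℂ, AnalyticAt ℂ f z₀ → AnalyticAt ℂ (fun z => A z (f z)) z₀)
    (hnil : ∀ᶠ z in 𝓝 z₀, A z ^ n = 0) (hne : ∀ᶠ z in 𝓝[≠] z₀, A z ^ (n - 1) ≠ 0) :
    ∃ f : Fin n → ℂ → Fin n → ℂ, (∀ i, AnalyticAt ℂ (f i) z₀) ∧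
      (∀ i : Fin n, ∀ᶠ z in 𝓝 z₀, (A z ^ (n - (i : ℕ))) (f i z) = 0) ∧
      (Matrix.of fun i => f i z₀).det ≠ 0 := by
  -- If A^(n-1) killed every standard basis vector near z₀, it would vanish there; so some constant
  -- vector serves as a cyclic vector on a punctured neighbourhood.
  obtain ⟨v, hv⟩ : ∃ v : Fin n → ℂ, ∀ᶠ z in 𝓝[≠] z₀, (A z ^ (n - 1)) v ≠ 0 := by
    by_contra! h
    have h1 : ∀ j : Fin n, ∀ᶠ z in 𝓝 z₀, (A z ^ (n - 1)) (Pi.single j 1) = 0 := fun j =>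
      ((analyticAt_pow_apply hA analyticAt_const
        (n - 1)).eventually_eq_zero_or_eventually_ne_zero).resolve_right (h _)
    obtain ⟨z, hz1, hz2⟩ :=
      (((eventually_all.2 h1).filter_mono nhdsWithin_le_nhds).and hne).exists
    exact hz2 (LinearMap.pi_ext' fun j => LinearMap.ext_ring (by simpa using hz1 j))
  have hfa : ∀ i : Fin n, AnalyticAt ℂ (fun z => (A z ^ (i : ℕ)) v) z₀ := fun i =>
    analyticAt_pow_apply hA analyticAt_const _
  have hD : AnalyticAt ℂ (fun z => (Matrix.of fun i : Fin n => (A z ^ (i : ℕ)) v).det) z₀ :=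
    analyticAt_det fun j k => analyticAt_pi_iff.1 (hfa j) k
  -- The determinant of v, Av, …, A^(n-1) v is non-zero off z₀, so its order at z₀ is finite and can
  -- drive the induction.
  have hord : analyticOrderAt (fun z => (Matrix.of fun i : Fin n => (A z ^ (i : ℕ)) v).det) z₀ ≠
      ⊤ := by
    rw [Ne, analyticOrderAt_eq_top]
    intro h
    obtain ⟨z, ⟨hz1, hz2⟩, hz3⟩ :=
      (((h.and hnil).filter_mono nhdsWithin_le_nhds).and hv).exists
    have hli := linearIndependent_pow_apply hz2 hz3
    exact (Matrix.linearIndependent_rows_iff_isUnit.1 hli).map Matrix.detMonoidHom |>.ne_zero hz1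
  refine exists_independent_of_generically_independent hA _ (fun i z => (A z ^ (i : ℕ)) v) hfa
    (fun i => ?_) (ENat.natCast_toNat hord).symm
  filter_upwards [hnil] with z hz
  rw [← Module.End.mul_apply, ← pow_add, Nat.sub_add_cancel i.2.le, hz, LinearMap.zero_apply]

end Analytic

/-! ### Holomorphic sections in coordinates -/

section Charts

variable {X : Type*} [TopologicalSpace X] [ChartedSpace ℂ X]

theorem tendsto_chart_symm (x₀ : X) :
    Tendsto (chartAt ℂ x₀).symm (𝓝 (chartAt ℂ x₀ x₀)) (𝓝 x₀) := by
  have h := (chartAt ℂ x₀).continuousAt_symm (mem_chart_target ℂ x₀)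
  rwa [ContinuousAt, (chartAt ℂ x₀).left_inv (mem_chart_source ℂ x₀)] at h

theorem tendsto_chart (x₀ : X) : Tendsto (chartAt ℂ x₀) (𝓝 x₀) (𝓝 (chartAt ℂ x₀ x₀)) :=
  (chartAt ℂ x₀).continuousAt (mem_chart_source ℂ x₀)

theorem tendsto_chart_symm_ne (x₀ : X) :
    Tendsto (chartAt ℂ x₀).symm (𝓝[≠] (chartAt ℂ x₀ x₀)) (𝓝[≠] x₀) := by
  refine tendsto_nhdsWithin_iff.2 ⟨(tendsto_chart_symm x₀).mono_left nhdsWithin_le_nhds, ?_⟩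
  filter_upwards [nhdsWithin_le_nhds ((chartAt ℂ x₀).open_target.mem_nhds (mem_chart_target ℂ x₀)),
    self_mem_nhdsWithin] with z hz hne h
  refine hne ?_
  have := (chartAt ℂ x₀).right_inv hz
  rw [show (chartAt ℂ x₀).symm z = x₀ from h] at this
  exact this.symm

theorem tendsto_chart_ne (x₀ : X) :
    Tendsto (chartAt ℂ x₀) (𝓝[≠] x₀) (𝓝[≠] (chartAt ℂ x₀ x₀)) := by
  refine tendsto_nhdsWithin_iff.2 ⟨(tendsto_chart x₀).mono_left nhdsWithin_le_nhds, ?_⟩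
  filter_upwards [nhdsWithin_le_nhds ((chartAt ℂ x₀).open_source.mem_nhds (mem_chart_source ℂ x₀)),
    self_mem_nhdsWithin] with y hy hne h
  exact hne ((chartAt ℂ x₀).injOn hy (mem_chart_source ℂ x₀) h)

theorem eventually_chart_left_inv (x₀ : X) :
    ∀ᶠ y in 𝓝 x₀, (chartAt ℂ x₀).symm (chartAt ℂ x₀ y) = y := by
  filter_upwards [(chartAt ℂ x₀).open_source.mem_nhds (mem_chart_source ℂ x₀)] with y hy
  exact (chartAt ℂ x₀).left_inv hy

theorem eventually_chart_right_inv (x₀ : X) :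
    ∀ᶠ z in 𝓝 (chartAt ℂ x₀ x₀), chartAt ℂ x₀ ((chartAt ℂ x₀).symm z) = z := by
  filter_upwards [(chartAt ℂ x₀).open_target.mem_nhds (mem_chart_target ℂ x₀)] with y hy
  exact (chartAt ℂ x₀).right_inv hy

/-- Dichotomy of isolated zeros propagates on a connected space: if locally a property holds
identically or fails on a punctured neighbourhood, and it fails somewhere, then it fails on a
punctured neighbourhood of each point. -/
theorem eventually_not_of_connected {Y : Type*} [TopologicalSpace Y] [PreconnectedSpace Y]
    {P : Y → Prop} (hP : ∀ x, (∀ᶠ y in 𝓝 x, P y) ∨ ∀ᶠ y in 𝓝[≠] x, ¬P y) (hne : ∃ x, ¬P x)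
    (x : Y) : ∀ᶠ y in 𝓝[≠] x, ¬P y := by
  -- Openness is automatic. For closedness, the punctured alternative at a limit point would forbid
  -- nearby points around which P holds.
  have hclopen : IsClopen {x | ∀ᶠ y in 𝓝 x, P y} := by
    refine ⟨?_, isOpen_setOfPred_eventually_nhds⟩
    refine isClosed_of_closure_subset fun y hy => ?_
    by_contra hny
    have h := (hP y).resolve_left hny
    rw [eventually_nhdsWithin_iff] at h
    obtain ⟨w, hw1, hw2⟩ := mem_closure_iff_nhds.1 hy _ h
    by_cases hwy : w = y
    · exact hny (hwy ▸ hw2)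
    · exact hw1 hwy (Eventually.self_of_nhds hw2)
  rcases isClopen_iff.1 hclopen with h | h
  · exact (hP x).resolve_left fun hx => by
      have : x ∈ ({x | ∀ᶠ y in 𝓝 x, P y} : Set Y) := hx
      simp [h] at this
  · obtain ⟨w, hw⟩ := hne
    have : w ∈ ({x | ∀ᶠ y in 𝓝 x, P y} : Set Y) := h ▸ mem_univ w
    exact absurd (Eventually.self_of_nhds this) hw

theorem contDiffAt_comp_chart_symm {F : Type*} [NormedAddCommGroup F] [NormedSpace ℝ F]
    {f : X → F} {m : WithTop ℕ∞} {x₀ : X} (hf : ContMDiffAt 𝓘(ℝ, ℂ) 𝓘(ℝ, F) m f x₀) :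
    ContDiffAt ℝ m (fun z => f ((chartAt ℂ x₀).symm z)) (chartAt ℂ x₀ x₀) := by
  have h := (contMDiffAt_iff.1 hf).2
  simpa [contDiffWithinAt_univ, Function.comp_def, chartAt_self_eq] using h

variable [IsManifold 𝓘(ℂ, ℂ) ω X]

theorem coordVec_ne_zero {x₀ x : X} (hx : x ∈ (chartAt ℂ x₀).source) :
    coordVec (chartAt ℂ x₀) x ≠ 0 := by
  have : IsManifold 𝓘(ℂ, ℂ) 1 X := IsManifold.of_le (n := ω) le_top
  have he := (mdifferentiable_chart (I := 𝓘(ℂ, ℂ)) x₀).mfderiv hx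
  have h : (mfderiv 𝓘(ℂ, ℂ) 𝓘(ℂ, ℂ) (chartAt ℂ x₀) x).inverse =
      (((mdifferentiable_chart (I := 𝓘(ℂ, ℂ)) x₀).mfderiv hx).symm :
        TangentSpace 𝓘(ℂ, ℂ) (chartAt ℂ x₀ x) →L[ℂ] TangentSpace 𝓘(ℂ, ℂ) x) := by
    rw [← ContinuousLinearMap.inverse_equiv]
    rfl
  rw [coordVec, h]
  exact fun h0 => one_ne_zero (α := ℂ)
    (((mdifferentiable_chart (I := 𝓘(ℂ, ℂ)) x₀).mfderiv hx).symm.map_eq_zero_iff.1 h0)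

theorem exists_smul_coordVec {x₀ x : X} (hx : x ∈ (chartAt ℂ x₀).source)
    (t : TangentSpace 𝓘(ℂ, ℂ) x) : ∃ c : ℂ, t = c • coordVec (chartAt ℂ x₀) x :=
  ⟨(id t : ℂ) / (id (coordVec (chartAt ℂ x₀) x) : ℂ),
    (div_mul_cancel₀ (G₀ := ℂ) t (coordVec_ne_zero hx)).symm⟩

theorem ConformalMetric.density_pos (g : ConformalMetric X) {x₀ x : X}
    (hx : x ∈ (chartAt ℂ x₀).source) : 0 < g.density (chartAt ℂ x₀) x :=
  g.sq_pos _ _ (coordVec_ne_zero hx)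

end Charts

/-! ### Fibre coordinates and holomorphic sections -/

section Sections

variable {X : Type*} [TopologicalSpace X] [ChartedSpace ℂ X]
  {n : ℕ} {E : X → Type*}
  [TopologicalSpace (TotalSpace (Fin n → ℂ) E)]
  [∀ x, TopologicalSpace (E x)] [∀ x, AddCommGroup (E x)] [∀ x, Module ℂ (E x)]
  [FiberBundle (Fin n → ℂ) E] [VectorBundle ℂ (Fin n → ℂ) E]

variable (n E) in
/-- Coordinates of a vector in the preferred trivialization at `x₀`. -/
def toCoord (x₀ y : X) : E y →ₗ[ℂ] (Fin n → ℂ) :=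
  (trivializationAt (Fin n → ℂ) E x₀).linearMapAt ℂ y

variable (n E) in
/-- The vector with given coordinates in the preferred trivialization at `x₀`. -/
def ofCoord (x₀ y : X) : (Fin n → ℂ) →ₗ[ℂ] E y :=
  (trivializationAt (Fin n → ℂ) E x₀).symmₗ ℂ y

variable (n E) in
/-- The domain of the preferred chart and trivialization at `x₀`. -/
def coordDomain (x₀ : X) : Set X :=
  (chartAt ℂ x₀).source ∩ (trivializationAt (Fin n → ℂ) E x₀).baseSet

theorem isOpen_coordDomain (x₀ : X) : IsOpen (coordDomain n E x₀) :=
  (chartAt ℂ x₀).open_source.inter (trivializationAt (Fin n → ℂ) E x₀).open_baseSet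

theorem mem_coordDomain (x₀ : X) : x₀ ∈ coordDomain n E x₀ :=
  ⟨mem_chart_source ℂ x₀, FiberBundle.mem_baseSet_trivializationAt' x₀⟩

theorem ofCoord_toCoord {x₀ y : X} (hy : y ∈ coordDomain n E x₀) (v : E y) :
    ofCoord n E x₀ y (toCoord n E x₀ y v) = v :=
  Trivialization.symmₗ_linearMapAt _ hy.2 v

theorem toCoord_ofCoord {x₀ y : X} (hy : y ∈ coordDomain n E x₀) (v : Fin n → ℂ) :
    toCoord n E x₀ y (ofCoord n E x₀ y v) = v :=
  Trivialization.linearMapAt_symmₗ _ hy.2 v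

theorem toCoord_injective {x₀ y : X} (hy : y ∈ coordDomain n E x₀) :
    Function.Injective (toCoord n E x₀ y) :=
  Function.LeftInverse.injective (ofCoord_toCoord hy)

variable (n E) in
theorem finrank_fiber (x : X) : Module.finrank ℂ (E x) = n := by
  have := ((trivializationAt (Fin n → ℂ) E x).continuousLinearEquivAt ℂ x
    (FiberBundle.mem_baseSet_trivializationAt' x)).toLinearEquiv.finrank_eq
  simpa using this

variable [IsManifold 𝓘(ℂ, ℂ) ω X] [ContMDiffVectorBundle ω (Fin n → ℂ) E 𝓘(ℂ, ℂ)]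

/-- Regularity C^ω over ℂ is analyticity, so isolated zeros and orders of vanishing become available
for sections; the next theorem goes back. -/
theorem IsHolomorphicOn.analyticAt_toCoord {s : ∀ x, E x} {U : Set X}
    (hs : IsHolomorphicOn n s U) (hU : IsOpen U) {x₀ : X} (hx : x₀ ∈ U) :
    AnalyticAt ℂ (fun z => toCoord n E x₀ ((chartAt ℂ x₀).symm z)
      (s ((chartAt ℂ x₀).symm z))) (chartAt ℂ x₀ x₀) := by
  have h1 := (hs x₀ hx).contMDiffAt (hU.mem_nhds hx)
  rw [(trivializationAt (Fin n → ℂ) E x₀).contMDiffAt_section_iff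
    (FiberBundle.mem_baseSet_trivializationAt' x₀)] at h1
  have h2 := (contMDiffAt_iff.1 h1).2
  rw [ModelWithCorners.range_eq_univ, contDiffWithinAt_omega_iff_analyticWithinAt,
    analyticWithinAt_univ] at h2
  refine h2.congr ?_
  filter_upwards [(tendsto_chart_symm x₀).eventually
    ((isOpen_coordDomain (n := n) (E := E) x₀).mem_nhds (mem_coordDomain x₀))] with z hz
  simp [toCoord, Trivialization.coe_linearMapAt_of_mem _ hz.2, chartAt_self_eq]

theorem exists_isHolomorphicOn_ofCoord {x₀ : X} {f : ℂ → Fin n → ℂ}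
    (hf : AnalyticAt ℂ f (chartAt ℂ x₀ x₀)) :
    ∃ U, IsOpen U ∧ x₀ ∈ U ∧ U ⊆ coordDomain n E x₀ ∧
      IsHolomorphicOn n (fun y => ofCoord n E x₀ y (f (chartAt ℂ x₀ y))) U := by
  obtain ⟨V, hV, hVo, hxV⟩ := eventually_nhds_iff.1
    ((tendsto_chart x₀).eventually hf.eventually_analyticAt)
  refine ⟨coordDomain n E x₀ ∩ V, (isOpen_coordDomain x₀).inter hVo, ⟨mem_coordDomain x₀, hxV⟩,
    inter_subset_left, fun y hy => ContMDiffAt.contMDiffWithinAt ?_⟩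
  rw [(trivializationAt (Fin n → ℂ) E x₀).contMDiffAt_section_iff hy.1.2]
  have h1 : ContMDiffAt 𝓘(ℂ, ℂ) 𝓘(ℂ, Fin n → ℂ) ω (fun y => f (chartAt ℂ x₀ y)) y :=
    ((hV y hy.2).contDiffAt.contMDiffAt (n := ω)).comp y
      (contMDiffAt_of_mem_maximalAtlas (IsManifold.chart_mem_maximalAtlas x₀) hy.1.1)
  refine h1.congr_of_eventuallyEq ?_
  filter_upwards [(isOpen_coordDomain (n := n) (E := E) x₀).mem_nhds hy.1] with w hw
  have := toCoord_ofCoord hw (f (chartAt ℂ x₀ w))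
  rwa [toCoord, Trivialization.coe_linearMapAt_of_mem _ hw.2] at this

end Sections

/-! ### Frames adapted to the filtration G_k -/

section AdaptedFrames

variable {X : Type*} [TopologicalSpace X] [ChartedSpace ℂ X]
  {n : ℕ} {E : X → Type*}
  [TopologicalSpace (TotalSpace (Fin n → ℂ) E)]
  [∀ x, TopologicalSpace (E x)] [∀ x, AddCommGroup (E x)] [∀ x, Module ℂ (E x)]
  [FiberBundle (Fin n → ℂ) E] [VectorBundle ℂ (Fin n → ℂ) E]

theorem IsHolomorphicOn.mono {s : ∀ x, E x} {U V : Set X} (hs : IsHolomorphicOn n s U)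
    (h : V ⊆ U) : IsHolomorphicOn n s V :=
  ContMDiffOn.mono hs h

theorem IsHolomorphicFrame.mono {A B : ∀ x, Submodule ℂ (E x)} {r : ℕ} {U V : Set X}
    {s : Fin r → ∀ x, E x} (hs : IsHolomorphicFrame n A B U s) (hV : IsOpen V) (h : V ⊆ U) :
    IsHolomorphicFrame n A B V s :=
  ⟨hV, fun i => (hs.holomorphic i).mono h, fun i x hx => hs.mem i x (h hx),
    fun x hx => hs.linearIndependent x (h hx), fun x hx => hs.span x (h hx)⟩

theorem IsHolomorphicFrame.linearIndependent_vectors {A : ∀ x, Submodule ℂ (E x)} {r : ℕ}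
    {U : Set X} {s : Fin r → ∀ x, E x} (hs : IsHolomorphicFrame n A (fun _ => ⊥) U s)
    {x : X} (hx : x ∈ U) : LinearIndependent ℂ fun i => s i x :=
  LinearIndependent.of_comp _ (hs.linearIndependent x hx)

theorem isHolomorphicFrame_of_linearIndependent {U : Set X} {s : Fin n → ∀ x, E x}
    (hU : IsOpen U) (hs : ∀ i, IsHolomorphicOn n (s i) U)
    (hli : ∀ x ∈ U, LinearIndependent ℂ fun i => s i x) :
    IsHolomorphicFrame n (fun _ => ⊤) (fun _ => ⊥) U s where
  isOpen := hU
  holomorphic := hs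
  mem := fun _ _ _ => Submodule.mem_top
  linearIndependent := fun x hx => (hli x hx).map' _ (Submodule.ker_mkQ ⊥)
  span := fun x hx => by
    have := finiteDimensional_fiber n E x
    rw [(hli x hx).span_eq_top_of_card_eq_finrank' (by simp [finrank_fiber n E x])]
    exact le_sup_left

/-- Coordinates as a linear equivalence of fibres. -/
theorem linearIndependent_toCoord {x₀ y : X} (hy : y ∈ coordDomain n E x₀) {ι : Type*}
    {v : ι → E y} : LinearIndependent ℂ (fun i => toCoord n E x₀ y (v i)) ↔
      LinearIndependent ℂ v :=
  LinearMap.linearIndependent_iff (v := v) _ (LinearMap.ker_eq_bot.2 (toCoord_injective hy))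

theorem det_ne_zero_iff_linearIndependent {v : Fin n → Fin n → ℂ} :
    (Matrix.of v).det ≠ 0 ↔ LinearIndependent ℂ v := by
  rw [← isUnit_iff_ne_zero, ← Matrix.isUnit_iff_isUnit_det,
    ← Matrix.linearIndependent_rows_iff_isUnit]
  rfl

variable [IsManifold 𝓘(ℂ, ℂ) ω X] [ContMDiffVectorBundle ω (Fin n → ℂ) E 𝓘(ℂ, ℂ)]

theorem IsHolomorphicOn.eventually_eq_zero_or {s : ∀ x, E x} {U : Set X}
    (hs : IsHolomorphicOn n s U) (hU : IsOpen U) {x₀ : X} (hx : x₀ ∈ U) :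
    (∀ᶠ y in 𝓝 x₀, s y = 0) ∨ ∀ᶠ y in 𝓝[≠] x₀, s y ≠ 0 := by
  have hD := (isOpen_coordDomain (n := n) (E := E) x₀).mem_nhds (mem_coordDomain x₀)
  rcases (hs.analyticAt_toCoord hU hx).eventually_eq_zero_or_eventually_ne_zero with h | h
  · left
    filter_upwards [(tendsto_chart x₀).eventually h, hD, eventually_chart_left_inv x₀]
      with y h1 h2 h3
    rw [h3] at h1
    exact toCoord_injective h2 (h1.trans (map_zero _).symm)
  · right
    filter_upwards [(tendsto_chart_ne x₀).eventually h, nhdsWithin_le_nhds hD,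
      nhdsWithin_le_nhds (eventually_chart_left_inv x₀)] with y h1 h2 h3 h4
    rw [h3, h4, map_zero] at h1
    exact h1 rfl

/-- The coefficients of a holomorphic section in a holomorphic frame are holomorphic. -/
theorem IsHolomorphicFrame.exists_coeff {U : Set X} {s : Fin n → ∀ x, E x}
    (hs : IsHolomorphicFrame n (fun _ => ⊤) (fun _ => ⊥) U s) {x₀ : X} (hx : x₀ ∈ U)
    {V : Set X} {σ : ∀ x, E x} (hσ : IsHolomorphicOn n σ V) (hV : IsOpen V) (hxV : x₀ ∈ V) :
    ∃ a : Fin n → ℂ → ℂ, (∀ i, AnalyticAt ℂ (a i) (chartAt ℂ x₀ x₀)) ∧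
      ∀ᶠ y in 𝓝 x₀, σ y = ∑ i, a i (chartAt ℂ x₀ y) • s i y := by
  have hD := (isOpen_coordDomain (n := n) (E := E) x₀).mem_nhds (mem_coordDomain x₀)
  obtain ⟨a, ha, ha'⟩ := exists_analytic_coeff
    (fun i => (hs.holomorphic i).analyticAt_toCoord hs.isOpen hx) (by
      rw [det_ne_zero_iff_linearIndependent]
      have h : ∀ y, y = x₀ → LinearIndependent ℂ fun i => toCoord n E x₀ y (s i y) := by
        rintro _ rfl
        exact (linearIndependent_toCoord (mem_coordDomain _)).2 (hs.linearIndependent_vectors hx)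
      exact h _ ((chartAt ℂ x₀).left_inv (mem_chart_source ℂ x₀))) (hσ.analyticAt_toCoord hV hxV)
  refine ⟨a, ha, ?_⟩
  filter_upwards [(tendsto_chart x₀).eventually ha', hD, eventually_chart_left_inv x₀]
    with y h1 h2 h3
  rw [h3] at h1
  refine toCoord_injective h2 (h1.trans ?_)
  simp

namespace HiggsField

variable (θ : HiggsField n E)

/-- `θ(∂/∂z)` for the preferred coordinate `z` at `x₀`. -/
def localEnd (x₀ y : X) : Module.End ℂ (E y) := θ.field y (coordVec (chartAt ℂ x₀) y)

theorem exists_field_eq_smul {x₀ y : X} (hy : y ∈ (chartAt ℂ x₀).source)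
    (t : TangentSpace 𝓘(ℂ, ℂ) y) : ∃ c : ℂ, θ.field y t = c • θ.localEnd x₀ y := by
  obtain ⟨c, rfl⟩ := exists_smul_coordVec hy t
  exact ⟨c, map_smul _ _ _⟩

theorem field_pow_apply_eq_zero {x₀ y : X} (hy : y ∈ (chartAt ℂ x₀).source) {m : ℕ} {v : E y}
    (h : (θ.localEnd x₀ y ^ m) v = 0) (t : TangentSpace 𝓘(ℂ, ℂ) y) :
    (θ.field y t ^ m) v = 0 := by
  obtain ⟨c, hc⟩ := θ.exists_field_eq_smul hy t
  rw [hc, smul_pow, LinearMap.smul_apply, h, smul_zero]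

theorem isHolomorphicOn_localEnd_pow {x₀ : X} {U : Set X} (hU : IsOpen U)
    (hUs : U ⊆ (chartAt ℂ x₀).source) {s : ∀ x, E x} (hs : IsHolomorphicOn n s U) (m : ℕ) :
    IsHolomorphicOn n (fun y => (θ.localEnd x₀ y ^ m) (s y)) U := by
  induction m with
  | zero => simpa using hs
  | succ m ih =>
    simp only [pow_succ', Module.End.mul_apply]
    exact θ.holomorphic _ (IsManifold.chart_mem_maximalAtlas x₀) U hU hUs _ ih

/-- Test θ(∂/∂z)^m on the coordinate frame: each image is a holomorphic section with the dichotomy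
of isolated zeros, and one image that is not identically zero decides for the whole endomorphism. -/
theorem eventually_pow_eq_zero_or (m : ℕ) (x₀ : X) :
    (∀ᶠ y in 𝓝 x₀, ∀ t, θ.field y t ^ m = 0) ∨
      ∀ᶠ y in 𝓝[≠] x₀, ¬∀ t, θ.field y t ^ m = 0 := by
  have hD := (isOpen_coordDomain (n := n) (E := E) x₀).mem_nhds (mem_coordDomain x₀)
  have hc : ∀ j : Fin n, ∃ U, IsOpen U ∧ x₀ ∈ U ∧ U ⊆ coordDomain n E x₀ ∧
      IsHolomorphicOn n (fun y => ofCoord n E x₀ y (Pi.single j 1)) U := fun j =>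
    exists_isHolomorphicOn_ofCoord (f := fun _ => Pi.single j 1) analyticAt_const
  have hd : ∀ j : Fin n,
      (∀ᶠ y in 𝓝 x₀, (θ.localEnd x₀ y ^ m) (ofCoord n E x₀ y (Pi.single j 1)) = 0) ∨
      ∀ᶠ y in 𝓝[≠] x₀, (θ.localEnd x₀ y ^ m) (ofCoord n E x₀ y (Pi.single j 1)) ≠ 0 := by
    intro j
    obtain ⟨U, hU, hxU, hUD, hs⟩ := hc j
    exact (θ.isHolomorphicOn_localEnd_pow hU (fun y hy => (hUD hy).1) hs m).eventually_eq_zero_or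
      hU hxU
  by_cases hall : ∀ j : Fin n,
      ∀ᶠ y in 𝓝 x₀, (θ.localEnd x₀ y ^ m) (ofCoord n E x₀ y (Pi.single j 1)) = 0
  · left
    filter_upwards [eventually_all.2 hall, hD] with y h1 h2 t
    have h3 : (θ.localEnd x₀ y ^ m) ∘ₗ ofCoord n E x₀ y = 0 :=
      LinearMap.pi_ext' fun j => LinearMap.ext_ring (by simpa using h1 j)
    refine LinearMap.ext fun v => θ.field_pow_apply_eq_zero h2.1 ?_ t
    rw [← ofCoord_toCoord h2 v]
    exact LinearMap.congr_fun h3 _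
  · right
    rw [not_forall] at hall
    obtain ⟨j, hj⟩ := hall
    filter_upwards [(hd j).resolve_left hj] with y h1 h2
    exact h1 (by rw [localEnd, h2]; rfl)

theorem IsGenericallyRegularNilpotent.eventually_pow_ne_zero [PreconnectedSpace X]
    {θ : HiggsField n E} (hθ : θ.IsGenericallyRegularNilpotent) (x₀ : X) :
    ∀ᶠ y in 𝓝[≠] x₀, ∃ t, θ.field y t ^ (n - 1) ≠ 0 := by
  have h := eventually_not_of_connected (θ.eventually_pow_eq_zero_or (n - 1)) (by
    obtain ⟨x, v, h⟩ := hθ.2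
    exact ⟨x, fun h' => h (h' v)⟩) x₀
  simpa only [not_forall] using h

/-- A holomorphic frame of `E` near `x₀` whose members from the `k`-th on (counted from `0`) are a
frame of `G_k`, for all `k`. -/
structure IsAdaptedFrame (x₀ : X) (U : Set X) (s : Fin n → ∀ y, E y) : Prop where
  mem : x₀ ∈ U
  frame : IsHolomorphicFrame n (fun _ => ⊤) (fun _ => ⊥) U s
  filtration_eq : ∀ y ∈ U, ∀ k : ℕ, θ.filtration k y =
    Submodule.span ℂ (range fun i : {i : Fin n // k ≤ i} => s i y)

variable {θ}

/-- Away from x₀ the span of s_k, …, s_{n-1} fills ker θ^{n-k} for dimension reasons. At x₀ the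
kernel may be larger than G_k, so values of sections of the kernel sheaf are followed there by
continuation of their coefficients. The lemma serves both the general case and the CVHS case. -/
theorem exists_isAdaptedFrame_of_ker (hnil : ∀ y t, θ.field y t ^ n = 0) {x₀ : X}
    (hne : ∀ᶠ y in 𝓝[≠] x₀, ∃ t, θ.field y t ^ (n - 1) ≠ 0) {U : Set X} {s : Fin n → ∀ y, E y}
    (hs : IsHolomorphicFrame n (fun _ => ⊤) (fun _ => ⊥) U s) (hx : x₀ ∈ U)
    (hker : ∀ i : Fin n, ∀ y ∈ U, ∀ t, (θ.field y t ^ (n - (i : ℕ))) (s i y) = 0) :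
    ∃ V, θ.IsAdaptedFrame x₀ V s := by
  have hspan_ker : ∀ y ∈ U, ∀ (k : ℕ) t,
      Submodule.span ℂ (range fun i : {i : Fin n // k ≤ i} => s i y) ≤
        LinearMap.ker (θ.field y t ^ (n - k)) := by
    rintro y hy k t
    rw [Submodule.span_le]
    rintro _ ⟨i, rfl⟩
    exact pow_apply_eq_zero_of_le (by have := i.2; omega) (hker i y hy t)
  have hspan_le : ∀ y ∈ U, ∀ k : ℕ,
      Submodule.span ℂ (range fun i : {i : Fin n // k ≤ i} => s i y) ≤ θ.filtration k y := by
    rintro y hy k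
    rw [Submodule.span_le]
    rintro _ ⟨i, rfl⟩
    exact ⟨U, s i, hs.isOpen, hy, hs.holomorphic i, fun w hw t =>
      pow_apply_eq_zero_of_le (by have := i.2; omega) (hker i w hw t), rfl⟩
  -- The kernel has dimension at most n - k, and it contains at least n - k independent members of
  -- the frame.
  have hgen : ∀ y ∈ U, ∀ t, θ.field y t ^ (n - 1) ≠ 0 → ∀ k : ℕ,
      Submodule.span ℂ (range fun i : {i : Fin n // k ≤ i} => s i y) =
        LinearMap.ker (θ.field y t ^ (n - k)) := by
    intro y hy t ht k
    have := finiteDimensional_fiber n E y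
    refine Submodule.eq_of_le_of_finrank_le (hspan_ker y hy k t) ?_
    refine (finrank_ker_pow_le (finrank_fiber n E y) (hnil y t) ht (Nat.sub_le n k)).trans ?_
    have hli : LinearIndependent ℂ fun i : {i : Fin n // k ≤ i} => s i y :=
      (hs.linearIndependent_vectors hy).comp _ Subtype.val_injective
    rw [finrank_span_eq_card hli]
    simpa using Fintype.card_le_of_injective
      (fun i : Fin (n - k) => (⟨⟨k + i, by omega⟩, by simp⟩ : {i : Fin n // k ≤ i}))
      (fun a b hab => by
        have := congrArg (fun i => (i.1 : ℕ)) hab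
        exact Fin.ext (by simpa using this))
  rw [eventually_nhdsWithin_iff, eventually_nhds_iff] at hne
  obtain ⟨W, hW, hWo, hxW⟩ := hne
  refine ⟨U ∩ W, ⟨hx, hxW⟩, hs.mono (hs.isOpen.inter hWo) inter_subset_left, fun y hy k =>
    le_antisymm ?_ (hspan_le y hy.1 k)⟩
  rintro _ ⟨V, σ, hV, hyV, hσ, hσk, rfl⟩
  by_cases hyx : y = x₀
  · subst hyx
    obtain ⟨a, ha, ha'⟩ := hs.exists_coeff hx hσ hV hyV
    -- The coefficients of index below k vanish at nearby points other than x₀, where the span is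
    -- the kernel, hence also at x₀ by analyticity.
    have hzero : ∀ i : Fin n, (i : ℕ) < k → a i (chartAt ℂ y y) = 0 := by
      intro i hi
      refine Eventually.self_of_nhds (p := fun z => a i z = 0) ((ha i).frequently_zero_iff_eventually_zero.1
        (Eventually.frequently ?_))
      filter_upwards [(tendsto_chart_symm y).eventually ha' |>.filter_mono nhdsWithin_le_nhds,
        (tendsto_chart_symm_ne y).eventually (self_mem_nhdsWithin),
        ((tendsto_chart_symm y).eventually ((hV.inter (hs.isOpen.inter hWo)).mem_nhds
          ⟨hyV, hy⟩)).filter_mono nhdsWithin_le_nhds,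
        (eventually_chart_right_inv y).filter_mono nhdsWithin_le_nhds] with z h1 h2 h3 h4
      obtain ⟨t, ht⟩ := hW _ h3.2.2 h2
      have h5 : σ ((chartAt ℂ y).symm z) ∈ Submodule.span ℂ
          (range fun i : {i : Fin n // k ≤ i} => s i ((chartAt ℂ y).symm z)) := by
        rw [hgen _ h3.2.1 t ht]
        exact hσk _ h3.1 t
      rw [h1, h4] at h5
      obtain ⟨b, hb⟩ := (Submodule.mem_span_range_iff_exists_fun ℂ).1 h5
      have hli := hs.linearIndependent_vectors h3.2.1
      rw [sum_smul_subtype_eq_sum_dite (fun i : Fin n => k ≤ i) b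
        (fun i => s i ((chartAt ℂ y).symm z))] at hb
      have := Fintype.linearIndependent_iff.1 hli
        (fun j => a j z - if h : k ≤ j then b ⟨j, h⟩ else 0) (by
          simp only [sub_smul, Finset.sum_sub_distrib, hb, sub_self]) i
      simpa [not_le.2 hi] using this
    have h6 := ha'.self_of_nhds
    rw [h6]
    refine Submodule.sum_mem _ fun i _ => ?_
    by_cases hi : k ≤ i
    · exact Submodule.smul_mem _ _ (Submodule.subset_span ⟨⟨i, hi⟩, rfl⟩)
    · rw [hzero i (not_le.1 hi), zero_smul]
      exact Submodule.zero_mem _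
  · obtain ⟨t, ht⟩ := hW y hy.2 hyx
    rw [hgen y hy.1 t ht]
    exact hσk y hyV t

/-- In the trivialization, θ(∂/∂z) becomes an analytic family A of endomorphisms of ℂⁿ, to which
saturation applies; its germs of vectors are then shrunk to a common domain on which they form a
frame. -/
theorem IsGenericallyRegularNilpotent.exists_isAdaptedFrame [PreconnectedSpace X]
    (hθ : θ.IsGenericallyRegularNilpotent) (x₀ : X) :
    ∃ U s, θ.IsAdaptedFrame x₀ U s := by
  set A : ℂ → Module.End ℂ (Fin n → ℂ) := fun z =>
    toCoord n E x₀ ((chartAt ℂ x₀).symm z) ∘ₗ θ.localEnd x₀ ((chartAt ℂ x₀).symm z) ∘ₗ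
      ofCoord n E x₀ ((chartAt ℂ x₀).symm z) with hAdef
  have hD := (isOpen_coordDomain (n := n) (E := E) x₀).mem_nhds (mem_coordDomain x₀)
  have hApow : ∀ z, (chartAt ℂ x₀).symm z ∈ coordDomain n E x₀ → ∀ m v,
      (A z ^ m) v = toCoord n E x₀ ((chartAt ℂ x₀).symm z)
        ((θ.localEnd x₀ ((chartAt ℂ x₀).symm z) ^ m)
          (ofCoord n E x₀ ((chartAt ℂ x₀).symm z) v)) := by
    intro z hz m v
    induction m with
    | zero => simp [toCoord_ofCoord hz]
    | succ m ih =>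
      rw [pow_succ', Module.End.mul_apply, ih, pow_succ', Module.End.mul_apply]
      simp [hAdef, ofCoord_toCoord hz]
  have hA : ∀ f : ℂ → Fin n → ℂ, AnalyticAt ℂ f (chartAt ℂ x₀ x₀) →
      AnalyticAt ℂ (fun z => A z (f z)) (chartAt ℂ x₀ x₀) := by
    intro f hf
    obtain ⟨U, hU, hxU, hUD, hs⟩ := exists_isHolomorphicOn_ofCoord (n := n) (E := E) hf
    have h1 := θ.isHolomorphicOn_localEnd_pow hU (fun y hy => (hUD hy).1) hs 1
    refine (h1.analyticAt_toCoord hU hxU).congr ?_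
    filter_upwards [eventually_chart_right_inv x₀] with z hz
    simp [hAdef, hz]
  obtain ⟨f, hf, hfk, hfd⟩ := exists_analytic_adapted_frame hA (by
      filter_upwards [(tendsto_chart_symm x₀).eventually hD] with z hz
      refine LinearMap.ext fun v => ?_
      rw [hApow z hz, localEnd, hθ.1]
      simp) (by
      filter_upwards [(tendsto_chart_symm_ne x₀).eventually (hθ.eventually_pow_ne_zero x₀),
        ((tendsto_chart_symm x₀).eventually hD).filter_mono nhdsWithin_le_nhds] with z h1 h2 h3
      obtain ⟨t, ht⟩ := h1
      refine ht (LinearMap.ext fun v => θ.field_pow_apply_eq_zero h2.1 ?_ t)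
      refine toCoord_injective h2 ?_
      have := hApow z h2 (n - 1) (toCoord n E x₀ _ v)
      rw [ofCoord_toCoord h2, h3] at this
      rw [← this, map_zero, LinearMap.zero_apply])
  choose U hU hxU hUD hUs using fun i => exists_isHolomorphicOn_ofCoord (n := n) (E := E) (hf i)
  have hev : ∀ᶠ y in 𝓝 x₀, (∀ i, y ∈ U i) ∧ y ∈ coordDomain n E x₀ ∧
      (∀ i : Fin n, (θ.localEnd x₀ y ^ (n - (i : ℕ)))
        (ofCoord n E x₀ y (f i (chartAt ℂ x₀ y))) = 0) ∧
      (Matrix.of fun i => f i (chartAt ℂ x₀ y)).det ≠ 0 := by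
    have hdet : AnalyticAt ℂ (fun z => (Matrix.of fun i => f i z).det) (chartAt ℂ x₀ x₀) :=
      analyticAt_det fun i j => analyticAt_pi_iff.1 (hf i) j
    filter_upwards [eventually_all.2 fun i => (hU i).mem_nhds (hxU i), hD,
      (tendsto_chart x₀).eventually (eventually_all.2 hfk), eventually_chart_left_inv x₀,
      (tendsto_chart x₀).eventually (hdet.continuousAt.eventually_ne hfd)] with y h1 h2 h3 h4 h5
    refine ⟨h1, h2, fun i => ?_, h5⟩
    have h6 := h3 i
    rw [hApow _ (by rwa [h4]), h4] at h6
    exact toCoord_injective h2 (h6.trans (map_zero _).symm)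
  obtain ⟨V, hV, hVo, hxV⟩ := eventually_nhds_iff.1 hev
  obtain ⟨W, hW⟩ := exists_isAdaptedFrame_of_ker hθ.1 (hθ.eventually_pow_ne_zero x₀)
    (s := fun i y => ofCoord n E x₀ y (f i (chartAt ℂ x₀ y)))
    (isHolomorphicFrame_of_linearIndependent hVo
      (fun i => (hUs i).mono fun y hy => (hV y hy).1 i) fun y hy => by
        have h := hV y hy
        rw [← linearIndependent_toCoord h.2.1]
        simp only [toCoord_ofCoord h.2.1]
        exact det_ne_zero_iff_linearIndependent.1 h.2.2.2) hxV
    (fun i y hy t => θ.field_pow_apply_eq_zero (hV y hy).2.1.1 ((hV y hy).2.2.1 i) t)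
  exact ⟨W, _, hW⟩

end HiggsField

end AdaptedFrames

/-! ### Induced metrics in adapted frames -/

section Induced

variable {X : Type*} [TopologicalSpace X] [ChartedSpace ℂ X]
  {n : ℕ} {E : X → Type*}
  [TopologicalSpace (TotalSpace (Fin n → ℂ) E)]
  [∀ x, TopologicalSpace (E x)] [∀ x, AddCommGroup (E x)] [∀ x, Module ℂ (E x)]
  [FiberBundle (Fin n → ℂ) E] [VectorBundle ℂ (Fin n → ℂ) E]

namespace HermitianMetric

variable (h : HermitianMetric n E) {x : X} {W : Submodule ℂ (E x)}

theorem eq_zero_of_form_self_eq_zero {v : E x} (hv : h.form x v v = 0) : v = 0 := by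
  by_contra hne
  have := h.pos x v hne
  simp [hv] at this

theorem form_self_im (v : E x) : (h.form x v v).im = 0 :=
  Complex.conj_eq_iff_im.1 (h.conj_symm x v v)

theorem perp_eq_zero {w : E x} (hw : w ∈ W) : h.perp W w = 0 := by
  have h1 : h.perp W w ∈ W := by
    have := W.sub_mem hw (h.sub_perp_mem W w)
    rwa [sub_sub_cancel] at this
  exact h.eq_zero_of_form_self_eq_zero (h.form_perp W w h1)

theorem perp_ne_zero {v : E x} (hv : v ∉ W) : h.perp W v ≠ 0 := fun h0 => hv (by
  have := h.sub_perp_mem W v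
  rwa [h0, sub_zero] at this)

theorem quotForm_self_im (v : E x) : (h.quotForm W v v).im = 0 := h.form_self_im _

theorem quotForm_self_pos {v : E x} (hv : v ∉ W) : 0 < (h.quotForm W v v).re :=
  h.pos x _ (h.perp_ne_zero hv)

theorem quotForm_smul_add (v : E x) {w : E x} (hw : w ∈ W) (c : ℂ) :
    (h.quotForm W (c • v + w) (c • v + w)).re = ‖c‖ ^ 2 * (h.quotForm W v v).re := by
  simp only [quotForm, map_add, map_smul, h.perp_eq_zero hw, add_zero, map_smulₛₗ,
    LinearMap.smul_apply, smul_eq_mul, ← mul_assoc, ← Complex.normSq_eq_norm_sq]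
  rw [mul_comm c, ← Complex.normSq_eq_conj_mul_self, Complex.re_ofReal_mul]

end HermitianMetric

variable [IsManifold 𝓘(ℂ, ℂ) ω X] [ContMDiffVectorBundle ω (Fin n → ℂ) E 𝓘(ℂ, ℂ)]

/-- θ(∂/∂z) carries a section killed by θ^{n-k} to one killed by θ^{n-k-1}. The bound k < n excludes
truncation in n - (k + 1). -/
theorem HiggsField.field_mem_filtration (θ : HiggsField n E) {k : ℕ} (hk : k < n) {x : X} {v : E x}
    (hv : v ∈ θ.filtration k x) (t : TangentSpace 𝓘(ℂ, ℂ) x) :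
    θ.field x t v ∈ θ.filtration (k + 1) x := by
  obtain ⟨U, s, hU, hxU, hs, hsk, rfl⟩ := hv
  obtain ⟨c, hc⟩ := θ.exists_field_eq_smul (mem_chart_source ℂ x) t
  rw [hc, LinearMap.smul_apply]
  refine Submodule.smul_mem _ _ ⟨U ∩ (chartAt ℂ x).source, _,
    hU.inter (chartAt ℂ x).open_source, ⟨hxU, mem_chart_source ℂ x⟩,
    θ.isHolomorphicOn_localEnd_pow (hU.inter (chartAt ℂ x).open_source) inter_subset_right
      (hs.mono inter_subset_left) 1, fun y hy t' => ?_, by simp⟩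
  refine θ.field_pow_apply_eq_zero hy.2 ?_ t'
  rw [← Module.End.mul_apply, ← pow_add]
  have : n - (k + 1) + 1 = n - k := by omega
  rw [this]
  exact hsk y hy.1 _

theorem HermitianMetric.gradedSq_smul_add (h : HermitianMetric n E) (θ : HiggsField n E) (i : ℕ)
    (x : X) (v : E x) {w : E x} (hw : w ∈ θ.filtration i x) (c : ℂ) :
    h.gradedSq θ i x (c • v + w) = ‖c‖ ^ 2 * h.gradedSq θ i x v :=
  h.quotForm_smul_add v hw c

namespace HiggsField.IsAdaptedFrame

variable {θ : HiggsField n E} {x₀ : X} {U : Set X} {s : Fin n → ∀ y, E y}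
  (hs : θ.IsAdaptedFrame x₀ U s)

include hs

theorem mem_filtration {y : X} (hy : y ∈ U) {k : ℕ} {i : Fin n} (hi : k ≤ i) :
    s i y ∈ θ.filtration k y := by
  rw [hs.filtration_eq y hy]
  exact Submodule.subset_span ⟨⟨i, hi⟩, rfl⟩

theorem notMem_filtration {y : X} (hy : y ∈ U) {k : ℕ} {i : Fin n} (hi : (i : ℕ) < k) :
    s i y ∉ θ.filtration k y := by
  rw [hs.filtration_eq y hy]
  have h := (hs.frame.linearIndependent_vectors hy).notMem_span_image (s := {j : Fin n | k ≤ j})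
    (x := i) (by simpa using hi)
  rwa [image_eq_range] at h

theorem exists_eq_smul_add {y : X} (hy : y ∈ U) {k : ℕ} {i : Fin n} (hi : (i : ℕ) = k) {v : E y}
    (hv : v ∈ θ.filtration k y) : ∃ c : ℂ, ∃ w ∈ θ.filtration (k + 1) y, v = c • s i y + w := by
  rw [hs.filtration_eq y hy] at hv
  obtain ⟨b, rfl⟩ := (Submodule.mem_span_range_iff_exists_fun ℂ).1 hv
  refine ⟨b ⟨i, hi.ge⟩, ∑ j ∈ Finset.univ.erase ⟨i, hi.ge⟩, b j • s j y,
    Submodule.sum_mem _ fun j hj => Submodule.smul_mem _ _ (hs.mem_filtration hy ?_),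
    (Finset.add_sum_erase _ _ (Finset.mem_univ _)).symm⟩
  have h1 := j.2
  have h2 : (j : Fin n) ≠ i := fun h => (Finset.mem_erase.1 hj).1 (Subtype.ext h)
  have h3 : ((j : Fin n) : ℕ) ≠ i := fun h => h2 (Fin.ext h)
  omega

theorem gradedFrame (i : Fin n) :
    IsHolomorphicFrame n (θ.filtration i) (θ.filtration (i + 1)) U (fun _ : Fin 1 => s i) where
  isOpen := hs.frame.isOpen
  holomorphic := fun _ => hs.frame.holomorphic i
  mem := fun _ y hy => hs.mem_filtration hy le_rfl
  linearIndependent := fun y hy => by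
    rw [linearIndependent_unique_iff]
    simpa using hs.notMem_filtration hy (Nat.lt_succ_self i)
  span := fun y hy v hv => by
    obtain ⟨c, w, hw, rfl⟩ := hs.exists_eq_smul_add hy rfl hv
    exact Submodule.add_mem_sup (Submodule.smul_mem _ _ (Submodule.subset_span ⟨0, rfl⟩)) hw

theorem span_sup_filtration {y : X} (hy : y ∈ U) {k : ℕ} (hk : k ≤ n) :
    Submodule.span ℂ (range fun i : Fin k => s (Fin.castLE hk i) y) ⊔ θ.filtration k y = ⊤ := by
  have := finiteDimensional_fiber n E y
  rw [eq_top_iff, ← (hs.frame.linearIndependent_vectors hy).span_eq_top_of_card_eq_finrank'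
    (by simp [finrank_fiber n E y]), Submodule.span_le]
  rintro _ ⟨i, rfl⟩
  rcases lt_or_ge (i : ℕ) k with hi | hi
  · exact Submodule.mem_sup_left (Submodule.subset_span ⟨⟨i, hi⟩, rfl⟩)
  · exact Submodule.mem_sup_right (hs.mem_filtration hy hi)

theorem eq_zero_of_sum_mem {y : X} (hy : y ∈ U) {k : ℕ} (hk : k ≤ n) {c : Fin k → ℂ}
    (hc : ∑ i, c i • s (Fin.castLE hk i) y ∈ θ.filtration k y) (i : Fin k) : c i = 0 := by
  rw [hs.filtration_eq y hy] at hc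
  have hli := hs.frame.linearIndependent_vectors hy
  have h1 : ∑ i, c i • s (Fin.castLE hk i) y ∈
      Submodule.span ℂ ((fun j => s j y) '' (range (Fin.castLE hk))) :=
    Submodule.sum_mem _ fun i _ => Submodule.smul_mem _ _
      (Submodule.subset_span ⟨_, mem_range_self i, rfl⟩)
  have hd := hli.disjoint_span_image (s := range (Fin.castLE hk)) (t := {j : Fin n | k ≤ j}) (by
    rw [Set.disjoint_left]
    rintro _ ⟨i, rfl⟩ hi
    exact absurd i.2 (not_lt.2 (by simpa using hi)))
  rw [image_eq_range (fun j => s j y) {j : Fin n | k ≤ j}] at hd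
  have h0 := (Submodule.disjoint_def.1 hd) _ h1 hc
  exact Fintype.linearIndependent_iff.1
    (hli.comp _ (Fin.castLE_injective hk)) c h0 i

/-- Shows that the local frames of E/G_k over which the curvature statements quantify do exist. -/
theorem quotientFrame {k : ℕ} (hk : k ≤ n) :
    IsHolomorphicFrame n (fun _ => ⊤) (θ.filtration k) U (fun i : Fin k => s (Fin.castLE hk i)) where
  isOpen := hs.frame.isOpen
  holomorphic := fun _ => hs.frame.holomorphic _
  mem := fun _ _ _ => Submodule.mem_top
  linearIndependent := fun y hy => by
    rw [Fintype.linearIndependent_iff]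
    intro c hc
    refine hs.eq_zero_of_sum_mem hy hk ?_
    rw [← Submodule.Quotient.mk_eq_zero, ← Submodule.mkQ_apply, map_sum]
    simpa using hc
  span := fun y hy => (hs.span_sup_filtration hy hk).ge

/-- A constant triangular change of an adapted frame is adapted. -/
theorem triangular {T : Matrix (Fin n) (Fin n) ℂ} (hT : ∀ i j, j < i → T i j = 0)
    (hd : ∀ i, T i i ≠ 0) : θ.IsAdaptedFrame x₀ U (fun i y => ∑ j, T i j • s j y) := by
  have hdet : T.det ≠ 0 := by
    rw [Matrix.det_of_isUpperTriangular (fun i j hij => hT i j hij)]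
    exact Finset.prod_ne_zero_iff.2 fun i _ => hd i
  have hli : ∀ y ∈ U, LinearIndependent ℂ fun i => ∑ j, T i j • s j y := by
    intro y hy
    rw [Fintype.linearIndependent_iff]
    intro c hc
    have h1 : ∑ j, (Matrix.vecMul c T) j • s j y = 0 := by
      rw [← hc]
      simp only [Finset.smul_sum, Matrix.vecMul, dotProduct, Finset.sum_smul, smul_smul]
      exact Finset.sum_comm
    have h2 : Matrix.vecMul c T = 0 :=
      funext (Fintype.linearIndependent_iff.1 (hs.frame.linearIndependent_vectors hy) _ h1)
    exact congrFun (Matrix.eq_zero_of_vecMul_eq_zero hdet h2)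
  have hle : ∀ y ∈ U, ∀ k : ℕ,
      Submodule.span ℂ (range fun i : {i : Fin n // k ≤ i} => ∑ j, T i j • s j y) ≤
        θ.filtration k y := by
    intro y hy k
    rw [Submodule.span_le]
    rintro _ ⟨i, rfl⟩
    refine Submodule.sum_mem _ fun j _ => ?_
    rcases lt_or_ge j i.1 with hj | hj
    · rw [hT _ _ hj, zero_smul]
      exact Submodule.zero_mem _
    · exact Submodule.smul_mem _ _ (hs.mem_filtration hy (i.2.trans hj))
  refine ⟨hs.mem, isHolomorphicFrame_of_linearIndependent hs.frame.isOpen (fun i => ?_) hli,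
    fun y hy k => ?_⟩
  · exact ContMDiffOn.sum_section (s := Finset.univ) (t := fun j y => T i j • s j y)
      fun j _ => ContMDiffOn.const_smul_section (hs.frame.holomorphic j)
  · have := finiteDimensional_fiber n E y
    refine (Submodule.eq_of_le_of_finrank_le (hle y hy k) ?_).symm
    rw [hs.filtration_eq y hy]
    exact (finrank_span_eq_card ((hs.frame.linearIndependent_vectors hy).comp _
      Subtype.val_injective)).trans_le
        (finrank_span_eq_card ((hli y hy).comp _ Subtype.val_injective)).ge

end HiggsField.IsAdaptedFrame

end Induced

/-! ### Gram determinants, orthonormalization and the norm of γ_k -/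

section GramMinors

variable {X : Type*} [TopologicalSpace X] [ChartedSpace ℂ X]
  {n : ℕ} {E : X → Type*}
  [TopologicalSpace (TotalSpace (Fin n → ℂ) E)]
  [∀ x, TopologicalSpace (E x)] [∀ x, AddCommGroup (E x)] [∀ x, Module ℂ (E x)]
  [FiberBundle (Fin n → ℂ) E]

/-- The Gram determinant of the members of a frame from the `k`-th on. -/
def HermitianMetric.gramMinor (h : HermitianMetric n E) (s : Fin n → ∀ y, E y) (k : ℕ)
    (y : X) : ℝ :=
  (Matrix.of fun i j : {i : Fin n // k ≤ i} => h.form y (s i y) (s j y)).det.re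

theorem contDiff_det_re {ι : Type*} [Fintype ι] [DecidableEq ι] :
    ContDiff ℝ ∞ fun A : ι → ι → ℂ => (Matrix.of A).det.re := by
  simp only [Matrix.det_apply', Matrix.of_apply]
  refine Complex.reCLM.contDiff.comp (ContDiff.sum fun σ _ => contDiff_const.mul
    (contDiff_prod fun i _ => ?_))
  exact contDiff_apply_apply ℝ ℂ (σ i) i

theorem HermitianMetric.contMDiffAt_gramMinor (h : HermitianMetric n E) {s : Fin n → ∀ y, E y}
    {U : Set X} (hU : IsOpen U) (hs : ∀ i, IsHolomorphicOn n (s i) U) {y : X} (hy : y ∈ U) (k : ℕ) :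
    ContMDiffAt 𝓘(ℝ, ℂ) 𝓘(ℝ, ℝ) ∞ (h.gramMinor s k) y := by
  have h1 : ContMDiffAt 𝓘(ℝ, ℂ) 𝓘(ℝ, {i : Fin n // k ≤ i} → {i : Fin n // k ≤ i} → ℂ) ∞
      (fun w => fun i j : {i : Fin n // k ≤ i} => h.form w (s i w) (s j w)) y :=
    contMDiffAt_pi_space.2 fun i => contMDiffAt_pi_space.2 fun j =>
      (h.smooth U hU _ _ (hs i) (hs j) y hy).contMDiffAt (hU.mem_nhds hy)
  exact contDiff_det_re.contDiffAt.contMDiffAt.comp y h1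

theorem contMDiffAt_real_log {f : X → ℝ} {y : X} (hf : ContMDiffAt 𝓘(ℝ, ℂ) 𝓘(ℝ, ℝ) ∞ f y)
    (h0 : f y ≠ 0) : ContMDiffAt 𝓘(ℝ, ℂ) 𝓘(ℝ, ℝ) ∞ (fun w => Real.log (f w)) y :=
  (Real.contDiffAt_log.2 h0).contMDiffAt.comp y hf

variable [VectorBundle ℂ (Fin n → ℂ) E] [IsManifold 𝓘(ℂ, ℂ) ω X]
  [ContMDiffVectorBundle ω (Fin n → ℂ) E 𝓘(ℂ, ℂ)]

namespace HiggsField.IsAdaptedFrame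

variable {θ : HiggsField n E} {x₀ : X} {U : Set X} {s : Fin n → ∀ y, E y}
  (hs : θ.IsAdaptedFrame x₀ U s) (h : HermitianMetric n E)

include hs

theorem coeff_eq_zero_of_sum_mem {y : X} (hy : y ∈ U) {k : ℕ} {c : Fin n → ℂ}
    (hc : ∑ i, c i • s i y ∈ θ.filtration k y) {i : Fin n} (hi : (i : ℕ) < k) : c i = 0 := by
  rw [hs.filtration_eq y hy] at hc
  obtain ⟨b, hb⟩ := (Submodule.mem_span_range_iff_exists_fun ℂ).1 hc
  rw [sum_smul_subtype_eq_sum_dite (fun i : Fin n => k ≤ i) b (fun i => s i y)] at hb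
  have := Fintype.linearIndependent_iff.1 (hs.frame.linearIndependent_vectors hy)
    (fun j => c j - if h : k ≤ j then b ⟨j, h⟩ else 0) (by
      simp only [sub_smul, Finset.sum_sub_distrib, hb, sub_self]) i
  simpa [not_le.2 hi] using this

theorem gradedSq_pos {y : X} (hy : y ∈ U) (i : Fin n) :
    0 < h.gradedSq θ (i + 1) y (s i y) :=
  h.quotForm_self_pos (hs.notMem_filtration hy (Nat.lt_succ_self i))

/-- The isometry det G_k ≅ L_{k+1} ⊗ det G_{k+1}: projecting s_k off G_{k+1} splits the Gram matrix
into a 1 × 1 block and the next minor. -/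
theorem det_gram_succ {y : X} (hy : y ∈ U) (k : Fin n) :
    (Matrix.of fun i j : {i : Fin n // (k : ℕ) ≤ i} => h.form y (s i y) (s j y)).det =
      h.gradedSq θ (k + 1) y (s k y) *
        (Matrix.of fun i j : {i : Fin n // (k : ℕ) + 1 ≤ i} => h.form y (s i y) (s j y)).det := by
  have hq : ∀ i : Fin n, (k : ℕ) + 1 ≤ i → (k : ℕ) ≤ i := fun i hi => by omega
  have hrange : (range fun i : {i : {i : Fin n // (k : ℕ) ≤ i} // (k : ℕ) + 1 ≤ i.1} =>
      s i.1.1 y) = range fun i : {i : Fin n // (k : ℕ) + 1 ≤ i} => s i y := by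
    ext v
    constructor
    · rintro ⟨i, rfl⟩
      exact ⟨⟨i.1.1, i.2⟩, rfl⟩
    · rintro ⟨i, rfl⟩
      exact ⟨⟨⟨i.1, hq _ i.2⟩, i.2⟩, rfl⟩
  have hspan : Submodule.span ℂ (range fun i : {i : {i : Fin n // (k : ℕ) ≤ i} //
      (k : ℕ) + 1 ≤ i.1} => s i.1.1 y) = θ.filtration (k + 1) y := by
    rw [hrange, hs.filtration_eq y hy]
  rw [det_gram_eq_mul (h.form y) (fun i : {i : Fin n // (k : ℕ) ≤ i} => s i y)
    (fun i => (k : ℕ) + 1 ≤ i.1) (h.perp (θ.filtration (k + 1) y))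
    (fun u => hspan ▸ h.sub_perp_mem _ u) (fun u w hw => h.form_perp _ u (hspan ▸ hw))]
  congr 1
  · have : Subsingleton {i : {i : Fin n // (k : ℕ) ≤ i} // ¬(k : ℕ) + 1 ≤ i.1} :=
      ⟨fun a b => Subtype.ext (Subtype.ext (Fin.ext (by
        have := a.2; have := b.2; have := a.1.2; have := b.1.2; omega)))⟩
    rw [Matrix.det_eq_elem_of_subsingleton _ ⟨⟨k, le_rfl⟩, by simp⟩]
    refine Complex.ext ?_ ?_
    · rfl
    · exact h.quotForm_self_im _
  · rw [← Matrix.det_submatrix_equiv_self (Equiv.subtypeSubtypeEquivSubtype fun {i} => hq i)]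
    rfl

/-- Reality and positivity pass together from k + 1 to k through the factorization above, starting
from the empty determinant 1 at k = n. -/
theorem det_gram_eq_gramMinor_and_pos {y : X} (hy : y ∈ U) {k : ℕ} (hk : k ≤ n) :
    (Matrix.of fun i j : {i : Fin n // k ≤ i} => h.form y (s i y) (s j y)).det =
      h.gramMinor s k y ∧ 0 < h.gramMinor s k y := by
  induction hk using Nat.decreasingInduction with
  | self =>
    have : IsEmpty {i : Fin n // n ≤ i} := ⟨fun i => absurd i.1.2 (not_lt.2 i.2)⟩
    simp [HermitianMetric.gramMinor]
  | of_succ k hk ih =>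
    have h1 := hs.det_gram_succ h hy ⟨k, hk⟩
    simp only [ih.1] at h1
    have h2 : h.gramMinor s k y = h.gradedSq θ (k + 1) y (s ⟨k, hk⟩ y) * h.gramMinor s (k + 1) y := by
      rw [HermitianMetric.gramMinor, h1, ← Complex.ofReal_mul, Complex.ofReal_re]
    refine ⟨by rw [h1, h2]; push_cast; rfl, h2 ▸ mul_pos (hs.gradedSq_pos h hy ⟨k, hk⟩) ih.2⟩

theorem gramMinor_pos {y : X} (hy : y ∈ U) {k : ℕ} (hk : k ≤ n) : 0 < h.gramMinor s k y :=
  (hs.det_gram_eq_gramMinor_and_pos h hy hk).2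

theorem gramMinor_succ {y : X} (hy : y ∈ U) (k : Fin n) :
    h.gramMinor s k y = h.gradedSq θ (k + 1) y (s k y) * h.gramMinor s (k + 1) y := by
  rw [HermitianMetric.gramMinor, hs.det_gram_succ h hy,
    (hs.det_gram_eq_gramMinor_and_pos h hy (by omega : (k : ℕ) + 1 ≤ n)).1,
    ← Complex.ofReal_mul, Complex.ofReal_re]

/-- The isometry det E ≅ det(E/G_k) ⊗ det G_k. -/
theorem detQuotSq_mul_gramMinor {y : X} (hy : y ∈ U) {k : ℕ} (hk : k ≤ n) :
    h.detQuotSq (θ.filtration k y) (fun i : Fin k => s (Fin.castLE hk i) y) * h.gramMinor s k y =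
      h.gramMinor s 0 y := by
  have hspan := hs.filtration_eq y hy k
  have h1 := det_gram_eq_mul (h.form y) (fun i => s i y)
    (fun i => k ≤ i) (h.perp (θ.filtration k y))
    (fun u => hspan ▸ h.sub_perp_mem _ u) (fun u w hw => h.form_perp _ u (hspan ▸ hw))
  rw [(hs.det_gram_eq_gramMinor_and_pos h hy hk).1] at h1
  have h0 : h.gramMinor s 0 y = (Matrix.of fun i j => h.form y (s i y) (s j y)).det.re := by
    rw [HermitianMetric.gramMinor, ← Matrix.det_submatrix_equiv_self
      (Equiv.subtypeUnivEquiv (p := fun i : Fin n => 0 ≤ (i : ℕ)) fun i => Nat.zero_le _).symm]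
    rfl
  let ε : Fin k ≃ {i : Fin n // ¬k ≤ i} :=
    { toFun := fun i => ⟨Fin.castLE hk i, by simp⟩
      invFun := fun i => ⟨i.1, not_le.1 i.2⟩
      left_inv := fun i => rfl
      right_inv := fun i => rfl }
  rw [h0, h1, Complex.re_mul_ofReal, ← Matrix.det_submatrix_equiv_self ε]
  rfl

/-- An adapted frame can be made orthonormal at `x₀`. -/
theorem exists_orthonormal : ∃ s', θ.IsAdaptedFrame x₀ U s' ∧
    ∀ i j, h.form x₀ (s' i x₀) (s' j x₀) = if i = j then 1 else 0 := by
  set u : Fin n → E x₀ := fun i => h.perp (θ.filtration (i + 1) x₀) (s i x₀) with hu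
  have hpos : ∀ i, 0 < (h.form x₀ (u i) (u i)).re := fun i => hs.gradedSq_pos h hs.mem i
  have hex : ∀ i : Fin n, ∃ b : {j : Fin n // (i : ℕ) + 1 ≤ j} → ℂ,
      ∑ j, b j • s j x₀ = s i x₀ - u i := fun i => by
    rw [← Submodule.mem_span_range_iff_exists_fun ℂ, ← hs.filtration_eq x₀ hs.mem]
    exact h.sub_perp_mem _ _
  choose b hb using hex
  set r : Fin n → ℂ := fun i => ((Real.sqrt (h.form x₀ (u i) (u i)).re : ℝ) : ℂ) with hr
  have hr0 : ∀ i, r i ≠ 0 := fun i => by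
    simpa [hr] using (Real.sqrt_pos.2 (hpos i)).ne'
  -- Gram–Schmidt in the single fibre at x₀, each s_i being projected off the later vectors. The
  -- coefficients are constants, so the new frame is still holomorphic, and triangularity keeps it
  -- adapted.
  set T : Matrix (Fin n) (Fin n) ℂ := Matrix.of fun i j =>
    (r i)⁻¹ * ((if i = j then 1 else 0) - if hj : (i : ℕ) + 1 ≤ j then b i ⟨j, hj⟩ else 0) with hT
  have hTs : ∀ i, ∑ j, T i j • s j x₀ = (r i)⁻¹ • u i := by
    intro i
    have h1 := hb i
    rw [sum_smul_subtype_eq_sum_dite (fun j : Fin n => (i : ℕ) + 1 ≤ j) (b i)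
      (fun j => s j x₀)] at h1
    simp only [hT, Matrix.of_apply, mul_smul, ← Finset.smul_sum, sub_smul, Finset.sum_sub_distrib,
      h1, ite_smul, one_smul, zero_smul, Finset.sum_ite_eq, Finset.mem_univ, if_true,
      sub_sub_cancel]
  refine ⟨_, hs.triangular (T := T) (fun i j hij => ?_) (fun i => ?_), ?_⟩
  · have h1 : i ≠ j := hij.ne'
    have h2 : ¬(i : ℕ) + 1 ≤ j := by have := Fin.lt_def.1 hij; omega
    simp only [hT, Matrix.of_apply, if_neg h1, dif_neg h2, sub_zero, mul_zero]
  · simpa [hT] using hr0 i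
  · have horth : ∀ i j : Fin n, i < j → h.form x₀ (u j) (u i) = 0 := by
      intro i j hij
      refine h.form_perp _ _ ?_
      have h1 := hs.mem_filtration hs.mem (k := (i : ℕ) + 1) (i := j) (Fin.lt_def.1 hij)
      have h2 : s j x₀ - u j ∈ θ.filtration (i + 1) x₀ := by
        rw [← hb j]
        refine Submodule.sum_mem _ fun l _ => Submodule.smul_mem _ _ (hs.mem_filtration hs.mem ?_)
        have := l.2
        have := Fin.lt_def.1 hij
        omega
      have h3 := Submodule.sub_mem _ h1 h2
      rwa [sub_sub_cancel] at h3
    intro i j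
    simp only [hTs, map_smulₛₗ, LinearMap.smul_apply, smul_eq_mul, RingHom.id_apply]
    rcases lt_trichotomy i j with hij | rfl | hij
    · rw [← h.conj_symm, horth i j hij]
      simp [hij.ne]
    · have h1 : h.form x₀ (u i) (u i) = r i * r i := by
        rw [← Complex.ofReal_mul, Real.mul_self_sqrt (hpos i).le]
        exact Complex.ext rfl (h.form_self_im _)
      have h2 : (starRingEnd ℂ) (r i) = r i := Complex.conj_ofReal _
      have h3 := hr0 i
      rw [h1, map_inv₀, h2, if_pos rfl]
      field_simp
    · rw [horth j i hij]
      simp [hij.ne']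

theorem gradedSq_eq_one (horth : ∀ i j, h.form x₀ (s i x₀) (s j x₀) = if i = j then 1 else 0)
    (i : Fin n) : h.gradedSq θ (i + 1) x₀ (s i x₀) = 1 := by
  have h1 : ∀ k, h.gramMinor s k x₀ = 1 := by
    intro k
    have : (Matrix.of fun i j : {i : Fin n // k ≤ i} => h.form x₀ (s i x₀) (s j x₀)) = 1 := by
      ext i j
      simp [horth, Matrix.one_apply, Subtype.ext_iff]
    rw [HermitianMetric.gramMinor, this, Matrix.det_one, Complex.one_re]
  have := hs.gramMinor_succ h hs.mem i
  rw [h1, h1, mul_one] at this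
  exact this.symm

theorem exists_localEnd_eq {a b : Fin n} (hab : (a : ℕ) + 1 = b) :
    ∃ τ : ℂ, ∃ w ∈ θ.filtration (b + 1) x₀,
      θ.localEnd x₀ x₀ (s a x₀) = τ • s b x₀ + w := by
  have h1 := θ.field_mem_filtration a.2 (hs.mem_filtration hs.mem (le_refl (a : ℕ)))
    (coordVec (chartAt ℂ x₀) x₀)
  rw [hab] at h1
  exact hs.exists_eq_smul_add hs.mem rfl h1

/-- The norm of `γ_k` in an adapted frame. -/
theorem gammaNormSq_eq (g : ConformalMetric X) {N : ℕ → ∀ x, E x → ℝ} {k : ℕ} {a b : Fin n}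
    (ha : (a : ℕ) + 1 = k) (hb : (b : ℕ) = k)
    (hN : ∀ v ∈ θ.filtration (k - 1) x₀, ∀ w ∈ θ.filtration k x₀, ∀ c : ℂ,
      N k x₀ (c • v + w) = ‖c‖ ^ 2 * N k x₀ v)
    (hN' : ∀ v ∈ θ.filtration k x₀, ∀ w ∈ θ.filtration (k + 1) x₀, ∀ c : ℂ,
      N (k + 1) x₀ (c • v + w) = ‖c‖ ^ 2 * N (k + 1) x₀ v)
    {τ : ℂ} {w : E x₀} (hw : w ∈ θ.filtration (k + 1) x₀)
    (hτ : θ.localEnd x₀ x₀ (s a x₀) = τ • s b x₀ + w) :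
    θ.gammaNormSq g N k x₀ = 2 * (‖τ‖ ^ 2 * N (k + 1) x₀ (s b x₀)) /
      (g.density (chartAt ℂ x₀) x₀ * N k x₀ (s a x₀)) := by
  have ha' : (a : ℕ) = k - 1 := by omega
  have hbn : k < n := hb ▸ b.2
  have hsa := hs.mem_filtration hs.mem ha'.ge
  have hsb := hs.mem_filtration hs.mem hb.ge
  -- Rescaling v or t multiplies numerator and denominator alike, and changes of v inside G_k only
  -- affect the image modulo G_{k+1}. The set is a singleton, so the supremum is a genuine value.
  have hset : {c | ∃ v ∈ θ.filtration (k - 1) x₀, v ∉ θ.filtration k x₀ ∧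
      ∃ t : TangentSpace 𝓘(ℂ, ℂ) x₀, t ≠ 0 ∧
        c = 2 * N (k + 1) x₀ (θ.field x₀ t v) / (g.sq x₀ t * N k x₀ v)} =
      {2 * (‖τ‖ ^ 2 * N (k + 1) x₀ (s b x₀)) /
        (g.density (chartAt ℂ x₀) x₀ * N k x₀ (s a x₀))} := by
    refine Set.eq_singleton_iff_unique_mem.2 ⟨?_, ?_⟩
    · refine ⟨s a x₀, hsa, hs.notMem_filtration hs.mem (by omega), coordVec (chartAt ℂ x₀) x₀,
        coordVec_ne_zero (mem_chart_source ℂ x₀), ?_⟩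
      have h1 : θ.field x₀ (coordVec (chartAt ℂ x₀) x₀) (s a x₀) = τ • s b x₀ + w := hτ
      rw [h1, hN' _ hsb _ hw]
      rfl
    · rintro c ⟨v, hv, hv', t, ht, rfl⟩
      obtain ⟨c, w', hw', rfl⟩ := hs.exists_eq_smul_add hs.mem ha' hv
      rw [show k - 1 + 1 = k by omega] at hw'
      obtain ⟨d, rfl⟩ := exists_smul_coordVec (mem_chart_source ℂ x₀) t
      have hc : c ≠ 0 := by
        rintro rfl
        exact hv' (by simpa using hw')
      have hd : d ≠ 0 := by
        rintro rfl
        exact ht (zero_smul ℂ _)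
      have h1 : θ.field x₀ (d • coordVec (chartAt ℂ x₀) x₀) (c • s a x₀ + w') =
          (d * c * τ) • s b x₀ + ((d * c) • w + d • θ.localEnd x₀ x₀ w') := by
        rw [map_smul, LinearMap.smul_apply, map_add, map_smul]
        change d • (c • θ.localEnd x₀ x₀ (s a x₀) + θ.localEnd x₀ x₀ w') = _
        rw [hτ]
        module
      have h2 : (d * c) • w + d • θ.localEnd x₀ x₀ w' ∈ θ.filtration (k + 1) x₀ :=
        Submodule.add_mem _ (Submodule.smul_mem _ _ hw)
          (Submodule.smul_mem _ _ (θ.field_mem_filtration hbn hw' _))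
      rw [h1, hN' _ hsb _ h2, g.sq_smul, hN _ hsa _ hw']
      have h3 : ‖c‖ ≠ 0 := norm_ne_zero_iff.2 hc
      have h4 : ‖d‖ ≠ 0 := norm_ne_zero_iff.2 hd
      change 2 * (‖d * c * τ‖ ^ 2 * N (k + 1) x₀ (s b x₀)) /
        (‖d‖ ^ 2 * g.density (chartAt ℂ x₀) x₀ * (‖c‖ ^ 2 * N k x₀ (s a x₀))) = _
      rw [norm_mul, norm_mul]
      rw [show 2 * ((‖d‖ * ‖c‖ * ‖τ‖) ^ 2 * N (k + 1) x₀ (s b x₀)) =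
        (‖d‖ ^ 2 * ‖c‖ ^ 2) * (2 * (‖τ‖ ^ 2 * N (k + 1) x₀ (s b x₀))) by ring,
        show ‖d‖ ^ 2 * g.density (chartAt ℂ x₀) x₀ * (‖c‖ ^ 2 * N k x₀ (s a x₀)) =
        (‖d‖ ^ 2 * ‖c‖ ^ 2) * (g.density (chartAt ℂ x₀) x₀ * N k x₀ (s a x₀)) by ring]
      exact mul_div_mul_left _ _ (by positivity)
  rw [gammaNormSq, hset, csSup_singleton]

end HiggsField.IsAdaptedFrame

end GramMinors

/-! ### Curvature computations -/

section Ddbar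

variable {X : Type*} [TopologicalSpace X] [ChartedSpace ℂ X] {x₀ : X} {f f' : X → ℝ}

theorem ddbar_congr (h : f =ᶠ[𝓝 x₀] f') :
    ddbar (chartAt ℂ x₀) f x₀ = ddbar (chartAt ℂ x₀) f' x₀ := by
  have h1 : (fun z => ((f ((chartAt ℂ x₀).symm z) : ℝ) : ℂ)) =ᶠ[𝓝 (chartAt ℂ x₀ x₀)]
      fun z => ((f' ((chartAt ℂ x₀).symm z) : ℝ) : ℂ) := by
    filter_upwards [(tendsto_chart_symm x₀).eventually h] with z hz
    rw [hz]
  have h2 : wirtingerBar (fun z => ((f ((chartAt ℂ x₀).symm z) : ℝ) : ℂ)) =ᶠ[𝓝 (chartAt ℂ x₀ x₀)]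
      wirtingerBar fun z => ((f' ((chartAt ℂ x₀).symm z) : ℝ) : ℂ) :=
    h1.eventually_nhds.mono fun z hz => complexDirDeriv.congr hz
  rw [ddbar, ddbar, wirtinger_eq, wirtinger_eq, complexDirDeriv.congr h2]

theorem contDiffAt_ofReal_comp {F : ℂ → ℝ} {z : ℂ} (hF : ContDiffAt ℝ 2 F z) :
    ContDiffAt ℝ 2 (fun z => ((F z : ℝ) : ℂ)) z :=
  Complex.ofRealCLM.contDiff.contDiffAt.comp z hF

theorem ddbar_sub
    (hf : ContDiffAt ℝ 2 (fun z => f ((chartAt ℂ x₀).symm z)) (chartAt ℂ x₀ x₀))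
    (hf' : ContDiffAt ℝ 2 (fun z => f' ((chartAt ℂ x₀).symm z)) (chartAt ℂ x₀ x₀)) :
    ddbar (chartAt ℂ x₀) (fun y => f y - f' y) x₀ =
      ddbar (chartAt ℂ x₀) f x₀ - ddbar (chartAt ℂ x₀) f' x₀ := by
  have hc := contDiffAt_ofReal_comp hf
  have hc' := contDiffAt_ofReal_comp hf'
  have h2 : wirtingerBar (fun z => ((f ((chartAt ℂ x₀).symm z) - f' ((chartAt ℂ x₀).symm z) : ℝ) : ℂ))
      =ᶠ[𝓝 (chartAt ℂ x₀ x₀)] fun z =>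
        wirtingerBar (fun z => ((f ((chartAt ℂ x₀).symm z) : ℝ) : ℂ)) z -
        wirtingerBar (fun z => ((f' ((chartAt ℂ x₀).symm z) : ℝ) : ℂ)) z := by
    filter_upwards [hc.eventually (by simp), hc'.eventually (by simp)] with z h1 h1'
    push_cast
    exact complexDirDeriv.sub (h1.differentiableAt (by norm_num)) (h1'.differentiableAt (by norm_num))
  have h3 := complexDirDeriv.sub (c := -Complex.I)
    (f := wirtingerBar fun z => ((f ((chartAt ℂ x₀).symm z) : ℝ) : ℂ))
    (g := wirtingerBar fun z => ((f' ((chartAt ℂ x₀).symm z) : ℝ) : ℂ))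
    (complexDirDeriv.differentiableAt hc) (complexDirDeriv.differentiableAt hc')
  rw [ddbar, wirtinger_eq, complexDirDeriv.congr h2, h3, Complex.sub_re, ← wirtinger_eq,
    ← wirtinger_eq]
  rfl

theorem ddbar_add
    (hf : ContDiffAt ℝ 2 (fun z => f ((chartAt ℂ x₀).symm z)) (chartAt ℂ x₀ x₀))
    (hf' : ContDiffAt ℝ 2 (fun z => f' ((chartAt ℂ x₀).symm z)) (chartAt ℂ x₀ x₀)) :
    ddbar (chartAt ℂ x₀) (fun y => f y + f' y) x₀ =
      ddbar (chartAt ℂ x₀) f x₀ + ddbar (chartAt ℂ x₀) f' x₀ := by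
  have h := ddbar_sub (f := fun y => f y + f' y) (f' := f') (hf.add hf') hf'
  simp only [add_sub_cancel_right] at h
  linarith

theorem ddbar_const (c : ℝ) : ddbar (chartAt ℂ x₀) (fun _ => c) x₀ = 0 := by
  have h : (wirtingerBar fun _ => (c : ℂ)) = fun _ => 0 := funext fun z => complexDirDeriv.const _
  rw [ddbar, h, wirtinger_eq, complexDirDeriv.const, Complex.zero_re]

theorem contDiffAt_two_of_contMDiffAt (hf : ContMDiffAt 𝓘(ℝ, ℂ) 𝓘(ℝ, ℝ) ∞ f x₀) :
    ContDiffAt ℝ 2 (fun z => f ((chartAt ℂ x₀).symm z)) (chartAt ℂ x₀ x₀) :=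
  (contDiffAt_comp_chart_symm hf).of_le ENat.LEInfty.out

/-- A holomorphic change of frame multiplies squared norms by |a|², which curvature does not see.
The regularity clause lets this term be split off by additivity of `ddbar`. -/
theorem ddbar_log_normSq {a : ℂ → ℂ} (ha : AnalyticAt ℂ a (chartAt ℂ x₀ x₀))
    (h0 : a (chartAt ℂ x₀ x₀) ≠ 0) :
    ContDiffAt ℝ 2 (fun z => Real.log (Complex.normSq
      (a (chartAt ℂ x₀ ((chartAt ℂ x₀).symm z))))) (chartAt ℂ x₀ x₀) ∧
    ddbar (chartAt ℂ x₀) (fun y => Real.log (Complex.normSq (a (chartAt ℂ x₀ y)))) x₀ = 0 := by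
  have hev := eventually_chart_right_inv x₀
  constructor
  · have h1 : ContDiffAt ℝ 2 (fun z => Real.log (Complex.normSq (a z))) (chartAt ℂ x₀ x₀) := by
      refine ContDiffAt.log ?_ (by simpa using h0)
      have h2 : ContDiffAt ℝ 2 a (chartAt ℂ x₀ x₀) := ha.contDiffAt.restrict_scalars ℝ
      have h3 : ContDiffAt ℝ 2 (fun z => (a z).re * (a z).re + (a z).im * (a z).im)
          (chartAt ℂ x₀ x₀) := by
        have hre := Complex.reCLM.contDiff.contDiffAt.comp (chartAt ℂ x₀ x₀) h2
        have him := Complex.imCLM.contDiff.contDiffAt.comp (chartAt ℂ x₀ x₀) h2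
        exact (hre.mul hre).add (him.mul him)
      exact h3
    refine h1.congr_of_eventuallyEq ?_
    filter_upwards [hev] with z hz
    rw [hz]
  · have h1 := wirtinger_wirtingerBar_log_normSq ha h0
    have h2 : (fun z => ((Real.log (Complex.normSq
        (a (chartAt ℂ x₀ ((chartAt ℂ x₀).symm z)))) : ℝ) : ℂ)) =ᶠ[𝓝 (chartAt ℂ x₀ x₀)]
        fun z => ((Real.log (Complex.normSq (a z)) : ℝ) : ℂ) := by
      filter_upwards [hev] with z hz
      rw [hz]
    have h3 : wirtingerBar (fun z => ((Real.log (Complex.normSq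
        (a (chartAt ℂ x₀ ((chartAt ℂ x₀).symm z)))) : ℝ) : ℂ)) =ᶠ[𝓝 (chartAt ℂ x₀ x₀)]
        wirtingerBar fun z => ((Real.log (Complex.normSq (a z)) : ℝ) : ℂ) :=
      h2.eventually_nhds.mono fun z hz => complexDirDeriv.congr hz
    rw [ddbar, wirtinger_eq, complexDirDeriv.congr h3, ← wirtinger_eq, h1, Complex.zero_re]

end Ddbar

/-! ### Curvature of det(E/G_k) -/

section Curvature

variable {X : Type*} [TopologicalSpace X] [ChartedSpace ℂ X]
  {n : ℕ} {E : X → Type*}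
  [TopologicalSpace (TotalSpace (Fin n → ℂ) E)]
  [∀ x, TopologicalSpace (E x)] [∀ x, AddCommGroup (E x)] [∀ x, Module ℂ (E x)]
  [FiberBundle (Fin n → ℂ) E] [VectorBundle ℂ (Fin n → ℂ) E]

theorem HermitianMetric.detQuotSq_linear_change (h : HermitianMetric n E) {x : X}
    {W : Submodule ℂ (E x)} {k : ℕ} {v v' : Fin k → E x} {a : Matrix (Fin k) (Fin k) ℂ}
    (ha : ∀ i, v' i - ∑ j, a i j • v j ∈ W) :
    h.detQuotSq W v' = Complex.normSq a.det * h.detQuotSq W v := by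
  have h1 : ∀ i, h.perp W (v' i) = ∑ j, a i j • h.perp W (v j) := by
    intro i
    have := h.perp_eq_zero (ha i)
    rw [map_sub, sub_eq_zero, map_sum] at this
    simpa using this
  have h2 : (Matrix.of fun i j => h.quotForm W (v' i) (v' j)) =
      a.map (starRingEnd ℂ) * (Matrix.of fun i j => h.quotForm W (v i) (v j)) * a.transpose := by
    ext i j
    simp only [HermitianMetric.quotForm, h1, Matrix.of_apply, Matrix.mul_apply, Matrix.map_apply,
      Matrix.transpose_apply, map_sum, LinearMap.sum_apply, map_smulₛₗ, LinearMap.smul_apply,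
      smul_eq_mul, Finset.sum_mul, Finset.mul_sum, RingHom.id_apply]
    exact Finset.sum_congr rfl fun k _ => Finset.sum_congr rfl fun l _ => by ring
  have h3 : (a.map (starRingEnd ℂ)).det = (starRingEnd ℂ) a.det :=
    (RingHom.map_det (starRingEnd ℂ) a).symm
  rw [HermitianMetric.detQuotSq, h2, Matrix.det_mul, Matrix.det_mul, Matrix.det_transpose, h3,
    mul_right_comm, ← Complex.normSq_eq_conj_mul_self, Complex.re_ofReal_mul]
  rfl

variable [IsManifold 𝓘(ℂ, ℂ) ω X] [ContMDiffVectorBundle ω (Fin n → ℂ) E 𝓘(ℂ, ℂ)]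

namespace HiggsField.IsAdaptedFrame

variable {θ : HiggsField n E} {x₀ : X} {U : Set X} {s : Fin n → ∀ y, E y}
  (hs : θ.IsAdaptedFrame x₀ U s) (h : HermitianMetric n E)

include hs

theorem eventually_mem : ∀ᶠ y in 𝓝 x₀, y ∈ U := hs.frame.isOpen.mem_nhds hs.mem

theorem contMDiffAt_log_gramMinor {k : ℕ} (hk : k ≤ n) :
    ContMDiffAt 𝓘(ℝ, ℂ) 𝓘(ℝ, ℝ) ∞ (fun y => Real.log (h.gramMinor s k y)) x₀ :=
  contMDiffAt_real_log (h.contMDiffAt_gramMinor hs.frame.isOpen hs.frame.holomorphic hs.mem k)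
    (hs.gramMinor_pos h hs.mem hk).ne'

/-- The curvature of `det (E / G_k)` in terms of Gram determinants of an adapted frame. -/
theorem detQuotCurvature_eq_gramMinor (g : ConformalMetric X) {k : ℕ} (hk : k ≤ n) {V : Set X}
    {σ : Fin k → ∀ y, E y} (hxV : x₀ ∈ V)
    (hσ : IsHolomorphicFrame n (fun _ => ⊤) (θ.filtration k) V σ) :
    h.detQuotCurvature θ g σ x₀ = 2 / g.density (chartAt ℂ x₀) x₀ *
      (ddbar (chartAt ℂ x₀) (fun y => Real.log (h.gramMinor s k y)) x₀ -
        ddbar (chartAt ℂ x₀) (fun y => Real.log (h.gramMinor s 0 y)) x₀) := by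
  choose a ha ha' using fun i => hs.frame.exists_coeff hs.mem (hσ.holomorphic i) hσ.isOpen hxV
  -- Modulo G_k, A expresses the given frame σ through the first k members of s; independence of the
  -- classes of σ makes det A non-zero at x₀.
  set A : ℂ → Matrix (Fin k) (Fin k) ℂ := fun z => Matrix.of fun i j => a i (Fin.castLE hk j) z
    with hA
  have hmod : ∀ᶠ y in 𝓝 x₀, ∀ i, σ i y - ∑ j, A (chartAt ℂ x₀ y) i j • s (Fin.castLE hk j) y ∈
      θ.filtration k y := by
    filter_upwards [eventually_all.2 ha', hs.eventually_mem] with y h1 hy i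
    have h2 : ∑ j, A (chartAt ℂ x₀ y) i j • s (Fin.castLE hk j) y =
        ∑ j : Fin n, if k ≤ j then 0 else a i j (chartAt ℂ x₀ y) • s j y := by
      have e1 : ∑ j, A (chartAt ℂ x₀ y) i j • s (Fin.castLE hk j) y =
          ∑ j ∈ Finset.univ.map (Fin.castLEEmb hk), a i j (chartAt ℂ x₀ y) • s j y := by
        rw [Finset.sum_map]
        rfl
      rw [e1]
      have e2 : Finset.univ.map (Fin.castLEEmb hk) =
          Finset.univ.filter fun j : Fin n => ¬k ≤ j := by
        ext j
        simp only [Finset.mem_map, Finset.mem_univ, true_and, Finset.mem_filter, not_le]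
        constructor
        · rintro ⟨i, rfl⟩
          exact i.2
        · intro hj
          exact ⟨⟨j, hj⟩, rfl⟩
      rw [e2, Finset.sum_filter]
      exact Finset.sum_congr rfl fun j _ => by by_cases hj : k ≤ j <;> simp [hj]
    rw [h1 i, h2, ← Finset.sum_sub_distrib]
    refine Submodule.sum_mem _ fun j _ => ?_
    by_cases hj : k ≤ j
    · simpa [hj] using Submodule.smul_mem _ _ (hs.mem_filtration hy hj)
    · simp [hj]
  have hdet : AnalyticAt ℂ (fun z => (A z).det) (chartAt ℂ x₀ x₀) :=
    analyticAt_det fun i j => ha i _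
  have hdet0 : (A (chartAt ℂ x₀ x₀)).det ≠ 0 := by
    intro h0
    obtain ⟨c, hc, hcA⟩ := Matrix.exists_vecMul_eq_zero_iff.2 h0
    refine hc (funext (Fintype.linearIndependent_iff.1 (hσ.linearIndependent x₀ hxV) c ?_))
    have h1 : ∑ i, c i • (σ i x₀ - ∑ j, A (chartAt ℂ x₀ x₀) i j • s (Fin.castLE hk j) x₀) ∈
        θ.filtration k x₀ :=
      Submodule.sum_mem _ fun i _ => Submodule.smul_mem _ _ (hmod.self_of_nhds i)
    have h2 : ∑ i, c i • ∑ j, A (chartAt ℂ x₀ x₀) i j • s (Fin.castLE hk j) x₀ = 0 := by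
      simp only [Finset.smul_sum, smul_smul]
      rw [Finset.sum_comm]
      simp only [← Finset.sum_smul]
      refine Finset.sum_eq_zero fun j _ => ?_
      have := congrFun hcA j
      simp only [Matrix.vecMul, dotProduct, Pi.zero_apply] at this
      rw [this, zero_smul]
    simp only [smul_sub, Finset.sum_sub_distrib, h2, sub_zero] at h1
    rw [← Submodule.Quotient.mk_eq_zero, ← Submodule.mkQ_apply, map_sum] at h1
    simpa using h1
  have hlog : (fun y => Real.log (h.detQuotSq (θ.filtration k y) fun i => σ i y)) =ᶠ[𝓝 x₀]
      fun y => Real.log (Complex.normSq ((A (chartAt ℂ x₀ y)).det)) +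
        (Real.log (h.gramMinor s 0 y) - Real.log (h.gramMinor s k y)) := by
    filter_upwards [hmod, hs.eventually_mem,
      (tendsto_chart x₀).eventually (hdet.continuousAt.eventually_ne hdet0)] with y h1 hy h2
    have hp := hs.gramMinor_pos h hy hk
    have hp0 := hs.gramMinor_pos h hy (Nat.zero_le n)
    have h3 := hs.detQuotSq_mul_gramMinor h hy hk
    rw [h.detQuotSq_linear_change h1, ← Real.log_div hp0.ne' hp.ne',
      ← eq_div_of_mul_eq hp.ne' h3, Real.log_mul (by simpa using h2)]
    rw [eq_div_of_mul_eq hp.ne' h3]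
    exact (div_pos hp0 hp).ne'
  have hc := fun k hk => contDiffAt_two_of_contMDiffAt (hs.contMDiffAt_log_gramMinor h (k := k) hk)
  obtain ⟨hn1, hn2⟩ := ddbar_log_normSq hdet hdet0
  rw [HermitianMetric.detQuotCurvature, ConformalMetric.contractedCurvature, ddbar_congr hlog,
    ddbar_add hn1 ((hc 0 (Nat.zero_le n)).sub (hc k hk)), hn2, ddbar_sub (hc 0 (Nat.zero_le n)) (hc k hk)]
  ring

/-- For a harmonic metric, the curvature of `det (E / G_k)` in an adapted frame that is
orthonormal at `x₀`. -/
theorem detQuotCurvature_eq_of_isHarmonic (g : ConformalMetric X) (hh : h.IsHarmonic θ)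
    (horth : ∀ i j, h.form x₀ (s i x₀) (s j x₀) = if i = j then 1 else 0)
    {Θ : Matrix (Fin n) (Fin n) ℂ}
    (hΘ : ∀ j, θ.localEnd x₀ x₀ (s j x₀) = ∑ i, Θ i j • s i x₀)
    {k : ℕ} (hk : k ≤ n) {V : Set X} {σ : Fin k → ∀ y, E y} (hxV : x₀ ∈ V)
    (hσ : IsHolomorphicFrame n (fun _ => ⊤) (θ.filtration k) V σ) :
    h.detQuotCurvature θ g σ x₀ = 2 / g.density (chartAt ℂ x₀) x₀ *
      ∑ i : Fin n, ∑ j : Fin n, if k ≤ i ∧ ¬k ≤ j then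
        Complex.normSq (wirtinger (fun ζ => h.gram (chartAt ℂ x₀) s ζ j i) (chartAt ℂ x₀ x₀)) +
          Complex.normSq (Θ i j) else 0 := by
  have hx := (chartAt ℂ x₀).left_inv (mem_chart_source ℂ x₀)
  have hit := hh _ (IsManifold.chart_mem_maximalAtlas x₀) U s hs.frame x₀
    ⟨hs.mem, mem_chart_source ℂ x₀⟩ Θ hΘ
  have hH : ∀ i j, ContDiffAt ℝ 2 (fun ζ => h.gram (chartAt ℂ x₀) s ζ i j) (chartAt ℂ x₀ x₀) := by
    intro i j
    have h1 : ContMDiffAt 𝓘(ℝ, ℂ) 𝓘(ℝ, ℂ) ∞ (fun w => h.form w (s i w) (s j w)) x₀ :=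
      (h.smooth U hs.frame.isOpen _ _ (hs.frame.holomorphic i) (hs.frame.holomorphic j) x₀
        hs.mem).contMDiffAt (hs.frame.isOpen.mem_nhds hs.mem)
    exact (contDiffAt_comp_chart_symm h1).of_le ENat.LEInfty.out
  have h1 : h.gram (chartAt ℂ x₀) s (chartAt ℂ x₀ x₀) = 1 := by
    ext i j
    have := horth i j
    simp only [HermitianMetric.gram, Matrix.of_apply, Matrix.one_apply]
    rw [← this]
    exact congrArg (fun y => h.form y (s i y) (s j y)) hx
  -- θ maps G_j into G_{j+1}, so Θ is strictly lower triangular.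
  have hΘ0 : ∀ i j : Fin n, i ≤ j → Θ i j = 0 := by
    intro i j hij
    have h2 := θ.field_mem_filtration j.2 (hs.mem_filtration hs.mem (le_refl (j : ℕ)))
      (coordVec (chartAt ℂ x₀) x₀)
    change θ.localEnd x₀ x₀ (s j x₀) ∈ _ at h2
    rw [hΘ] at h2
    exact hs.coeff_eq_zero_of_sum_mem hs.mem h2 (Nat.lt_succ_of_le (Fin.le_def.1 hij))
  have hdd : ∀ l, l ≤ n → ddbar (chartAt ℂ x₀) (fun y => Real.log (h.gramMinor s l y)) x₀ =
      ∑ i : Fin n, ∑ j : Fin n, if l ≤ i ∧ ¬l ≤ j then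
        Complex.normSq (wirtinger (fun ζ => h.gram (chartAt ℂ x₀) s ζ j i) (chartAt ℂ x₀ x₀)) +
          Complex.normSq (Θ i j) else 0 := by
    intro l hl
    have h2 := re_wirtinger_wirtingerBar_log_det_of_hitchin hH h1
      (fun i j => Eventually.of_forall fun ζ => (h.conj_symm _ _ _).symm) hit
      (fun i : Fin n => l ≤ i) (d := fun ζ => h.gramMinor s l ((chartAt ℂ x₀).symm ζ)) (by
        filter_upwards [(tendsto_chart_symm x₀).eventually hs.eventually_mem] with ζ hζ
        exact (hs.det_gram_eq_gramMinor_and_pos h hζ hl).1)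
    rw [ddbar, h2]
    -- Inside the block the terms |Θ_ij|² − |Θ_ji|² are antisymmetric and sum to zero, as the trace
    -- of a commutator must.
    have h3 : ∑ i : Fin n, ∑ j : Fin n, (if l ≤ i ∧ l ≤ j then
        Complex.normSq (Θ i j) - Complex.normSq (Θ j i) else 0) = 0 := by
      have h4 : ∀ i j : Fin n, (if l ≤ (i : ℕ) ∧ l ≤ (j : ℕ) then
          Complex.normSq (Θ i j) - Complex.normSq (Θ j i) else 0) =
          (if l ≤ (i : ℕ) ∧ l ≤ (j : ℕ) then Complex.normSq (Θ i j) else 0) -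
          (if l ≤ (j : ℕ) ∧ l ≤ (i : ℕ) then Complex.normSq (Θ j i) else 0) := by
        intro i j
        by_cases hi : l ≤ (i : ℕ) <;> by_cases hj : l ≤ (j : ℕ) <;> simp [hi, hj]
      simp only [h4, Finset.sum_sub_distrib]
      rw [sub_eq_zero, Finset.sum_comm]
    rw [← sub_eq_zero, ← Finset.sum_sub_distrib]
    refine Eq.trans ?_ h3
    refine Finset.sum_congr rfl fun i _ => ?_
    by_cases hi : l ≤ (i : ℕ)
    · simp only [hi, if_true, true_and]
      rw [← Finset.sum_sub_distrib]
      refine Finset.sum_congr rfl fun j _ => ?_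
      by_cases hj : l ≤ (j : ℕ)
      · simp only [hj, not_true, if_true, if_false]
        ring
      -- Here j < l ≤ i: this is the entry that would lead out of the invariant subbundle G_l, and
      -- it carries the only negative sign left.
      · have h5 : Θ j i = 0 := hΘ0 j i (Fin.le_def.2 (by omega))
        simp [hj, h5]
    · simp [hi]
  -- For l = 0 no index j lies outside the block, so the contribution of det E disappears.
  rw [hs.detQuotCurvature_eq_gramMinor h g hk hxV hσ, hdd k hk, hdd 0 (Nat.zero_le n)]
  simp

end HiggsField.IsAdaptedFrame

end Curvature

/-! ### Background metrics -/

section Background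

variable {X : Type*} [TopologicalSpace X] [ChartedSpace ℂ X]
  {n : ℕ} {E : X → Type*}
  [TopologicalSpace (TotalSpace (Fin n → ℂ) E)]
  [∀ x, TopologicalSpace (E x)] [∀ x, AddCommGroup (E x)] [∀ x, Module ℂ (E x)]
  [FiberBundle (Fin n → ℂ) E] [VectorBundle ℂ (Fin n → ℂ) E]

theorem potential_zero (w : ℕ → X → ℝ) (x : X) : potential w 0 x = 0 := by
  simp [potential]

theorem potential_succ (w : ℕ → X → ℝ) (k : ℕ) (x : X) :
    potential w (k + 1) x = potential w k x - w (k + 1) x := by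
  simp only [potential, Finset.sum_Icc_succ_top (Nat.le_add_left 1 k)]
  ring

theorem potential_eq_neg_sum_fin (w : ℕ → X → ℝ) (k : ℕ) (x : X) :
    potential w k x = -∑ i : Fin k, w (i + 1) x := by
  induction k with
  | zero => simp [potential]
  | succ k ih => rw [potential_succ, ih, Fin.sum_univ_castSucc]; simp; ring

variable [IsManifold 𝓘(ℂ, ℂ) ω X] [ContMDiffVectorBundle ω (Fin n → ℂ) E 𝓘(ℂ, ℂ)]
  {θ : HiggsField n E} {g : ConformalMetric X}

theorem BackgroundMetric.IsConformalFactor.gradedSq_eq {ht : BackgroundMetric θ g}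
    {h : HermitianMetric n E} {w : ℕ → X → ℝ} (hw : ht.IsConformalFactor h w) (k : Fin n) (x : X)
    {v : E x} (hv : v ∈ θ.filtration k x) :
    h.gradedSq θ (k + 1) x v = Real.exp (w (k + 1) x) * ht.sq (k + 1) x v :=
  hw (k + 1) (Finset.mem_Icc.2 ⟨by omega, k.2⟩) x v hv

namespace HiggsField.IsAdaptedFrame

variable {x₀ : X} {U : Set X} {s : Fin n → ∀ y, E y}
  (hs : θ.IsAdaptedFrame x₀ U s) {h : HermitianMetric n E} {ht : BackgroundMetric θ g}
  {w : ℕ → X → ℝ} (hw : ht.IsConformalFactor h w)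

include hs

theorem background_sq_pos (ht : BackgroundMetric θ g) {y : X} (hy : y ∈ U) (k : Fin n) :
    0 < ht.sq (k + 1) y (s k y) :=
  ht.sq_pos (k + 1) (Finset.mem_Icc.2 ⟨by omega, k.2⟩) y _ (hs.mem_filtration hy le_rfl)
    (hs.notMem_filtration hy (Nat.lt_succ_self k))

theorem contMDiffAt_log_background_sq (ht : BackgroundMetric θ g) (k : Fin n) :
    ContMDiffAt 𝓘(ℝ, ℂ) 𝓘(ℝ, ℝ) ∞ (fun y => Real.log (ht.sq (k + 1) y (s k y))) x₀ :=
  contMDiffAt_real_log ((ht.smooth (k + 1) (Finset.mem_Icc.2 ⟨by omega, k.2⟩) U _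
    (hs.gradedFrame k) x₀ hs.mem).contMDiffAt (hs.frame.isOpen.mem_nhds hs.mem))
    (hs.background_sq_pos ht hs.mem k).ne'

include hw

/-- Since |[s_k]|² = D_k / D_{k+1} in L_{k+1}, the factor w_{k+1} is a difference of logarithms of
smooth functions. Smoothness and derivatives of u are read off from this recursion; w itself is
given only pointwise. -/
theorem eventually_potential_succ (k : Fin n) : potential w (k + 1) =ᶠ[𝓝 x₀] fun y =>
    potential w k y - ((Real.log (h.gramMinor s k y) - Real.log (h.gramMinor s (k + 1) y)) -
      Real.log (ht.sq (k + 1) y (s k y))) := by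
  filter_upwards [hs.eventually_mem] with y hy
  have h1 := hw.gradedSq_eq k y (hs.mem_filtration hy le_rfl)
  have h2 := hs.gramMinor_succ h hy k
  have h3 := hs.gramMinor_pos h hy (show (k : ℕ) + 1 ≤ n from k.2)
  have h4 := hs.background_sq_pos ht hy k
  rw [potential_succ, h2, h1, Real.log_mul (by positivity) h3.ne',
    Real.log_mul (by positivity) h4.ne', Real.log_exp]
  ring

theorem contMDiffAt_potential {k : ℕ} (hk : k ≤ n) :
    ContMDiffAt 𝓘(ℝ, ℂ) 𝓘(ℝ, ℝ) ∞ (potential w k) x₀ := by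
  induction k with
  | zero => exact contMDiffAt_const.congr_of_eventuallyEq (Eventually.of_forall (potential_zero w))
  | succ k ih =>
    refine ContMDiffAt.congr_of_eventuallyEq ?_ (hs.eventually_potential_succ hw ⟨k, hk⟩)
    exact (ih (by omega)).sub (((hs.contMDiffAt_log_gramMinor h (by omega)).sub
      (hs.contMDiffAt_log_gramMinor h hk)).sub (hs.contMDiffAt_log_background_sq ht ⟨k, hk⟩))

/-- Each step of the recursion for u adds the background curvature (n + 1 - 2i)/2 with i = k + 1;
over i = 1, …, k these add up to k(n - k)/2. The Laplacian is halved because it carries 4/g where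
curvature carries 2/g. -/
theorem ddbar_log_gramMinor_eq_laplacian {k : ℕ} (hk : k ≤ n) :
    2 / g.density (chartAt ℂ x₀) x₀ *
      (ddbar (chartAt ℂ x₀) (fun y => Real.log (h.gramMinor s k y)) x₀ -
        ddbar (chartAt ℂ x₀) (fun y => Real.log (h.gramMinor s 0 y)) x₀) =
      (k : ℝ) * (n - k) / 2 + g.laplacian (potential w k) x₀ / 2 := by
  induction k with
  | zero =>
    rw [ConformalMetric.laplacian, ddbar_congr (f' := fun _ => 0)
      (Eventually.of_forall (potential_zero w)), ddbar_const]
    simp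
  | succ k ih =>
    have h1 := ih (by omega)
    have hsq := contDiffAt_two_of_contMDiffAt (hs.contMDiffAt_log_background_sq ht ⟨k, hk⟩)
    have hg0 := contDiffAt_two_of_contMDiffAt
      (hs.contMDiffAt_log_gramMinor h (show k ≤ n by omega))
    have hg1 := contDiffAt_two_of_contMDiffAt (hs.contMDiffAt_log_gramMinor h hk)
    have hu := contDiffAt_two_of_contMDiffAt (hs.contMDiffAt_potential hw (show k ≤ n by omega))
    have h2 := ddbar_congr (hs.eventually_potential_succ hw ⟨k, hk⟩)
    rw [ddbar_sub hu ((hg0.sub hg1).sub hsq), ddbar_sub (hg0.sub hg1) hsq, ddbar_sub hg0 hg1] at h2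
    have h3 := ht.curvature (k + 1) (Finset.mem_Icc.2 ⟨by omega, hk⟩) U _
      (hs.gradedFrame ⟨k, hk⟩) x₀ hs.mem
    rw [ConformalMetric.contractedCurvature] at h3
    rw [ConformalMetric.laplacian] at h1 ⊢
    simp only at h2 h3
    rw [h2]
    push_cast at h3 ⊢
    linear_combination h1 + h3

/-- The Toda-type operator and the curvature of `det (E / G_k)`. -/
theorem todaOperator_eq {k : ℕ} (hk1 : 1 ≤ k) (hkn : k < n) {V : Set X}
    {σ : Fin k → ∀ y, E y} (hxV : x₀ ∈ V)
    (hσ : IsHolomorphicFrame n (fun _ => ⊤) (θ.filtration k) V σ) :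
    todaOperator ht (potential w) k x₀ =
      -2 * (-h.detQuotCurvature θ g σ x₀ + θ.gammaNormSq g (h.gradedSq θ) k x₀) := by
  obtain ⟨k, rfl⟩ : ∃ l, k = l + 1 := ⟨k - 1, by omega⟩
  have hcurv := hs.detQuotCurvature_eq_gramMinor h g hkn.le hxV hσ
  rw [hs.ddbar_log_gramMinor_eq_laplacian hw hkn.le] at hcurv
  set a : Fin n := ⟨k, by omega⟩
  set b : Fin n := ⟨k + 1, hkn⟩
  obtain ⟨τ, v, hv, hτ⟩ := hs.exists_localEnd_eq (a := a) (b := b) rfl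
  have e1 := hs.gammaNormSq_eq g (N := h.gradedSq θ) (k := k + 1) (a := a) (b := b) rfl rfl
    (fun u _ u' hu' c => h.gradedSq_smul_add θ _ _ u hu' c)
    (fun u _ u' hu' c => h.gradedSq_smul_add θ _ _ u hu' c) hv hτ
  have e2 := hs.gammaNormSq_eq g (N := ht.sq) (k := k + 1) (a := a) (b := b) rfl rfl
    (fun u hu u' hu' c => ht.sq_smul_add (k + 1) (Finset.mem_Icc.2 ⟨by omega, by omega⟩) x₀ u hu
      u' hu' c)
    (fun u hu u' hu' c => ht.sq_smul_add (k + 1 + 1) (Finset.mem_Icc.2 ⟨by omega, by omega⟩) x₀ u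
      hu u' hu' c) hv hτ
  have e3 : h.gradedSq θ (k + 1) x₀ (s a x₀) =
      Real.exp (w (k + 1) x₀) * ht.sq (k + 1) x₀ (s a x₀) :=
    hw.gradedSq_eq a x₀ (hs.mem_filtration hs.mem le_rfl)
  have e4 : h.gradedSq θ (k + 1 + 1) x₀ (s b x₀) =
      Real.exp (w (k + 1 + 1) x₀) * ht.sq (k + 1 + 1) x₀ (s b x₀) :=
    hw.gradedSq_eq b x₀ (hs.mem_filtration hs.mem le_rfl)
  -- The second difference of u is w_{i+1} − w_i with i = k + 1, the logarithm of the factor by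
  -- which the quotient of the two line metrics in ‖γ_i‖² changes from h̃ to h.
  have e5 : 2 * potential w (k + 1) x₀ - potential w (k + 1 - 1) x₀ - potential w (k + 1 + 1) x₀ =
      w (k + 1 + 1) x₀ - w (k + 1) x₀ := by
    rw [Nat.add_sub_cancel, potential_succ w (k + 1), potential_succ w k]
    ring
  have hpos : 0 < ht.sq (k + 1) x₀ (s a x₀) := hs.background_sq_pos ht hs.mem a
  have hd := g.density_pos (mem_chart_source ℂ x₀)
  have e6 : θ.gammaNormSq g ht.sq (k + 1) x₀ * Real.exp (w (k + 1 + 1) x₀ - w (k + 1) x₀) =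
      θ.gammaNormSq g (h.gradedSq θ) (k + 1) x₀ := by
    rw [e1, e2, e3, e4, Real.exp_sub]
    have := (Real.exp_pos (w (k + 1) x₀)).ne'
    field_simp
  rw [todaOperator, e5, mul_assoc, e6, hcurv]
  push_cast
  ring

/-- In an adapted frame orthonormal at x₀ both determinants are 1 and every h_i is 1, so the product
of the e^{w_i} is 1. -/
theorem potential_rank_eq_zero (hdet : ht.DetEq h) : potential w n x₀ = 0 := by
  obtain ⟨s', hs', horth⟩ := hs.exists_orthonormal h
  have h1 := hdet x₀ (fun i => s' i x₀) fun i => hs'.mem_filtration hs'.mem le_rfl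
  have h2 : (Matrix.of fun i j => h.form x₀ (s' i x₀) (s' j x₀)) = 1 := by
    ext i j
    simp [horth, Matrix.one_apply]
  rw [h2, Matrix.det_one, Complex.one_re] at h1
  have h3 : ∏ i : Fin n, Real.exp (w (i + 1) x₀) = 1 := by
    rw [← mul_one (∏ i : Fin n, Real.exp (w (i + 1) x₀)), ← h1, ← Finset.prod_mul_distrib]
    rw [h1]
    exact Finset.prod_eq_one fun i _ => by
      rw [← hw.gradedSq_eq i x₀ (hs'.mem_filtration hs'.mem le_rfl), hs'.gradedSq_eq_one h horth]
  rw [← Real.exp_sum, Real.exp_eq_one_iff] at h3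
  rw [potential_eq_neg_sum_fin, h3, neg_zero]

end HiggsField.IsAdaptedFrame

end Background

/-! ### Harmonic metrics -/

section Harmonic

variable {X : Type*} [TopologicalSpace X] [ChartedSpace ℂ X]
  {n : ℕ} {E : X → Type*}
  [TopologicalSpace (TotalSpace (Fin n → ℂ) E)]
  [∀ x, TopologicalSpace (E x)] [∀ x, AddCommGroup (E x)] [∀ x, Module ℂ (E x)]
  [FiberBundle (Fin n → ℂ) E] [VectorBundle ℂ (Fin n → ℂ) E]
  [IsManifold 𝓘(ℂ, ℂ) ω X] [ContMDiffVectorBundle ω (Fin n → ℂ) E 𝓘(ℂ, ℂ)]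
  {θ : HiggsField n E} {x₀ : X} {U : Set X} {s : Fin n → ∀ y, E y} {h : HermitianMetric n E}

namespace HiggsField.IsAdaptedFrame

theorem exists_matrix (hs : θ.IsAdaptedFrame x₀ U s) : ∃ Θ : Matrix (Fin n) (Fin n) ℂ,
    ∀ j, θ.localEnd x₀ x₀ (s j x₀) = ∑ i, Θ i j • s i x₀ := by
  have := finiteDimensional_fiber n E x₀
  have hspan := (hs.frame.linearIndependent_vectors hs.mem).span_eq_top_of_card_eq_finrank'
    (by simp [finrank_fiber n E x₀])
  have hex : ∀ j, ∃ c : Fin n → ℂ, ∑ i, c i • s i x₀ = θ.localEnd x₀ x₀ (s j x₀) := fun j => by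
    rw [← Submodule.mem_span_range_iff_exists_fun ℂ, hspan]
    exact Submodule.mem_top
  choose c hc using hex
  exact ⟨Matrix.of fun i j => c j i, fun j => (hc j).symm⟩

/-- Orthonormality makes the induced norms on both lines equal to 1, which leaves the subdiagonal
entry of Θ. -/
theorem gammaNormSq_gradedSq_eq (hs : θ.IsAdaptedFrame x₀ U s) (g : ConformalMetric X)
    (horth : ∀ i j, h.form x₀ (s i x₀) (s j x₀) = if i = j then 1 else 0)
    {Θ : Matrix (Fin n) (Fin n) ℂ}
    (hΘ : ∀ j, θ.localEnd x₀ x₀ (s j x₀) = ∑ i, Θ i j • s i x₀) {a b : Fin n}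
    (hab : (a : ℕ) + 1 = b) :
    θ.gammaNormSq g (h.gradedSq θ) b x₀ =
      2 / g.density (chartAt ℂ x₀) x₀ * Complex.normSq (Θ b a) := by
  have hw : ∑ i ∈ Finset.univ.erase b, Θ i a • s i x₀ ∈ θ.filtration (b + 1) x₀ := by
    refine Submodule.sum_mem _ fun i hi => ?_
    rcases lt_or_ge (i : ℕ) (b + 1) with hlt | hge
    · have h2 := θ.field_mem_filtration a.2 (hs.mem_filtration hs.mem (le_refl (a : ℕ)))
        (coordVec (chartAt ℂ x₀) x₀)
      change θ.localEnd x₀ x₀ (s a x₀) ∈ _ at h2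
      rw [hΘ] at h2
      have hne : (i : ℕ) ≠ b := fun h => (Finset.mem_erase.1 hi).1 (Fin.ext h)
      rw [hs.coeff_eq_zero_of_sum_mem hs.mem h2 (by omega), zero_smul]
      exact Submodule.zero_mem _
    · exact Submodule.smul_mem _ _ (hs.mem_filtration hs.mem hge)
  have hτ : θ.localEnd x₀ x₀ (s a x₀) =
      Θ b a • s b x₀ + ∑ i ∈ Finset.univ.erase b, Θ i a • s i x₀ := by
    rw [hΘ]
    exact (Finset.add_sum_erase Finset.univ (fun i => Θ i a • s i x₀) (Finset.mem_univ b)).symm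
  have e := hs.gammaNormSq_eq g (N := h.gradedSq θ) (k := b) (a := a) (b := b) hab rfl
    (fun u _ u' hu' c => h.gradedSq_smul_add θ _ _ u hu' c)
    (fun u _ u' hu' c => h.gradedSq_smul_add θ _ _ u hu' c) hw hτ
  have h1 := hs.gradedSq_eq_one h horth a
  rw [hab] at h1
  rw [e, h1, hs.gradedSq_eq_one h horth b, Complex.normSq_eq_norm_sq]
  ring

/-- The curvature inequality for harmonic metrics. -/
theorem gammaNormSq_le_detQuotCurvature (hs : θ.IsAdaptedFrame x₀ U s) (g : ConformalMetric X)
    (hh : h.IsHarmonic θ) {k : ℕ} (hk1 : 1 ≤ k) (hkn : k < n) {V : Set X}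
    {σ : Fin k → ∀ y, E y} (hxV : x₀ ∈ V)
    (hσ : IsHolomorphicFrame n (fun _ => ⊤) (θ.filtration k) V σ) :
    θ.gammaNormSq g (h.gradedSq θ) k x₀ ≤ h.detQuotCurvature θ g σ x₀ := by
  obtain ⟨s', hs', horth⟩ := hs.exists_orthonormal h
  obtain ⟨Θ, hΘ⟩ := hs'.exists_matrix
  have hd := g.density_pos (mem_chart_source ℂ x₀)
  set a : Fin n := ⟨k - 1, by omega⟩ with ha
  set b : Fin n := ⟨k, hkn⟩ with hb
  have e := hs'.gammaNormSq_gradedSq_eq g horth hΘ (a := a) (b := b)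
    (show k - 1 + 1 = k by omega)
  change θ.gammaNormSq g (h.gradedSq θ) k x₀ = _ at e
  rw [e, hs'.detQuotCurvature_eq_of_isHarmonic h g hh horth hΘ hkn.le hxV hσ]
  refine mul_le_mul_of_nonneg_left ?_ (by positivity)
  have hnn : ∀ i j : Fin n, 0 ≤ if k ≤ (i : ℕ) ∧ ¬k ≤ (j : ℕ) then
      Complex.normSq (wirtinger (fun ζ => h.gram (chartAt ℂ x₀) s' ζ j i) (chartAt ℂ x₀ x₀)) +
        Complex.normSq (Θ i j) else 0 := by
    intro i j
    split_ifs
    · exact add_nonneg (Complex.normSq_nonneg _) (Complex.normSq_nonneg _)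
    · exact le_rfl
  -- Drop all of the nonnegative sum except the entry (k, k - 1), and there the second fundamental
  -- form as well.
  refine le_trans ?_ (Finset.single_le_sum (fun i _ => Finset.sum_nonneg fun j _ => hnn i j)
    (Finset.mem_univ b))
  refine le_trans ?_ (Finset.single_le_sum (fun j _ => hnn b j) (Finset.mem_univ a))
  have hba : k ≤ (b : ℕ) ∧ ¬k ≤ (a : ℕ) := ⟨le_rfl, by simp only [ha]; omega⟩
  rw [if_pos hba]
  exact le_add_of_nonneg_left (Complex.normSq_nonneg _)

end HiggsField.IsAdaptedFrame

/-! ### Complex variations of Hodge structure -/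

namespace HiggsField.IsCVHS

variable {L : Fin n → ∀ x, Submodule ℂ (E x)}

/-- Each application of θ raises the index by one, and the last line is killed. This gives both
nilpotency and the membership of s_i in ker θ^{n-i}. -/
theorem pow_apply_eq_zero (hL : θ.IsCVHS L) {y : X} (t : TangentSpace 𝓘(ℂ, ℂ) y) (m : ℕ)
    (i : Fin n) (hi : n ≤ i + m) {v : E y} (hv : v ∈ L i y) : (θ.field y t ^ m) v = 0 := by
  induction m generalizing i v with
  | zero => exact absurd i.2 (by omega)
  | succ m ih =>
    rw [pow_succ, Module.End.mul_apply]
    by_cases hin : (i : ℕ) + 1 < n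
    · exact ih ⟨i + 1, hin⟩ (by simp only; omega) (hL.map i ⟨i + 1, hin⟩ rfl y t v hv)
    · rw [hL.map_last i (by omega) y t v hv, map_zero]

theorem pow_rank_eq_zero (hL : θ.IsCVHS L) (y : X) (t : TangentSpace 𝓘(ℂ, ℂ) y) :
    θ.field y t ^ n = 0 := by
  have htop : (⨆ i, L i y) ≤ LinearMap.ker (θ.field y t ^ n) :=
    iSup_le fun i v hv => hL.pow_apply_eq_zero t n i (by omega) hv
  rw [(hL.internal y).submodule_iSup_eq_top, top_le_iff, LinearMap.ker_eq_top] at htop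
  exact htop

theorem exists_frame (hL : θ.IsCVHS L) (x₀ : X) :
    ∃ U, ∃ s : Fin n → ∀ y, E y, x₀ ∈ U ∧
      IsHolomorphicFrame n (fun _ => ⊤) (fun _ => ⊥) U s ∧
      ∀ y ∈ U, ∀ i, s i y ∈ L i y ∧ L i y ≤ Submodule.span ℂ {s i y} := by
  choose V σ hxV hσ using fun i => hL.line i x₀
  have hUo : IsOpen (⋂ i, V i) := isOpen_iInter_of_finite fun i => (hσ i).isOpen
  refine ⟨⋂ i, V i, fun i => σ i 0, mem_iInter.2 hxV, isHolomorphicFrame_of_linearIndependent hUo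
    (fun i => ((hσ i).holomorphic 0).mono (iInter_subset V i)) fun y hy => ?_, fun y hy i =>
    ⟨(hσ i).mem 0 y (mem_iInter.1 hy i), ?_⟩⟩
  · refine (hL.internal y).submodule_iSupIndep.linearIndependent _
      (fun i => (hσ i).mem 0 y (mem_iInter.1 hy i)) fun i => ?_
    exact ((hσ i).linearIndependent_vectors (mem_iInter.1 hy i)).ne_zero 0
  · have h1 := (hσ i).span y (mem_iInter.1 hy i)
    rw [Set.range_unique, sup_bot_eq] at h1
    exact h1

/-- For a local frame s_i of L i, θ(∂/∂z) s_i is a holomorphic section, so its zeros are isolated or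
it vanishes identically; connectedness excludes the latter. -/
theorem eventually_apply_ne_zero [PreconnectedSpace X] (hL : θ.IsCVHS L) (i : Fin n)
    (hi : (i : ℕ) + 1 < n) (x₀ : X) :
    ∀ᶠ y in 𝓝[≠] x₀, ¬∀ t, ∀ v ∈ L i y, θ.field y t v = 0 := by
  refine eventually_not_of_connected (P := fun y => ∀ t, ∀ v ∈ L i y, θ.field y t v = 0)
    (fun x => ?_) ?_ x₀
  · obtain ⟨U, s, hxU, hs, hsL⟩ := hL.exists_frame x
    have hU : IsOpen (U ∩ (chartAt ℂ x).source) := hs.isOpen.inter (chartAt ℂ x).open_source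
    have hx : x ∈ U ∩ (chartAt ℂ x).source := ⟨hxU, mem_chart_source ℂ x⟩
    have h1 := θ.isHolomorphicOn_localEnd_pow hU inter_subset_right
      ((hs.holomorphic i).mono inter_subset_left) 1
    simp only [pow_one] at h1
    refine (h1.eventually_eq_zero_or hU hx).imp (fun h2 => ?_) fun h2 => ?_
    · filter_upwards [h2, hU.mem_nhds hx] with y h3 hy t v hv
      obtain ⟨c, rfl⟩ := Submodule.mem_span_singleton.1 ((hsL y hy.1 i).2 hv)
      obtain ⟨d, hd⟩ := θ.exists_field_eq_smul hy.2 t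
      rw [hd, LinearMap.smul_apply, map_smul, h3, smul_zero, smul_zero]
    · filter_upwards [h2, nhdsWithin_le_nhds (hU.mem_nhds hx)] with y h3 hy h4
      exact h3 (h4 _ _ (hsL y hy.1 i).1)
  · obtain ⟨x, t, v, hv, hne⟩ := hL.ne_zero i hi
    exact ⟨x, fun h => hne (h t v hv)⟩

theorem localEnd_pow_apply_ne_zero (hL : θ.IsCVHS L) {x₀ y : X} {v : Fin n → E y}
    (hv : ∀ i, v i ∈ L i y ∧ L i y ≤ Submodule.span ℂ {v i})
    (hne : ∀ i : Fin n, (i : ℕ) + 1 < n → θ.localEnd x₀ y (v i) ≠ 0) (m : ℕ) (hm : m + 1 < n) :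
    ∃ c : ℂ, c ≠ 0 ∧ (θ.localEnd x₀ y ^ (m + 1)) (v ⟨0, by omega⟩) = c • v ⟨m + 1, hm⟩ := by
  have hstep : ∀ l (hl : l + 1 < n), ∃ c : ℂ, c ≠ 0 ∧
      θ.localEnd x₀ y (v ⟨l, by omega⟩) = c • v ⟨l + 1, hl⟩ := by
    intro l hl
    have h1 := hL.map ⟨l, by omega⟩ ⟨l + 1, hl⟩ rfl y (coordVec (chartAt ℂ x₀) y) _ (hv _).1
    obtain ⟨c, hc⟩ := Submodule.mem_span_singleton.1 ((hv _).2 h1)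
    refine ⟨c, ?_, hc.symm⟩
    rintro rfl
    exact hne ⟨l, by omega⟩ hl (by rw [localEnd, ← hc, zero_smul])
  induction m with
  | zero => simpa using hstep 0 hm
  | succ m ih =>
    obtain ⟨c, hc, h1⟩ := ih (by omega) hstep
    obtain ⟨d, hd, h2⟩ := hstep (m + 1) hm
    refine ⟨c * d, mul_ne_zero hc hd, ?_⟩
    rw [pow_succ', Module.End.mul_apply, h1, map_smul, h2, smul_smul]

/-- Off isolated points all arrows L i → L (i + 1) are isomorphisms, so their composite θ^{n-1} is
non-zero: generic regular nilpotency is derived here, and frames of the lines themselves are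
adapted. -/
theorem exists_isAdaptedFrame [PreconnectedSpace X] (hL : θ.IsCVHS L) (x₀ : X) :
    ∃ U s, θ.IsAdaptedFrame x₀ U s ∧
      ∀ y ∈ U, ∀ i, s i y ∈ L i y ∧ L i y ≤ Submodule.span ℂ {s i y} := by
  obtain ⟨U, s, hxU, hs, hsL⟩ := hL.exists_frame x₀
  -- For n = 0 the power n - 1 is 0 in ℕ and the identity of the zero fibre is zero, so the
  -- non-vanishing below would fail; the claim is then trivial.
  rcases Nat.eq_zero_or_pos n with rfl | hn
  · refine ⟨U, s, ⟨hxU, hs, fun y _ k => ?_⟩, hsL⟩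
    have := finiteDimensional_fiber 0 E y
    have : Subsingleton (E y) := Module.finrank_zero_iff.1 (finrank_fiber 0 E y)
    exact Subsingleton.elim _ _
  have hne : ∀ᶠ y in 𝓝[≠] x₀, ∃ t, θ.field y t ^ (n - 1) ≠ 0 := by
    have h1 : ∀ᶠ y in 𝓝[≠] x₀, ∀ i : Fin n, (i : ℕ) + 1 < n →
        ¬∀ t, ∀ v ∈ L i y, θ.field y t v = 0 := by
      refine eventually_all.2 fun i => ?_
      by_cases hi : (i : ℕ) + 1 < n
      · filter_upwards [hL.eventually_apply_ne_zero i hi x₀] with y h2 _ using h2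
      · exact Eventually.of_forall fun y h => absurd h hi
    filter_upwards [h1, nhdsWithin_le_nhds (hs.isOpen.mem_nhds hxU),
      nhdsWithin_le_nhds ((chartAt ℂ x₀).open_source.mem_nhds (mem_chart_source ℂ x₀))]
      with y h2 hy hyc
    refine ⟨coordVec (chartAt ℂ x₀) y, fun h0 => ?_⟩
    have h3 : ∀ i : Fin n, (i : ℕ) + 1 < n → θ.localEnd x₀ y (s i y) ≠ 0 := by
      intro i hi h4
      refine h2 i hi fun t v hv => ?_
      obtain ⟨c, rfl⟩ := Submodule.mem_span_singleton.1 ((hsL y hy i).2 hv)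
      obtain ⟨d, hd⟩ := θ.exists_field_eq_smul hyc t
      rw [hd, LinearMap.smul_apply, map_smul, h4, smul_zero, smul_zero]
    have hli := hs.linearIndependent_vectors hy
    rcases Nat.lt_or_ge 1 n with hn1 | hn1
    · obtain ⟨c, hc, h5⟩ := hL.localEnd_pow_apply_ne_zero (x₀ := x₀) (hsL y hy) h3 (n - 2) (by omega)
      have h6 : θ.localEnd x₀ y ^ (n - 2 + 1) = 0 := by
        rw [show n - 2 + 1 = n - 1 by omega]
        exact h0
      rw [h6, LinearMap.zero_apply] at h5
      exact smul_ne_zero hc (hli.ne_zero _) h5.symm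
    · have h5 := LinearMap.congr_fun h0 (s ⟨0, hn⟩ y)
      rw [show n - 1 = 0 by omega, pow_zero] at h5
      exact hli.ne_zero _ h5
  obtain ⟨V, hV⟩ := exists_isAdaptedFrame_of_ker hL.pow_rank_eq_zero hne hs hxU
    fun i y hy t => hL.pow_apply_eq_zero t _ i (by omega) (hsL y hy i).1
  refine ⟨V ∩ U, s, ⟨⟨hV.mem, hxU⟩, hs.mono (hV.frame.isOpen.inter hs.isOpen) inter_subset_right,
    fun y hy k => hV.filtration_eq y hy.1 k⟩, fun y hy => hsL y hy.2⟩

/-- The lines are already orthogonal, so constant rescaling suffices; unlike general Gram–Schmidt it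
keeps s_i inside L i on the whole neighbourhood. -/
theorem exists_orthonormal_isAdaptedFrame [PreconnectedSpace X] (hL : θ.IsCVHS L)
    (hdiag : h.IsDiagonal L) (x₀ : X) :
    ∃ U s, θ.IsAdaptedFrame x₀ U s ∧
      (∀ y ∈ U, ∀ i, s i y ∈ L i y ∧ L i y ≤ Submodule.span ℂ {s i y}) ∧
      ∀ i j, h.form x₀ (s i x₀) (s j x₀) = if i = j then 1 else 0 := by
  obtain ⟨U, s, hs, hsL⟩ := hL.exists_isAdaptedFrame x₀
  have hpos : ∀ i, 0 < (h.form x₀ (s i x₀) (s i x₀)).re := fun i =>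
    h.pos x₀ _ ((hs.frame.linearIndependent_vectors hs.mem).ne_zero i)
  set r : Fin n → ℂ := fun i => ((Real.sqrt (h.form x₀ (s i x₀) (s i x₀)).re : ℝ) : ℂ) with hr
  have hr0 : ∀ i, r i ≠ 0 := fun i => by
    simpa [hr] using (Real.sqrt_pos.2 (hpos i)).ne'
  have ht := hs.triangular (T := Matrix.diagonal fun i => (r i)⁻¹)
    (fun i j hij => Matrix.diagonal_apply_ne _ hij.ne') (fun i => by simpa using hr0 i)
  have hT : ∀ (i : Fin n) (y : X),
      ∑ j, (Matrix.diagonal fun i => (r i)⁻¹) i j • s j y = (r i)⁻¹ • s i y := by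
    intro i y
    simp [Matrix.diagonal_apply]
  simp only [hT] at ht
  refine ⟨U, _, ht, fun y hy i => ⟨Submodule.smul_mem _ _ (hsL y hy i).1, ?_⟩, fun i j => ?_⟩
  · rw [Submodule.span_singleton_smul_eq (IsUnit.mk0 _ (inv_ne_zero (hr0 i)))]
    exact (hsL y hy i).2
  · simp only [map_smulₛₗ, LinearMap.smul_apply, smul_eq_mul, RingHom.id_apply]
    by_cases hij : i = j
    · subst hij
      have h1 : h.form x₀ (s i x₀) (s i x₀) = r i * r i := by
        rw [← Complex.ofReal_mul, Real.mul_self_sqrt (hpos i).le]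
        exact Complex.ext rfl (h.form_self_im _)
      have h2 : (starRingEnd ℂ) (r i) = r i := Complex.conj_ofReal _
      have h3 := hr0 i
      rw [h1, map_inv₀, h2, if_pos rfl]
      field_simp
    · rw [hdiag i j hij x₀ _ (hsL x₀ hs.mem i).1 _ (hsL x₀ hs.mem j).1]
      simp [hij]

/-- Equality of curvatures for diagonal harmonic metrics on a complex variation of Hodge
structure. -/
theorem gammaNormSq_eq_detQuotCurvature [PreconnectedSpace X] (hL : θ.IsCVHS L)
    (hdiag : h.IsDiagonal L) (g : ConformalMetric X)
    (hh : h.IsHarmonic θ) {k : ℕ} (hk1 : 1 ≤ k) (hkn : k < n) {V : Set X}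
    {σ : Fin k → ∀ y, E y} (hxV : x₀ ∈ V)
    (hσ : IsHolomorphicFrame n (fun _ => ⊤) (θ.filtration k) V σ) :
    θ.gammaNormSq g (h.gradedSq θ) k x₀ = h.detQuotCurvature θ g σ x₀ := by
  obtain ⟨U, s, hs, hsL, horth⟩ := hL.exists_orthonormal_isAdaptedFrame hdiag x₀
  obtain ⟨Θ, hΘ⟩ := hs.exists_matrix
  set a : Fin n := ⟨k - 1, by omega⟩ with ha
  set b : Fin n := ⟨k, hkn⟩ with hb
  have e := hs.gammaNormSq_gradedSq_eq g horth hΘ (a := a) (b := b) (show k - 1 + 1 = k by omega)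
  change θ.gammaNormSq g (h.gradedSq θ) k x₀ = _ at e
  have hΘ0 : ∀ i j : Fin n, (i : ℕ) ≠ j + 1 → Θ i j = 0 := by
    intro i j hij
    have hli := Fintype.linearIndependent_iff.1 (hs.frame.linearIndependent_vectors hs.mem)
    have h1 : ∃ c : Fin n → ℂ, (∀ l : Fin n, (l : ℕ) ≠ j + 1 → c l = 0) ∧
        θ.localEnd x₀ x₀ (s j x₀) = ∑ l, c l • s l x₀ := by
      by_cases hj : (j : ℕ) + 1 < n
      · have h2 := hL.map j ⟨j + 1, hj⟩ rfl x₀ (coordVec (chartAt ℂ x₀) x₀) _ (hsL x₀ hs.mem j).1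
        obtain ⟨c, hc⟩ := Submodule.mem_span_singleton.1 ((hsL x₀ hs.mem _).2 h2)
        refine ⟨Pi.single ⟨j + 1, hj⟩ c, fun l hl => ?_, ?_⟩
        · exact Pi.single_eq_of_ne (fun h => hl (congrArg Fin.val h)) _
        · rw [Finset.sum_eq_single ⟨j + 1, hj⟩ (fun l _ hl => by
            rw [Pi.single_eq_of_ne hl, zero_smul]) (by simp), Pi.single_eq_same, hc]
          rfl
      · refine ⟨0, fun _ _ => rfl, ?_⟩
        rw [show θ.localEnd x₀ x₀ (s j x₀) = 0 from
          hL.map_last j (by omega) x₀ _ _ (hsL x₀ hs.mem j).1]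
        simp
    obtain ⟨c, hc0, hc⟩ := h1
    rw [hΘ] at hc
    have := hli (fun l => Θ l j - c l) (by
      simp only [sub_smul, Finset.sum_sub_distrib, hc, sub_self]) i
    simp only [hc0 i hij, sub_zero] at this
    exact this
  -- The off-diagonal Gram entries vanish near x₀, not merely at x₀, so the lines have no second
  -- fundamental form.
  have hH0 : ∀ i j : Fin n, i ≠ j →
      wirtinger (fun ζ => h.gram (chartAt ℂ x₀) s ζ j i) (chartAt ℂ x₀ x₀) = 0 := by
    intro i j hij
    rw [wirtinger_eq, complexDirDeriv.congr (g := fun _ => 0), complexDirDeriv.const]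
    filter_upwards [(tendsto_chart_symm x₀).eventually hs.eventually_mem] with ζ hζ
    exact hdiag j i hij.symm _ _ (hsL _ hζ j).1 _ (hsL _ hζ i).1
  rw [e, hs.detQuotCurvature_eq_of_isHarmonic h g hh horth hΘ hkn.le hxV hσ]
  congr 1
  symm
  rw [Finset.sum_eq_single b, Finset.sum_eq_single a]
  · have hba : k ≤ (b : ℕ) ∧ ¬k ≤ (a : ℕ) := ⟨le_rfl, by simp only [ha]; omega⟩
    have hne : b ≠ a := fun h => hba.2 (h ▸ hba.1)
    rw [if_pos hba, hH0 b a hne, map_zero, zero_add]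
  · intro j _ hj
    split_ifs with hc
    · rw [hH0 b j (fun h => hc.2 (h ▸ hc.1)), hΘ0 b j (fun h => hj (Fin.ext (by
        simp only [hb, ha] at h ⊢; omega)))]
      simp
    · rfl
  · simp
  · intro i _ hi
    refine Finset.sum_eq_zero fun j _ => ?_
    split_ifs with hc
    · have h1 : (i : ℕ) ≠ k := fun h => hi (Fin.ext h)
      rw [hH0 i j (fun h => hc.2 (h ▸ hc.1)), hΘ0 i j (by omega)]
      simp
    · rfl
  · simp

end HiggsField.IsCVHS

end Harmonic

end HiggsBundle

end

/-! ### The theorem: assembly from adapted frames at each point -/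

theorem proposition3p1 {X : Type*} [TopologicalSpace X] [T2Space X] [ConnectedSpace X]
    [NoncompactSpace X] [ChartedSpace ℂ X] [IsManifold 𝓘(ℂ, ℂ) ω X]
    (g : HiggsBundle.ConformalMetric X) (hg : g.IsCompleteHyperbolic)
    {n : ℕ} {E : X → Type*} [TopologicalSpace (TotalSpace (Fin n → ℂ) E)]
    [∀ x, TopologicalSpace (E x)] [∀ x, AddCommGroup (E x)] [∀ x, Module ℂ (E x)]
    [FiberBundle (Fin n → ℂ) E] [VectorBundle ℂ (Fin n → ℂ) E]
    [ContMDiffVectorBundle ω (Fin n → ℂ) E 𝓘(ℂ, ℂ)]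
    (θ : HiggsBundle.HiggsField n E) (h : HiggsBundle.HermitianMetric n E) :
    -- the inequality for harmonic metrics, on `det (E / G_k)` and for the functions `u_i`
    (θ.IsGenericallyRegularNilpotent → h.IsHarmonic θ →
      (∀ k ∈ Finset.Icc 1 (n - 1), ∀ x,
        (∃ (U : Set X) (s : Fin k → ∀ y, E y), x ∈ U ∧
          HiggsBundle.IsHolomorphicFrame n (fun _ => ⊤) (θ.filtration k) U s) ∧
        ∀ (U : Set X) (s : Fin k → ∀ y, E y), x ∈ U →
          HiggsBundle.IsHolomorphicFrame n (fun _ => ⊤) (θ.filtration k) U s →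
          -h.detQuotCurvature θ g s x + θ.gammaNormSq g (h.gradedSq θ) k x ≤ 0) ∧
      ∀ (ht : HiggsBundle.BackgroundMetric θ g) (w : ℕ → X → ℝ),
        ht.DetEq h → ht.IsConformalFactor h w →
        (∀ i ≤ n, ContMDiff 𝓘(ℝ, ℂ) 𝓘(ℝ, ℝ) ∞ (HiggsBundle.potential w i)) ∧
        (∀ x, HiggsBundle.potential w 0 x = 0) ∧ (∀ x, HiggsBundle.potential w n x = 0) ∧
        ∀ i ∈ Finset.Icc 1 (n - 1), ∀ x,
          0 ≤ HiggsBundle.todaOperator ht (HiggsBundle.potential w) i x) ∧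
    -- equality for diagonal harmonic metrics on a complex variation of Hodge structure
    (∀ L : Fin n → ∀ x, Submodule ℂ (E x), θ.IsCVHS L → h.IsHarmonic θ → h.IsDiagonal L →
      (∀ k ∈ Finset.Icc 1 (n - 1), ∀ x,
        (∃ (U : Set X) (s : Fin k → ∀ y, E y), x ∈ U ∧
          HiggsBundle.IsHolomorphicFrame n (fun _ => ⊤) (θ.filtration k) U s) ∧
        ∀ (U : Set X) (s : Fin k → ∀ y, E y), x ∈ U →
          HiggsBundle.IsHolomorphicFrame n (fun _ => ⊤) (θ.filtration k) U s →
          -h.detQuotCurvature θ g s x + θ.gammaNormSq g (h.gradedSq θ) k x = 0) ∧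
      ∀ (ht : HiggsBundle.BackgroundMetric θ g) (w : ℕ → X → ℝ),
        ht.DetEq h → ht.IsConformalFactor h w →
        (∀ i ≤ n, ContMDiff 𝓘(ℝ, ℂ) 𝓘(ℝ, ℝ) ∞ (HiggsBundle.potential w i)) ∧
        (∀ x, HiggsBundle.potential w 0 x = 0) ∧ (∀ x, HiggsBundle.potential w n x = 0) ∧
        ∀ i ∈ Finset.Icc 1 (n - 1), ∀ x,
          HiggsBundle.todaOperator ht (HiggsBundle.potential w) i x = 0) ∧
    -- the two forms are equivalent, for every Hermitian metric
    (θ.IsGenericallyRegularNilpotent →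
      ∀ (ht : HiggsBundle.BackgroundMetric θ g) (w : ℕ → X → ℝ),
        ht.DetEq h → ht.IsConformalFactor h w →
        ∀ k ∈ Finset.Icc 1 (n - 1), ∀ x, ∀ (U : Set X) (s : Fin k → ∀ y, E y), x ∈ U →
          HiggsBundle.IsHolomorphicFrame n (fun _ => ⊤) (θ.filtration k) U s →
          (-h.detQuotCurvature θ g s x + θ.gammaNormSq g (h.gradedSq θ) k x ≤ 0 ↔
            0 ≤ HiggsBundle.todaOperator ht (HiggsBundle.potential w) k x) ∧
          (-h.detQuotCurvature θ g s x + θ.gammaNormSq g (h.gradedSq θ) k x = 0 ↔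
            HiggsBundle.todaOperator ht (HiggsBundle.potential w) k x = 0)) := by
  have hk0 {k : ℕ} (hk : k ∈ Finset.Icc 1 (n - 1)) : 1 ≤ k ∧ k < n := by
    rw [Finset.mem_Icc] at hk
    omega
  refine ⟨fun hθ hh => ⟨fun k hk x => ?_, fun ht w hdet hw => ⟨fun i hi x => ?_,
    fun x => HiggsBundle.potential_zero w x, fun x => ?_, fun k hk x => ?_⟩⟩,
    fun L hL hh hdiag => ⟨fun k hk x => ?_, fun ht w hdet hw => ⟨fun i hi x => ?_,
    fun x => HiggsBundle.potential_zero w x, fun x => ?_, fun k hk x => ?_⟩⟩,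
    fun hθ ht w _ hw k hk x V σ hxV hσ => ?_⟩
  · obtain ⟨hk1, hkn⟩ := hk0 hk
    obtain ⟨U, s, hs⟩ := hθ.exists_isAdaptedFrame x
    refine ⟨⟨U, _, hs.mem, hs.quotientFrame hkn.le⟩, fun V σ hxV hσ => ?_⟩
    linarith [hs.gammaNormSq_le_detQuotCurvature g hh hk1 hkn hxV hσ]
  · obtain ⟨U, s, hs⟩ := hθ.exists_isAdaptedFrame x
    exact hs.contMDiffAt_potential hw hi
  · obtain ⟨U, s, hs⟩ := hθ.exists_isAdaptedFrame x
    exact hs.potential_rank_eq_zero hw hdet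
  · obtain ⟨hk1, hkn⟩ := hk0 hk
    obtain ⟨U, s, hs⟩ := hθ.exists_isAdaptedFrame x
    rw [hs.todaOperator_eq hw hk1 hkn hs.mem (hs.quotientFrame hkn.le)]
    linarith [hs.gammaNormSq_le_detQuotCurvature g hh hk1 hkn hs.mem (hs.quotientFrame hkn.le)]
  · obtain ⟨hk1, hkn⟩ := hk0 hk
    obtain ⟨U, s, hs, -⟩ := hL.exists_isAdaptedFrame x
    refine ⟨⟨U, _, hs.mem, hs.quotientFrame hkn.le⟩, fun V σ hxV hσ => ?_⟩
    linarith [hL.gammaNormSq_eq_detQuotCurvature hdiag g hh hk1 hkn hxV hσ]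
  · obtain ⟨U, s, hs, -⟩ := hL.exists_isAdaptedFrame x
    exact hs.contMDiffAt_potential hw hi
  · obtain ⟨U, s, hs, -⟩ := hL.exists_isAdaptedFrame x
    exact hs.potential_rank_eq_zero hw hdet
  · obtain ⟨hk1, hkn⟩ := hk0 hk
    obtain ⟨U, s, hs, -⟩ := hL.exists_isAdaptedFrame x
    rw [hs.todaOperator_eq hw hk1 hkn hs.mem (hs.quotientFrame hkn.le)]
    linarith [hL.gammaNormSq_eq_detQuotCurvature hdiag g hh hk1 hkn hs.mem
      (hs.quotientFrame hkn.le)]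
  · obtain ⟨hk1, hkn⟩ := hk0 hk
    obtain ⟨U, s, hs⟩ := hθ.exists_isAdaptedFrame x
    rw [hs.todaOperator_eq hw hk1 hkn hxV hσ]
    constructor <;> constructor <;> intro _ <;> linarith
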